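/- **Setting.** Let $G$ be a locally profinite group, $L\subset G$ a closed subgroup and $(\sigma,V)$ a complex representation of $L$. (The case of interest: $G$ is a reductive $p$-adic group, $L$ a Levi subgroup and $\sigma$ a unitary supercuspidal representation of $L$.) Let $X_{\mathrm{nr}}^u(L)$ be the compact group of unitary unramified characters of $L$, that is, of the homomorphisms $L\to S^1$ that are trivial on every compact subgroup of $L$, with the topology of pointwise convergence. Write $\mathfrak s=[L,\sigma]$ and let $W_{\mathfrak s}^e$ be the group of homeomorphisms of $X_{\mathrm{nr}}^u(L)$ generated by the maps $\chi\mapsto\chi_1\otimes(n\cdot\chi)$, where $n\in N_G(L)$ and $\chi_1\in X_{\mathrm{nr}}^u(L)$ are such that $n\cdot\sigma\cong\sigma\otimes\chi_1$. Suppose that $W_{\mathfrak s}^e$ is finite (as it is in the case of interest). Let $\natural_{\mathfrak s}:W_{\mathfrak s}^e\times W_{\mathfrak s}^e\to\mathbb C^\times$ be any 2-cocycle with $\natural_{\mathfrak s}(1,1)=1$. For a finite group $\Gamma$ acting on a unital $C^*$-algebra $D$ and a normalized 2-cocycle $\natural:\Gamma\times\Gamma\to\mathbb C^\times$, the twisted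 crossed product $D\rtimes\mathbb C[\Gamma,\natural]$ consists of the sums $\sum_{w\in\Gamma}d_wT_w$ with $d_w\in D$, multiplied by $(d_1T_u)(d_2T_v)=\natural(u,v)\,d_1u(d_2)\,T_{uv}$; for $D=\mathbb C$ this is the twisted group algebra $\mathbb C[\Gamma,\natural]$. It is a $C^*$-algebra, for the involution that extends the one of $D$ and makes every $s(w)^{-1}T_w$ unitary, where $s(w)=\prod_{v\in\Gamma}|\natural(w,v)|^{1/|\Gamma|}$ (so $s=1$ if $|\natural|=1$). Put $$A=C(X_{\mathrm{nr}}^u(L))\rtimes\mathbb C[W_{\mathfrak s}^e,\natural_{\mathfrak s}^{-1}],\qquad X=X_{\mathrm{nr}}^u(L)/W_{\mathfrak s}^e .$$ The algebra $C(X)$ acts on $A$ via pullback of functions to $X_{\mathrm{nr}}^u(L)$. For $Z\subset X$ let $C_0(X,Z)\subset C(X)$ be the ideal of functions vanishing on $Z$, and let $C_0(X,Z)A$ be the closed ideal of $A$ spanned by the products $fa$ with $f\in C_0(X,Z)$, $a\in A$. For $Z\subset\tau\subset X$ let $C_0(\tau,Z)$ be the algebra of continuous functions on $\tau$ vanishing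 on $Z$. Fix a $W_{\mathfrak s}^e$-equivariant triangulation of $X_{\mathrm{nr}}^u(L)$: a homeomorphism with a finite simplicial complex such that $W_{\mathfrak s}^e$ acts simplicially and all points in the interior of one simplex have the same stabilizer in $W_{\mathfrak s}^e$. Let $\tau'$ be a simplex of it, with boundary $\partial\tau'$ and stabilizer $W_{\mathfrak s,\tau'}^e$, and let $\tau$ and $\partial\tau$ be the images of $\tau'$ and $\partial\tau'$ in $X$. **Lemma.** The $C^*$-algebra $C_0(X,\partial\tau)A/C_0(X,\tau)A$ is (strongly) Morita equivalent to $C_0(\tau,\partial\tau)\otimes\mathbb C[W_{\mathfrak s,\tau'}^e,\natural_{\mathfrak s}^{-1}]$, and for $i=0,1$ there is an isomorphism of abelian groups $$K_i\big(C_0(X,\partial\tau)A/C_0(X,\tau)A\big)\;\cong\;K_i\big(C_0(\tau,\partial\tau)\big)\otimes_{\mathbb Z}R\big(\mathbb C[W_{\mathfrak s,\tau'}^e,\natural_{\mathfrak s}^{-1}]\big).$$ Here $K_i$ is topological K-theory and $R(B)$ is the Grothendieck group of the category of finite dimensional representations of $B$. -/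

import Mathlib

open scoped Pointwise TensorProduct

set_option linter.unusedSectionVars false

noncomputable section

/-! ### Twisted group algebras and twisted crossed products of finite groups -/

/-- Normalized 2-cocycles `♮ : Γ × Γ → ℂˣ`. -/
structure TwoCocycle (Γ : Type*) [Group Γ] where
  toFun : Γ → Γ → ℂˣ
  one_one : toFun 1 1 = 1
  cocycle : ∀ u v w, toFun (u * v) w * toFun u v = toFun u (v * w) * toFun v w

namespace TwoCocycle

variable {Γ : Type*} [Group Γ]

instance : CoeFun (TwoCocycle Γ) (fun _ => Γ → Γ → ℂˣ) := ⟨toFun⟩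

/-- The pointwise inverse `♮⁻¹`. -/
instance : Inv (TwoCocycle Γ) where
  inv c :=
    { toFun := fun u v => (c u v)⁻¹
      one_one := by simp [c.one_one]
      cocycle := fun u v w => by
        rw [← mul_inv, ← mul_inv, c.cocycle] }

/-- Restriction of a cocycle to a subgroup. -/
def restrict (c : TwoCocycle Γ) (H : Subgroup Γ) : TwoCocycle H where
  toFun u v := c u v
  one_one := by simpa using c.one_one
  cocycle u v w := by simpa using c.cocycle u v w

theorem one_left (c : TwoCocycle Γ) (w : Γ) : c 1 w = 1 := by
  have h := c.cocycle 1 1 w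
  simp only [one_mul, mul_one, c.one_one] at h
  exact (mul_eq_right.mp h.symm)

theorem one_right (c : TwoCocycle Γ) (w : Γ) : c w 1 = 1 := by
  have h := c.cocycle w 1 1
  simp only [mul_one, c.one_one] at h
  exact (mul_eq_right.mp h)

variable [Finite Γ]

attribute [local instance] Fintype.ofFinite

/-- The positive scalars `s(w) = (∏ᵥ |♮(w, v)|) ^ (1 / |Γ|)`. They are characterized by
`|♮(u, v)| s(uv) = s(u) s(v)`; when `♮` has values in the unit circle, `s = 1`. -/
def scale (c : TwoCocycle Γ) (w : Γ) : ℝ :=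
  (∏ v : Γ, ‖(c w v : ℂ)‖) ^ ((Nat.card Γ : ℝ)⁻¹)

theorem scale_pos (c : TwoCocycle Γ) (w : Γ) : 0 < c.scale w :=
  Real.rpow_pos_of_pos (Finset.prod_pos fun v _ => by simp) _

theorem scale_mul (c : TwoCocycle Γ) (u v : Γ) :
    ‖(c u v : ℂ)‖ * c.scale (u * v) = c.scale u * c.scale v := by
  have hpos : ∀ a b : Γ, 0 < ‖(c a b : ℂ)‖ := fun a b => by simp
  have hP : ∀ a, 0 ≤ ∏ v : Γ, ‖(c a v : ℂ)‖ := fun a =>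
    Finset.prod_nonneg fun v _ => norm_nonneg _
  have key : ‖(c u v : ℂ)‖ ^ (Nat.card Γ) * ∏ w : Γ, ‖(c (u * v) w : ℂ)‖ =
      (∏ w : Γ, ‖(c u w : ℂ)‖) * ∏ w : Γ, ‖(c v w : ℂ)‖ := by
    have h1 : (∏ w : Γ, ‖(c u w : ℂ)‖) = ∏ w : Γ, ‖(c u (v * w) : ℂ)‖ :=
      (Equiv.prod_comp (Equiv.mulLeft v) fun w => ‖(c u w : ℂ)‖).symm
    rw [h1, Nat.card_eq_fintype_card, ← Finset.card_univ, ← Finset.prod_const,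
      ← Finset.prod_mul_distrib, ← Finset.prod_mul_distrib]
    refine Finset.prod_congr rfl fun w _ => ?_
    rw [← norm_mul, ← norm_mul, ← Units.val_mul, ← Units.val_mul, ← c.cocycle, mul_comm]
  have h0 : ‖(c u v : ℂ)‖ = (‖(c u v : ℂ)‖ ^ (Nat.card Γ)) ^ ((Nat.card Γ : ℝ)⁻¹) :=
    (Real.pow_rpow_inv_natCast (norm_nonneg _) Nat.card_pos.ne').symm
  unfold scale
  conv_lhs => rw [h0]
  rw [← Real.mul_rpow (pow_nonneg (norm_nonneg _) _) (hP _), key, Real.mul_rpow (hP _) (hP _)]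

theorem scale_one (c : TwoCocycle Γ) : c.scale 1 = 1 := by
  have := c.scale_mul 1 1
  simp only [c.one_one, mul_one, Units.val_one, norm_one, one_mul] at this
  have h := c.scale_pos 1
  exact (mul_eq_left₀ h.ne').mp this.symm

end TwoCocycle

/-- The twisted crossed product `D ⋊ ℂ[Γ, ♮]` of a unital C⋆-algebra `D` by a finite group `Γ`
acting through `α`: its elements are the formal sums `∑ w, a w ⊗ T_w` with `a w ∈ D`. -/
structure TwistedCrossedProduct {Γ D : Type*} [Group Γ] [CStarAlgebra D]
    (α : Γ →* (D ≃⋆ₐ[ℂ] D)) (c : TwoCocycle Γ) where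
  coeff : Γ → D

namespace TwistedCrossedProduct

variable {Γ D : Type*} [Group Γ] [Finite Γ] [CStarAlgebra D]
  {α : Γ →* (D ≃⋆ₐ[ℂ] D)} {c : TwoCocycle Γ}

attribute [local instance] Fintype.ofFinite Classical.decEq

@[ext]
theorem ext {a b : TwistedCrossedProduct α c} (h : ∀ w, a.coeff w = b.coeff w) : a = b := by
  cases a; cases b; congr; exact funext h

instance : Zero (TwistedCrossedProduct α c) := ⟨⟨0⟩⟩
instance : Add (TwistedCrossedProduct α c) := ⟨fun a b => ⟨a.coeff + b.coeff⟩⟩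
instance : Neg (TwistedCrossedProduct α c) := ⟨fun a => ⟨-a.coeff⟩⟩
instance : Sub (TwistedCrossedProduct α c) := ⟨fun a b => ⟨a.coeff - b.coeff⟩⟩
instance : SMul ℂ (TwistedCrossedProduct α c) := ⟨fun z a => ⟨z • a.coeff⟩⟩
instance : SMul ℕ (TwistedCrossedProduct α c) := ⟨fun z a => ⟨z • a.coeff⟩⟩
instance : SMul ℤ (TwistedCrossedProduct α c) := ⟨fun z a => ⟨z • a.coeff⟩⟩

/-- The unit is `1 ⊗ T_1`. -/
instance : One (TwistedCrossedProduct α c) := ⟨⟨Pi.single 1 1⟩⟩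

/-- `(a ⊗ T_u) (b ⊗ T_v) = ♮(u, v) • (a * u(b)) ⊗ T_{uv}`, extended bilinearly. -/
instance : Mul (TwistedCrossedProduct α c) :=
  ⟨fun a b => ⟨fun w => ∑ u : Γ,
    (c u (u⁻¹ * w) : ℂ) • (a.coeff u * α u (b.coeff (u⁻¹ * w)))⟩⟩

/-- The conjugate-linear involution with `(a ⊗ T_w)⋆ = T_w⋆ (a⋆ ⊗ T_1)`, where `T_w⋆` is determined
by the requirement that `s(w)⁻¹ T_w` is unitary. When `♮` has values in the unit circle this says
that all `T_w` are unitary. -/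
instance : Star (TwistedCrossedProduct α c) :=
  ⟨fun a => ⟨fun w => (((c.scale w : ℂ) ^ 2)⁻¹ * star (c w⁻¹ w : ℂ)) •
    α w (star (a.coeff w⁻¹))⟩⟩

@[simp] theorem coeff_zero : (0 : TwistedCrossedProduct α c).coeff = 0 := rfl
@[simp] theorem coeff_add (a b : TwistedCrossedProduct α c) :
    (a + b).coeff = a.coeff + b.coeff := rfl
@[simp] theorem coeff_neg (a : TwistedCrossedProduct α c) : (-a).coeff = -a.coeff := rfl
@[simp] theorem coeff_sub (a b : TwistedCrossedProduct α c) :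
    (a - b).coeff = a.coeff - b.coeff := rfl
@[simp] theorem coeff_smul (z : ℂ) (a : TwistedCrossedProduct α c) :
    (z • a).coeff = z • a.coeff := rfl
theorem coeff_one : (1 : TwistedCrossedProduct α c).coeff = Pi.single 1 1 := rfl
theorem coeff_mul (a b : TwistedCrossedProduct α c) (w : Γ) :
    (a * b).coeff w = ∑ u : Γ, (c u (u⁻¹ * w) : ℂ) • (a.coeff u * α u (b.coeff (u⁻¹ * w))) := rfl
theorem coeff_star (a : TwistedCrossedProduct α c) (w : Γ) :
    (star a).coeff w = (((c.scale w : ℂ) ^ 2)⁻¹ * star (c w⁻¹ w : ℂ)) •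
      α w (star (a.coeff w⁻¹)) := rfl

attribute [local instance] CStarAlgebra.spectralOrder CStarAlgebra.spectralOrderedRing


/-- The (faithful) regular representation of `D ⋊ ℂ[Γ, ♮]` on the Hilbert module `ℓ²(Γ, D)`, written as
matrices with entries in `D`; here the unitaries `s(w)⁻¹ T_w` act by twisted translations and
`d ∈ D` acts by the diagonal matrix with entries `h⁻¹(d)`. -/
def regular (a : TwistedCrossedProduct α c) : CStarMatrix Γ Γ D :=
  CStarMatrix.ofMatrix fun h g =>
    ((c (h * g⁻¹) g : ℂ) * (c.scale h / c.scale g : ℂ)) • α h⁻¹ (a.coeff (h * g⁻¹))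

theorem regular_apply (a : TwistedCrossedProduct α c) (h g : Γ) :
    regular a h g =
      ((c (h * g⁻¹) g : ℂ) * (c.scale h / c.scale g : ℂ)) • α h⁻¹ (a.coeff (h * g⁻¹)) := rfl

theorem scale_ne (c : TwoCocycle Γ) (w : Γ) : (c.scale w : ℂ) ≠ 0 :=
  Complex.ofReal_ne_zero.mpr (c.scale_pos w).ne'

theorem regular_one_col (a : TwistedCrossedProduct α c) (w : Γ) :
    regular a w 1 = (c.scale w : ℂ) • α w⁻¹ (a.coeff w) := by
  simp [regular_apply, c.one_right, c.scale_one]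

theorem regular_injective : Function.Injective (regular (α := α) (c := c)) := by
  intro a b hab
  ext w
  have h := congrFun (congrFun hab w) 1
  change regular a w 1 = regular b w 1 at h
  rw [regular_one_col, regular_one_col] at h
  exact (α w⁻¹).injective (smul_right_injective D (scale_ne c w) h)

theorem regular_zero : regular (0 : TwistedCrossedProduct α c) = 0 := by
  ext h g; simp [regular_apply]

theorem regular_add (a b : TwistedCrossedProduct α c) :
    regular (a + b) = regular a + regular b := by
  ext h g; simp [regular_apply]

theorem regular_neg (a : TwistedCrossedProduct α c) : regular (-a) = -regular a := by
  ext h g; simp [regular_apply]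

theorem regular_sub (a b : TwistedCrossedProduct α c) :
    regular (a - b) = regular a - regular b := by
  ext h g; simp [regular_apply, smul_sub]

theorem regular_smul (z : ℂ) (a : TwistedCrossedProduct α c) :
    regular (z • a) = z • regular a := by
  ext h g
  rw [CStarMatrix.smul_apply, regular_apply, regular_apply, coeff_smul, Pi.smul_apply, map_smul,
    smul_comm]

theorem regular_one : regular (1 : TwistedCrossedProduct α c) = 1 := by
  ext h g
  rw [regular_apply, coeff_one, CStarMatrix.one_apply]
  by_cases hg : h = g
  · subst hg
    simp [c.one_left, div_self (scale_ne c h)]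
  · rw [if_neg hg, Pi.single_eq_of_ne (by simpa [mul_inv_eq_one] using hg)]
    simp

theorem regular_mul (a b : TwistedCrossedProduct α c) :
    regular (a * b) = regular a * regular b := by
  ext h g
  rw [regular_apply, coeff_mul, CStarMatrix.mul_apply, map_sum, Finset.smul_sum]
  refine Fintype.sum_equiv ((Equiv.inv Γ).trans (Equiv.mulRight h)) _ _ fun u => ?_
  simp only [Equiv.trans_apply, Equiv.inv_apply, Equiv.coe_mulRight]
  rw [regular_apply, regular_apply, map_smul, smul_mul_smul_comm, smul_smul, map_mul]
  have e1 : h * (u⁻¹ * h)⁻¹ = u := by group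
  have e2 : u⁻¹ * h * g⁻¹ = u⁻¹ * (h * g⁻¹) := by group
  rw [e1, e2]
  have e3 : (α h⁻¹) ((α u) (b.coeff (u⁻¹ * (h * g⁻¹)))) =
      α (u⁻¹ * h)⁻¹ (b.coeff (u⁻¹ * (h * g⁻¹))) := by
    rw [show (u⁻¹ * h)⁻¹ = h⁻¹ * u by group, map_mul, StarAlgEquiv.mul_apply]
  rw [e3]
  congr 1
  have hc := congrArg (Units.val) (c.cocycle u (u⁻¹ * (h * g⁻¹)) g)
  rw [show u * (u⁻¹ * (h * g⁻¹)) = h * g⁻¹ by group,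
    show u⁻¹ * (h * g⁻¹) * g = u⁻¹ * h by group, Units.val_mul, Units.val_mul] at hc
  have n1 := scale_ne c (u⁻¹ * h)
  have n2 := scale_ne c g
  field_simp
  linear_combination (c.scale h : ℂ) * hc

theorem regular_star (a : TwistedCrossedProduct α c) : regular (star a) = star (regular a) := by
  ext h g
  rw [CStarMatrix.star_apply, regular_apply, regular_apply, coeff_star, map_smul, smul_smul,
    star_smul, ← map_star]
  have e1 : (h * g⁻¹)⁻¹ = g * h⁻¹ := by group
  have e3 : (α h⁻¹) ((α (h * g⁻¹)) (star (a.coeff (g * h⁻¹)))) =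
      α g⁻¹ (star (a.coeff (g * h⁻¹))) := by
    rw [← StarAlgEquiv.mul_apply, ← map_mul, show h⁻¹ * (h * g⁻¹) = g⁻¹ by group]
  rw [e1, e3]
  congr 1
  set w := h * g⁻¹ with hw
  have hh : w * g = h := by rw [hw]; group
  have hwi : g * h⁻¹ = w⁻¹ := by rw [hw]; group
  rw [hwi]
  have n1 := scale_ne c h
  have n2 := scale_ne c g
  have n3 := scale_ne c w
  have hc := c.cocycle w⁻¹ w g
  rw [inv_mul_cancel, c.one_left, one_mul, hh] at hc
  have hc' := congrArg Units.val hc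
  rw [Units.val_mul] at hc'
  have hs := c.scale_mul w g
  rw [hh] at hs
  have hn : star (c w g : ℂ) * (c w g : ℂ) = ((‖(c w g : ℂ)‖ : ℂ)) ^ 2 := by
    rw [mul_comm, Complex.star_def, Complex.mul_conj']
  have hs' : (‖(c w g : ℂ)‖ : ℂ) * c.scale h = c.scale w * c.scale g := by exact_mod_cast hs
  rw [hc']
  simp only [star_mul', star_div₀, Complex.star_def, Complex.conj_ofReal] at hn ⊢
  field_simp
  have : (‖(c w g : ℂ)‖ : ℂ) ^ 2 * (c.scale h : ℂ) ^ 2 = (c.scale w : ℂ) ^ 2 * (c.scale g : ℂ) ^ 2 := by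
    rw [← mul_pow, hs', mul_pow]
  rw [← hn] at this
  linear_combination this

theorem mul_assoc' (a b d : TwistedCrossedProduct α c) : a * b * d = a * (b * d) :=
  regular_injective (by simp only [regular_mul, mul_assoc])

instance : AddCommGroup (TwistedCrossedProduct α c) :=
  Function.Injective.addCommGroup TwistedCrossedProduct.coeff
    (fun a b h => by cases a; cases b; congr) rfl (fun _ _ => rfl) (fun _ => rfl)
    (fun _ _ => rfl) (fun _ _ => rfl) (fun _ _ => rfl)

instance : Ring (TwistedCrossedProduct α c) where
  left_distrib a b d := regular_injective (by simp only [regular_mul, regular_add, mul_add])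
  right_distrib a b d := regular_injective (by simp only [regular_mul, regular_add, add_mul])
  zero_mul a := regular_injective (by simp only [regular_mul, regular_zero, zero_mul])
  mul_zero a := regular_injective (by simp only [regular_mul, regular_zero, mul_zero])
  mul_assoc a b d := mul_assoc' a b d
  one_mul a := regular_injective (by simp only [regular_mul, regular_one, one_mul])
  mul_one a := regular_injective (by simp only [regular_mul, regular_one, mul_one])
  zsmul := fun n a => n • a
  zsmul_zero' := zero_zsmul
  zsmul_succ' := fun n a => SubNegMonoid.zsmul_succ' n a
  zsmul_neg' := fun n a => SubNegMonoid.zsmul_neg' n a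
  neg_add_cancel := neg_add_cancel
  sub_eq_add_neg := sub_eq_add_neg

instance : Module ℂ (TwistedCrossedProduct α c) where
  one_smul a := regular_injective (by simp only [regular_smul, one_smul])
  mul_smul x y a := regular_injective (by simp only [regular_smul, mul_smul])
  smul_zero x := regular_injective (by simp only [regular_smul, regular_zero, smul_zero])
  smul_add x a b := regular_injective (by simp only [regular_smul, regular_add, smul_add])
  add_smul x y a := regular_injective (by simp only [regular_smul, regular_add, add_smul])
  zero_smul a := regular_injective (by simp only [regular_smul, regular_zero, zero_smul])

instance : Algebra ℂ (TwistedCrossedProduct α c) :=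
  Algebra.ofModule
    (fun r a b => regular_injective (by simp only [regular_smul, regular_mul, smul_mul_assoc]))
    (fun r a b => regular_injective (by simp only [regular_smul, regular_mul, mul_smul_comm]))

instance : StarRing (TwistedCrossedProduct α c) where
  star_involutive a := regular_injective (by simp only [regular_star, star_star])
  star_mul a b := regular_injective (by simp only [regular_star, regular_mul, star_mul])
  star_add a b := regular_injective (by simp only [regular_star, regular_add, star_add])

/-- The regular representation as a linear map. -/
def regularₗ : TwistedCrossedProduct α c →ₗ[ℂ] CStarMatrix Γ Γ D where
  toFun := regular
  map_add' := regular_add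
  map_smul' := regular_smul

/-- The C⋆-norm of `D ⋊ ℂ[Γ, ♮]` is the operator norm in the regular representation. -/
instance : NormedRing (TwistedCrossedProduct α c) where
  toRing := inferInstance
  toMetricSpace := (NormedAddCommGroup.induced _ _ (regularₗ (α := α) (c := c))
    regular_injective).toMetricSpace
  toNorm := (NormedAddCommGroup.induced _ _ (regularₗ (α := α) (c := c)) regular_injective).toNorm
  dist_eq a b := (NormedAddCommGroup.induced _ _ (regularₗ (α := α) (c := c))
    regular_injective).dist_eq a b
  norm_mul_le a b := by
    change ‖regular (a * b)‖ ≤ ‖regular a‖ * ‖regular b‖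
    rw [regular_mul]
    exact norm_mul_le _ _

theorem norm_def (a : TwistedCrossedProduct α c) : ‖a‖ = ‖regular a‖ := rfl

theorem isometry_regular : Isometry (regular (α := α) (c := c)) :=
  AddMonoidHomClass.isometry_of_norm (regularₗ (α := α) (c := c)) fun _ => rfl

theorem isClosed_range_regular : IsClosed (Set.range (regular (α := α) (c := c))) := by
  have hcoe : ∀ h g : Γ, Continuous fun M : CStarMatrix Γ Γ D => M h g := fun h g =>
    (continuous_apply (A := fun _ : Γ => D) g).comp (continuous_apply (A := fun _ : Γ => Γ → D) h)
  have hα : ∀ w, Continuous (α w) := fun w =>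
    (AddMonoidHomClass.isometry_of_norm (α w) (fun x => StarAlgEquiv.norm_map (α w) x)).continuous
  have heq : Set.range (regular (α := α) (c := c)) = ⋂ h : Γ, ⋂ g : Γ,
      {M | M h g = ((c (h * g⁻¹) g : ℂ) * (c.scale h / c.scale g : ℂ)) • α h⁻¹
        ((c.scale (h * g⁻¹) : ℂ)⁻¹ • α (h * g⁻¹) (M (h * g⁻¹) 1))} := by
    ext M
    simp only [Set.mem_range, Set.mem_iInter, Set.mem_ofPred_eq]
    constructor
    · rintro ⟨a, rfl⟩ h g
      rw [regular_one_col, map_smul (α (h * g⁻¹)), inv_smul_smul₀ (scale_ne c _),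
        ← StarAlgEquiv.mul_apply (α (h * g⁻¹)), ← map_mul, mul_inv_cancel, map_one,
        StarAlgEquiv.one_apply, regular_apply]
    · intro hM
      refine ⟨⟨fun w => (c.scale w : ℂ)⁻¹ • α w (M w 1)⟩, ?_⟩
      ext h g
      rw [hM h g, regular_apply]
  rw [heq]
  refine isClosed_iInter fun h => isClosed_iInter fun g => isClosed_eq (hcoe h g) ?_
  exact (((hα _).comp (((hα _).comp (hcoe _ _)).const_smul _)).const_smul _)

instance : CompleteSpace (TwistedCrossedProduct α c) := by
  refine (isometry_regular (α := α) (c := c)).isUniformInducing.completeSpace ?_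
  exact (isClosed_range_regular (α := α) (c := c)).isComplete

/-- `D ⋊ ℂ[Γ, ♮]` as a C⋆-algebra. -/
instance : CStarAlgebra (TwistedCrossedProduct α c) where
  norm_smul_le r a := by
    change ‖regular (r • a)‖ ≤ ‖r‖ * ‖regular a‖
    rw [regular_smul]
    exact norm_smul_le _ _
  norm_mul_self_le a := by
    change ‖regular a‖ * ‖regular a‖ ≤ ‖regular (star a * a)‖
    rw [regular_mul, regular_star]
    exact (CStarRing.norm_star_mul_self (x := regular a)).symm.le
  star_smul r a := regular_injective (by
    simp only [regular_smul, regular_star, star_smul])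

end TwistedCrossedProduct

/-- The twisted group algebra `ℂ[Γ, ♮]`, with basis `T_w` and `T_u T_v = ♮(u, v) T_{uv}`. -/
abbrev TwistedGroupAlgebra (Γ : Type*) [Group Γ] (c : TwoCocycle Γ) : Type _ :=
  TwistedCrossedProduct (1 : Γ →* (ℂ ≃⋆ₐ[ℂ] ℂ)) c
/-! ### Closed ideals and quotients of C⋆-algebras -/

/-- Closed two-sided (self-adjoint) ideals of a C⋆-algebra. -/
class IsClosedIdeal {A : Type*} [NonUnitalCStarAlgebra A] (I : NonUnitalStarSubalgebra ℂ A) :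
    Prop where
  mul_mem_left : ∀ (a : A) {x : A}, x ∈ I → a * x ∈ I
  mul_mem_right : ∀ (a : A) {x : A}, x ∈ I → x * a ∈ I
  isClosed : IsClosed (I : Set A)

/-- The quotient C⋆-algebra `A / I`, with the quotient norm. -/
def CStarQuotient {A : Type*} [NonUnitalCStarAlgebra A] (I : NonUnitalStarSubalgebra ℂ A) :
    Type _ :=
  A ⧸ I.toNonUnitalSubalgebra.toSubmodule

namespace CStarQuotient

variable {A : Type*} [NonUnitalCStarAlgebra A] (I : NonUnitalStarSubalgebra ℂ A)

instance isClosed_coe [h : IsClosedIdeal I] : IsClosed (I : Set A) := h.isClosed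

instance isClosed_submodule [h : IsClosedIdeal I] :
    IsClosed (I.toNonUnitalSubalgebra.toSubmodule : Set A) := h.isClosed

variable [hI : IsClosedIdeal I]

instance : NormedAddCommGroup (CStarQuotient I) :=
  inferInstanceAs (NormedAddCommGroup (A ⧸ I.toNonUnitalSubalgebra.toSubmodule))

instance : NormedSpace ℂ (CStarQuotient I) :=
  inferInstanceAs (NormedSpace ℂ (A ⧸ I.toNonUnitalSubalgebra.toSubmodule))

instance : CompleteSpace (CStarQuotient I) :=
  inferInstanceAs (CompleteSpace (A ⧸ I.toNonUnitalSubalgebra.toSubmodule))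

/-- The quotient map. -/
def mk : A →ₗ[ℂ] CStarQuotient I := I.toNonUnitalSubalgebra.toSubmodule.mkQ

variable {I}

theorem mk_surjective : Function.Surjective (mk I) :=
  Submodule.mkQ_surjective _

theorem mk_eq_iff {a b : A} : mk I a = mk I b ↔ a - b ∈ I :=
  Submodule.Quotient.eq _

theorem norm_mk_le (a : A) : ‖mk I a‖ ≤ ‖a‖ :=
  Submodule.Quotient.norm_mk_le I.toNonUnitalSubalgebra.toSubmodule a

theorem exists_norm_lt (x : CStarQuotient I) {ε : ℝ} (hε : 0 < ε) :
    ∃ a, mk I a = x ∧ ‖a‖ < ‖x‖ + ε :=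
  Submodule.Quotient.norm_mk_lt (S := I.toNonUnitalSubalgebra.toSubmodule) x hε

instance : Mul (CStarQuotient I) :=
  ⟨Quotient.map₂ (· * ·) (by
    intro a a' ha b b' hb
    replace ha := (Submodule.quotientRel_def _).mp ha
    replace hb := (Submodule.quotientRel_def _).mp hb
    refine (Submodule.quotientRel_def _).mpr ?_
    change a * b - a' * b' ∈ I
    have : a * b - a' * b' = (a - a') * b + a' * (b - b') := by noncomm_ring
    rw [this]
    exact add_mem (hI.mul_mem_right b ha) (hI.mul_mem_left a' hb))⟩

instance : Star (CStarQuotient I) :=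
  ⟨Quotient.map star (by
    intro a a' ha
    replace ha := (Submodule.quotientRel_def _).mp ha
    refine (Submodule.quotientRel_def _).mpr ?_
    rw [← star_sub]
    exact I.star_mem' ha)⟩

theorem mk_mul (a b : A) : mk I (a * b) = mk I a * mk I b := rfl
theorem mk_star (a : A) : mk I (star a) = star (mk I a) := rfl

instance : NonUnitalRing (CStarQuotient I) where
  left_distrib x y z := by
    obtain ⟨a, rfl⟩ := mk_surjective x
    obtain ⟨b, rfl⟩ := mk_surjective y
    obtain ⟨c, rfl⟩ := mk_surjective z
    simp only [← mk_mul, ← map_add, mul_add]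
  right_distrib x y z := by
    obtain ⟨a, rfl⟩ := mk_surjective x
    obtain ⟨b, rfl⟩ := mk_surjective y
    obtain ⟨c, rfl⟩ := mk_surjective z
    simp only [← mk_mul, ← map_add, add_mul]
  zero_mul x := by
    obtain ⟨a, rfl⟩ := mk_surjective x
    rw [← map_zero (mk I), ← mk_mul, zero_mul]
  mul_zero x := by
    obtain ⟨a, rfl⟩ := mk_surjective x
    rw [← map_zero (mk I), ← mk_mul, mul_zero]
  mul_assoc x y z := by
    obtain ⟨a, rfl⟩ := mk_surjective x
    obtain ⟨b, rfl⟩ := mk_surjective y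
    obtain ⟨c, rfl⟩ := mk_surjective z
    simp only [← mk_mul, mul_assoc]

instance : StarRing (CStarQuotient I) where
  star_involutive x := by
    obtain ⟨a, rfl⟩ := mk_surjective x
    simp only [← mk_star, star_star]
  star_mul x y := by
    obtain ⟨a, rfl⟩ := mk_surjective x
    obtain ⟨b, rfl⟩ := mk_surjective y
    simp only [← mk_star, ← mk_mul, star_mul]
  star_add x y := by
    obtain ⟨a, rfl⟩ := mk_surjective x
    obtain ⟨b, rfl⟩ := mk_surjective y
    simp only [← mk_star, ← map_add, star_add]

instance : NonUnitalNormedRing (CStarQuotient I) where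
  dist_eq := NormedAddCommGroup.dist_eq
  norm_mul_le x y := by
    refine le_of_forall_pos_le_add fun ε hε => ?_
    obtain ⟨δ, hδ, hδ'⟩ : ∃ δ > 0, (‖x‖ + δ) * (‖y‖ + δ) ≤ ‖x‖ * ‖y‖ + ε := by
      have hc : Filter.Tendsto (fun δ : ℝ => (‖x‖ + δ) * (‖y‖ + δ)) (nhdsWithin 0 (Set.Ioi 0))
          (nhds ((‖x‖ + 0) * (‖y‖ + 0))) := by
        refine Filter.Tendsto.mono_left ?_ nhdsWithin_le_nhds
        exact (Continuous.tendsto (by fun_prop) 0)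
      have h1 : ∀ᶠ δ in nhdsWithin (0 : ℝ) (Set.Ioi 0),
          (‖x‖ + δ) * (‖y‖ + δ) < ‖x‖ * ‖y‖ + ε :=
        hc.eventually_lt_const (by simpa using hε)
      obtain ⟨δ, h2, h3⟩ := (h1.and self_mem_nhdsWithin).exists
      exact ⟨δ, h3, h2.le⟩
    obtain ⟨a, rfl, ha⟩ := exists_norm_lt x hδ
    obtain ⟨b, rfl, hb⟩ := exists_norm_lt y hδ
    rw [← mk_mul]
    calc ‖mk I (a * b)‖ ≤ ‖a * b‖ := norm_mk_le _
      _ ≤ ‖a‖ * ‖b‖ := norm_mul_le _ _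
      _ ≤ (‖mk I a‖ + δ) * (‖mk I b‖ + δ) := by gcongr
      _ ≤ _ := hδ'

open Filter Topology in
/-- The C⋆-inequality for the quotient norm. -/
theorem norm_mk_mul_self_le (a : A) : ‖mk I a‖ * ‖mk I a‖ ≤ ‖mk I (star a * a)‖ := by
  let _ : PartialOrder I := CStarAlgebra.spectralOrder I
  have : StarOrderedRing I := CStarAlgebra.spectralOrderedRing I
  refine le_of_forall_pos_le_add fun ε hε => ?_
  obtain ⟨b, hb, hbn⟩ := exists_norm_lt (mk I (star a * a)) hε
  have hy : star a * a - b ∈ I := mk_eq_iff.mp hb.symm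
  have hau := CStarAlgebra.increasingApproximateUnit I
  have := hau.neBot
  have key : ∀ᶠ e : I in CStarAlgebra.approximateUnit I,
      ‖mk I a‖ * ‖mk I a‖ ≤ ‖b‖ + ‖(star a * a - b) - (star a * a - b) * (e : A)‖ := by
    filter_upwards [hau.eventually_nonneg, hau.eventually_norm] with e he0 he1
    have hs : star (e : A) = e := congrArg Subtype.val (IsSelfAdjoint.of_nonneg he0).star_eq
    obtain ⟨d, hd⟩ := CStarAlgebra.nonneg_iff_eq_star_mul_self.mp he0
    let _ : PartialOrder (Unitization ℂ A) := CStarAlgebra.spectralOrder _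
    have : StarOrderedRing (Unitization ℂ A) := CStarAlgebra.spectralOrderedRing _
    have h0 : (0 : Unitization ℂ A) ≤ ((e : A) : Unitization ℂ A) := by
      have : ((e : A) : Unitization ℂ A) = star ((d : A) : Unitization ℂ A) * ((d : A) :) := by
        rw [hd]
        simp
      rw [this]
      exact star_mul_self_nonneg _
    have h1 : ((e : A) : Unitization ℂ A) ≤ 1 := by
      rw [← CStarAlgebra.norm_le_one_iff_of_nonneg _ h0, Unitization.norm_inr]
      exact he1
    have hu : ‖(1 : Unitization ℂ A) - ((e : A) : Unitization ℂ A)‖ ≤ 1 := by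
      rw [CStarAlgebra.norm_le_one_iff_of_nonneg _ (sub_nonneg.mpr h1)]
      exact sub_le_self _ h0
    set u : Unitization ℂ A := 1 - ((e : A) : Unitization ℂ A) with hu'
    have hright : ∀ y : A, ((y - y * e : A) : Unitization ℂ A) = y * u := by
      intro y; simp [hu', mul_sub]
    have hus : star u = u := by simp [hu', ← Unitization.inr_star, hs]
    have e1 : mk I a = mk I (a - a * e) := by
      rw [mk_eq_iff]
      simpa using hI.mul_mem_left a e.2
    have e2 : ‖a - a * e‖ * ‖a - a * e‖ = ‖u * ((star a * a : A) : Unitization ℂ A) * u‖ := by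
      rw [← Unitization.norm_inr (𝕜 := ℂ) (a - a * e), hright, ← CStarRing.norm_star_mul_self,
        star_mul, hus]
      simp [mul_assoc]
    have e3 : u * ((star a * a : A) : Unitization ℂ A) * u =
        u * (b : Unitization ℂ A) * u + u * ((star a * a - b : A) : Unitization ℂ A) * u := by
      rw [← add_mul, ← mul_add, ← Unitization.inr_add, add_sub_cancel]
    calc ‖mk I a‖ * ‖mk I a‖ ≤ ‖a - a * e‖ * ‖a - a * e‖ := by
          rw [e1]; gcongr <;> exact norm_mk_le _
      _ ≤ ‖u * (b : Unitization ℂ A) * u‖ +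
            ‖u * (((star a * a - b : A) : Unitization ℂ A) * u)‖ := by
          rw [e2, e3, mul_assoc u ((star a * a - b : A) : Unitization ℂ A)]
          exact norm_add_le _ _
      _ ≤ ‖(b : Unitization ℂ A)‖ + ‖((star a * a - b : A) : Unitization ℂ A) * u‖ := by
          gcongr
          · calc ‖u * (b : Unitization ℂ A) * u‖ ≤ ‖u‖ * ‖(b : Unitization ℂ A)‖ * ‖u‖ :=
                norm_mul₃_le
              _ ≤ 1 * ‖(b : Unitization ℂ A)‖ * 1 := by gcongr
              _ = _ := by simp
          · exact (norm_mul_le _ _).trans (mul_le_of_le_one_left (norm_nonneg _) hu)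
      _ = ‖b‖ + ‖(star a * a - b) - (star a * a - b) * (e : A)‖ := by
          rw [← hright, Unitization.norm_inr, Unitization.norm_inr]
  have hlim : Tendsto (fun e : I => ‖b‖ + ‖(star a * a - b) - (star a * a - b) * (e : A)‖)
      (CStarAlgebra.approximateUnit I) (𝓝 (‖b‖ + ‖(0 : A)‖)) := by
    refine Tendsto.const_add _ (Tendsto.norm ?_)
    have h1 := (hau.tendsto_mul_left ⟨_, hy⟩)
    have h2 := (continuous_subtype_val.tendsto _).comp h1
    have h3 := (tendsto_const_nhds (x := star a * a - b)
      (f := CStarAlgebra.approximateUnit I)).sub h2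
    simpa using h3
  have := ge_of_tendsto hlim key
  simp only [norm_zero, add_zero] at this
  linarith

instance : IsScalarTower ℂ (CStarQuotient I) (CStarQuotient I) where
  smul_assoc z x y := by
    obtain ⟨a, rfl⟩ := mk_surjective x
    obtain ⟨b, rfl⟩ := mk_surjective y
    rw [smul_eq_mul, smul_eq_mul, ← map_smul, ← mk_mul, ← mk_mul, ← map_smul, smul_mul_assoc]

instance : SMulCommClass ℂ (CStarQuotient I) (CStarQuotient I) where
  smul_comm z x y := by
    obtain ⟨a, rfl⟩ := mk_surjective x
    obtain ⟨b, rfl⟩ := mk_surjective y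
    rw [smul_eq_mul, smul_eq_mul, ← map_smul, ← mk_mul, ← mk_mul, ← map_smul, mul_smul_comm]

instance : StarModule ℂ (CStarQuotient I) where
  star_smul z x := by
    obtain ⟨a, rfl⟩ := mk_surjective x
    rw [← map_smul, ← mk_star, ← mk_star, star_smul, ← map_smul]

instance : CStarRing (CStarQuotient I) where
  norm_mul_self_le x := by
    obtain ⟨a, rfl⟩ := mk_surjective x
    rw [← mk_star, ← mk_mul]
    exact norm_mk_mul_self_le a

instance : NonUnitalCStarAlgebra (CStarQuotient I) where

end CStarQuotient

/-! ### Topological K-theory -/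

section KTheory

/-- Idempotent matrices of arbitrary finite size over `R`. -/
def IdempotentMatrix (R : Type*) [Ring R] : Type _ :=
  Σ n : ℕ, {e : Matrix (Fin n) (Fin n) R // e * e = e}

namespace IdempotentMatrix

variable {R S : Type*} [Ring R] [Ring S]

/-- `e ∼ f` if `e = x y` and `f = y x` for some rectangular matrices `x, y`; equivalently, the
finitely generated projective modules defined by `e` and `f` are isomorphic. -/
def Equivalent (e f : IdempotentMatrix R) : Prop :=
  ∃ (x : Matrix (Fin e.1) (Fin f.1) R) (y : Matrix (Fin f.1) (Fin e.1) R),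
    x * y = e.2.1 ∧ y * x = f.2.1

/-- The block diagonal sum `e ⊕ f`. -/
def sum (e f : IdempotentMatrix R) : IdempotentMatrix R :=
  ⟨e.1 + f.1, (Matrix.fromBlocks e.2.1 0 0 f.2.1).submatrix finSumFinEquiv.symm
    finSumFinEquiv.symm, by
      rw [Matrix.submatrix_mul_equiv, Matrix.fromBlocks_multiply, e.2.2, f.2.2]
      simp⟩

/-- Entrywise application of a ring homomorphism. -/
def map (φ : R →+* S) (e : IdempotentMatrix R) : IdempotentMatrix S :=
  ⟨e.1, e.2.1.map φ, by rw [← Matrix.map_mul, e.2.2]⟩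

theorem Equivalent.map (φ : R →+* S) {e f : IdempotentMatrix R} (h : Equivalent e f) :
    Equivalent (e.map φ) (f.map φ) := by
  obtain ⟨x, y, h1, h2⟩ := h
  refine ⟨x.map φ, y.map φ, ?_, ?_⟩
  · exact (Matrix.map_mul (L := x) (M := y) (f := φ)).symm.trans (by rw [h1]; rfl)
  · exact (Matrix.map_mul (L := y) (M := x) (f := φ)).symm.trans (by rw [h2]; rfl)

theorem map_sum (φ : R →+* S) (e f : IdempotentMatrix R) :
    (e.sum f).map φ = (e.map φ).sum (f.map φ) := by
  unfold sum map
  congr 2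
  ext i j
  simp only [Matrix.map_apply, Matrix.submatrix_apply]
  rcases finSumFinEquiv.symm i with i | i <;> rcases finSumFinEquiv.symm j with j | j <;> simp

end IdempotentMatrix

variable (R S : Type*) [Ring R] [Ring S]

/-- The relations that define `K₀` of a unital ring. -/
def K0Relations : AddSubgroup (FreeAbelianGroup (IdempotentMatrix R)) :=
  AddSubgroup.closure
    ({x | ∃ e f : IdempotentMatrix R, e.Equivalent f ∧
        x = FreeAbelianGroup.of e - FreeAbelianGroup.of f} ∪
      {x | ∃ e f : IdempotentMatrix R, x = FreeAbelianGroup.of (e.sum f) -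
        (FreeAbelianGroup.of e + FreeAbelianGroup.of f)})

/-- `K₀` of a unital ring: the Grothendieck group of the monoid of isomorphism classes of finitely
generated projective modules, described by idempotent matrices. -/
def UnitalK0 : Type _ := FreeAbelianGroup (IdempotentMatrix R) ⧸ K0Relations R

instance : AddCommGroup (UnitalK0 R) :=
  inferInstanceAs (AddCommGroup (FreeAbelianGroup (IdempotentMatrix R) ⧸ K0Relations R))

variable {R S}

/-- Functoriality of `K₀`. -/
def UnitalK0.map (φ : R →+* S) : UnitalK0 R →+ UnitalK0 S :=
  QuotientAddGroup.map (K0Relations R) (K0Relations S)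
    (FreeAbelianGroup.map (IdempotentMatrix.map φ)) (by
      rw [K0Relations, AddSubgroup.closure_le]
      rintro x (⟨e, f, h, rfl⟩ | ⟨e, f, rfl⟩)
      · refine AddSubgroup.subset_closure (Or.inl ⟨e.map φ, f.map φ, h.map φ, ?_⟩)
        simp
      · refine AddSubgroup.subset_closure (Or.inr ⟨e.map φ, f.map φ, ?_⟩)
        simp [IdempotentMatrix.map_sum])

/-- `K₀` of a possibly non-unital algebra `A`: the kernel of `K₀(A₊) → K₀(ℂ)`, where `A₊` is the
unitization of `A`. -/
def K0 (A : Type*) [NonUnitalRing A] [Module ℂ A] [IsScalarTower ℂ A A] [SMulCommClass ℂ A A] :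
    Type _ :=
  (UnitalK0.map (Unitization.fstHom ℂ A : Unitization ℂ A →ₐ[ℂ] ℂ).toRingHom).ker

instance (A : Type*) [NonUnitalRing A] [Module ℂ A] [IsScalarTower ℂ A A] [SMulCommClass ℂ A A] :
    AddCommGroup (K0 A) :=
  inferInstanceAs (AddCommGroup
    (UnitalK0.map (Unitization.fstHom ℂ A : Unitization ℂ A →ₐ[ℂ] ℂ).toRingHom).ker)

/-- The suspension `ΣA = {f ∈ C(S¹, A) : f(1) = 0}`. -/
def Suspension (A : Type*) [NonUnitalCStarAlgebra A] : NonUnitalSubalgebra ℂ C(Circle, A) where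
  carrier := {f | f 1 = 0}
  add_mem' {f g} hf hg := by
    change f 1 + g 1 = 0
    rw [show f 1 = 0 from hf, show g 1 = 0 from hg, add_zero]
  zero_mem' := rfl
  mul_mem' {f g} hf hg := by
    change f 1 * g 1 = 0
    rw [show f 1 = 0 from hf, zero_mul]
  smul_mem' z f hf := by
    change z • f 1 = 0
    rw [show f 1 = 0 from hf, smul_zero]

/-- `K₁(A) = K₀(ΣA)`. -/
abbrev K1 (A : Type*) [NonUnitalCStarAlgebra A] : Type _ := K0 (Suspension A)

end KTheory

/-! ### The Grothendieck group of representations -/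

section RepresentationRing

variable (B : Type*) [Ring B] [Algebra ℂ B]

/-- Finite dimensional representations of an algebra, realized on some `ℂⁿ`. -/
def FinDimRep : Type _ := Σ n : ℕ, B →ₐ[ℂ] Module.End ℂ (Fin n → ℂ)

variable {B}

/-- There is a short exact sequence of representations `0 → ρ₁ → ρ₂ → ρ₃ → 0`. -/
def FinDimRep.ShortExact (ρ₁ ρ₂ ρ₃ : FinDimRep B) : Prop :=
  ∃ (i : (Fin ρ₁.1 → ℂ) →ₗ[ℂ] (Fin ρ₂.1 → ℂ)) (p : (Fin ρ₂.1 → ℂ) →ₗ[ℂ] (Fin ρ₃.1 → ℂ)),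
    (∀ b v, i (ρ₁.2 b v) = ρ₂.2 b (i v)) ∧ (∀ b v, p (ρ₂.2 b v) = ρ₃.2 b (p v)) ∧
    Function.Injective i ∧ Function.Surjective p ∧ LinearMap.range i = LinearMap.ker p

variable (B)

/-- The relations that define `R(B)`. -/
def repRelations : AddSubgroup (FreeAbelianGroup (FinDimRep B)) :=
  AddSubgroup.closure {x | ∃ ρ₁ ρ₂ ρ₃ : FinDimRep B, FinDimRep.ShortExact ρ₁ ρ₂ ρ₃ ∧
    x = FreeAbelianGroup.of ρ₂ - (FreeAbelianGroup.of ρ₁ + FreeAbelianGroup.of ρ₃)}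

/-- `R(B)`: the Grothendieck group of the category of finite dimensional representations of `B`. -/
def RepGroup : Type _ := FreeAbelianGroup (FinDimRep B) ⧸ repRelations B

instance : AddCommGroup (RepGroup B) :=
  inferInstanceAs (AddCommGroup (FreeAbelianGroup (FinDimRep B) ⧸ repRelations B))

end RepresentationRing

/-! ### Morita equivalence of C⋆-algebras -/

universe u v

/-- (Strong) Morita equivalence of C⋆-algebras: there is a Banach space `E` which is
a full left Hilbert `A`-module and a full right Hilbert `B`-module, in such a way that the actions
are adjointable and `⟨x, y⟩_A z = x ⟨y, z⟩_B` (an `A`-`B`-imprimitivity bimodule). -/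
def MoritaEquivalent (A : Type u) (B : Type v) [NonUnitalCStarAlgebra A]
    [NonUnitalCStarAlgebra B] : Prop :=
  ∃ (E : Type (max u v)) (_ : NormedAddCommGroup E) (_ : NormedSpace ℂ E) (_ : CompleteSpace E)
    -- left action, right action and the two inner products
    (l : A →ₗ[ℂ] E →ₗ[ℂ] E) (r : B →ₗ[ℂ] E →ₗ[ℂ] E)
    (ipA : E →ₗ[ℂ] E →ₗ⋆[ℂ] A) (ipB : E →ₗ⋆[ℂ] E →ₗ[ℂ] B),
    (∀ a a' x, l (a * a') x = l a (l a' x)) ∧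
    (∀ b b' x, r (b * b') x = r b' (r b x)) ∧
    (∀ a b x, l a (r b x) = r b (l a x)) ∧
    -- `E` is a left Hilbert `A`-module
    (∀ a x y, ipA (l a x) y = a * ipA x y) ∧
    (∀ x y, star (ipA x y) = ipA y x) ∧
    (∀ x, ∃ a, ipA x x = star a * a) ∧
    (∀ x, ‖x‖ ^ 2 = ‖ipA x x‖) ∧
    -- `E` is a right Hilbert `B`-module
    (∀ b x y, ipB x (r b y) = ipB x y * b) ∧
    (∀ x y, star (ipB x y) = ipB y x) ∧
    (∀ x, ∃ b, ipB x x = star b * b) ∧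
    (∀ x, ‖x‖ ^ 2 = ‖ipB x x‖) ∧
    -- the actions are adjointable
    (∀ a x y, ipB (l a x) y = ipB x (l (star a) y)) ∧
    (∀ b x y, ipA (r b x) y = ipA x (r (star b) y)) ∧
    -- compatibility of the inner products
    (∀ x y z, l (ipA x y) z = r (ipB y z) x) ∧
    -- fullness
    Dense (Submodule.span ℂ {a | ∃ x y, ipA x y = a} : Set A) ∧
    Dense (Submodule.span ℂ {b | ∃ x y, ipB x y = b} : Set B)

/-! ### Algebras of continuous functions and crossed products with them -/

section Functions

/-- `C₀(T, Z; B) = {f ∈ C(T, B) : f = 0 on Z}`, for a compact space `T` and a subset `Z`. For a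
finite dimensional C⋆-algebra `B` this is the tensor product `C₀(T, Z) ⊗ B`. -/
def RelC0 {T : Type*} [TopologicalSpace T] [CompactSpace T] (Z : Set T) (B : Type*)
    [NonUnitalCStarAlgebra B] : NonUnitalStarSubalgebra ℂ C(T, B) where
  carrier := {f | ∀ z ∈ Z, f z = 0}
  add_mem' {f g} hf hg z hz := by
    rw [ContinuousMap.add_apply, hf z hz, hg z hz, add_zero]
  zero_mem' z hz := rfl
  mul_mem' {f g} hf hg z hz := by
    rw [ContinuousMap.mul_apply, hf z hz, zero_mul]
  smul_mem' k f hf z hz := by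
    rw [ContinuousMap.smul_apply, hf z hz, smul_zero]
  star_mem' {f} hf z hz := by
    rw [ContinuousMap.star_apply, hf z hz, star_zero]

instance {T : Type*} [TopologicalSpace T] [CompactSpace T] (Z : Set T) (B : Type*)
    [NonUnitalCStarAlgebra B] : IsClosed (RelC0 Z B : Set C(T, B)) := by
  have : (RelC0 Z B : Set C(T, B)) = ⋂ z ∈ Z, {f : C(T, B) | f z = 0} := by
    ext f
    simp only [Set.mem_iInter]
    rfl
  rw [this]
  exact isClosed_biInter fun z _ =>
    isClosed_eq (continuous_eval_const z) continuous_const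

variable {Γ Y : Type*} [Group Γ] [TopologicalSpace Y] [CompactSpace Y] [MulAction Γ Y]
  [ContinuousConstSMul Γ Y]

/-- The action of `Γ` on `C(Y)` by `(w f)(y) = f(w⁻¹ y)`. -/
def translation (Γ Y : Type*) [Group Γ] [TopologicalSpace Y] [CompactSpace Y] [MulAction Γ Y]
    [ContinuousConstSMul Γ Y] : Γ →* (C(Y, ℂ) ≃⋆ₐ[ℂ] C(Y, ℂ)) where
  toFun w := (Homeomorph.smul w⁻¹).compStarAlgEquiv' ℂ ℂ
  map_one' := by
    ext f y
    simp
  map_mul' u w := by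
    ext f y
    simp [mul_smul]

theorem translation_apply (w : Γ) (f : C(Y, ℂ)) (y : Y) :
    translation Γ Y w f y = f (w⁻¹ • y) := rfl

/-- The orbit space `Y / Γ`. -/
abbrev OrbitSpace (Γ Y : Type*) [Group Γ] [MulAction Γ Y] : Type _ :=
  MulAction.orbitRel.Quotient Γ Y

/-- The quotient map `Y → Y / Γ`. -/
def orbitMap (Γ : Type*) {Y : Type*} [Group Γ] [MulAction Γ Y] (y : Y) : OrbitSpace Γ Y :=
  Quotient.mk _ y

theorem continuous_orbitMap : Continuous (orbitMap Γ : Y → OrbitSpace Γ Y) :=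
  continuous_quotient_mk'

theorem orbitMap_smul (w : Γ) (y : Y) : orbitMap Γ (w • y) = orbitMap Γ y :=
  Quotient.sound ⟨w, rfl⟩

/-- The pullback of a function on `Y / Γ` to a `Γ`-invariant function on `Y`. -/
def pullback (f : C(OrbitSpace Γ Y, ℂ)) : C(Y, ℂ) := f.comp ⟨orbitMap Γ, continuous_orbitMap⟩

variable [Finite Γ] (c : TwoCocycle Γ)

/-- The action of `C(Y / Γ)` on the crossed product `C(Y) ⋊ ℂ[Γ, ♮]`. -/
def centralMul {c : TwoCocycle Γ} (f : C(OrbitSpace Γ Y, ℂ))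
    (a : TwistedCrossedProduct (translation Γ Y) c) :
    TwistedCrossedProduct (translation Γ Y) c :=
  ⟨fun w => pullback f * a.coeff w⟩

theorem translation_pullback (w : Γ) (f : C(OrbitSpace Γ Y, ℂ)) :
    translation Γ Y w (pullback f) = pullback f := by
  ext y
  exact congrArg f (orbitMap_smul w⁻¹ y)

attribute [local instance] Fintype.ofFinite in
theorem mul_centralMul {c : TwoCocycle Γ} (f : C(OrbitSpace Γ Y, ℂ))
    (b a : TwistedCrossedProduct (translation Γ Y) c) :
    b * centralMul f a = centralMul f (b * a) := by
  ext1 w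
  simp only [TwistedCrossedProduct.coeff_mul, centralMul, map_mul, translation_pullback,
    Finset.mul_sum]
  refine Finset.sum_congr rfl fun u _ => ?_
  rw [mul_left_comm, mul_smul_comm]

attribute [local instance] Fintype.ofFinite in
theorem centralMul_mul {c : TwoCocycle Γ} (f : C(OrbitSpace Γ Y, ℂ))
    (a b : TwistedCrossedProduct (translation Γ Y) c) :
    centralMul f a * b = centralMul f (a * b) := by
  ext1 w
  simp only [TwistedCrossedProduct.coeff_mul, centralMul, Finset.mul_sum]
  refine Finset.sum_congr rfl fun u _ => ?_
  rw [mul_assoc, mul_smul_comm]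

theorem star_centralMul {c : TwoCocycle Γ} (f : C(OrbitSpace Γ Y, ℂ))
    (a : TwistedCrossedProduct (translation Γ Y) c) :
    star (centralMul f a) = centralMul (star f) (star a) := by
  ext1 w
  simp only [TwistedCrossedProduct.coeff_star, centralMul]
  rw [star_mul', map_mul, mul_smul_comm]
  congr 2
  exact translation_pullback w (star f)

/-- The linear span of the products `f a` with `f ∈ C₀(Y / Γ, Z)` and `a ∈ C(Y) ⋊ ℂ[Γ, ♮]`. -/
def idealSpan (Z : Set (OrbitSpace Γ Y)) :
    Submodule ℂ (TwistedCrossedProduct (translation Γ Y) c) :=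
  Submodule.span ℂ {x | ∃ f ∈ RelC0 Z ℂ, ∃ a, x = centralMul f a}

variable {c} in
theorem mul_mem_idealSpan {Z : Set (OrbitSpace Γ Y)}
    (b : TwistedCrossedProduct (translation Γ Y) c) {x} (hx : x ∈ idealSpan c Z) :
    b * x ∈ idealSpan c Z := by
  induction hx using Submodule.span_induction with
  | mem x h =>
    obtain ⟨f, hf, a, rfl⟩ := h
    exact Submodule.subset_span ⟨f, hf, b * a, mul_centralMul f b a⟩
  | zero => simp
  | add x y _ _ hx hy => rw [mul_add]; exact add_mem hx hy
  | smul z x _ hx => rw [mul_smul_comm]; exact Submodule.smul_mem _ z hx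

variable {c} in
theorem mem_idealSpan_mul {Z : Set (OrbitSpace Γ Y)}
    (b : TwistedCrossedProduct (translation Γ Y) c) {x} (hx : x ∈ idealSpan c Z) :
    x * b ∈ idealSpan c Z := by
  induction hx using Submodule.span_induction with
  | mem x h =>
    obtain ⟨f, hf, a, rfl⟩ := h
    exact Submodule.subset_span ⟨f, hf, a * b, centralMul_mul f a b⟩
  | zero => simp
  | add x y _ _ hx hy => rw [add_mul]; exact add_mem hx hy
  | smul z x _ hx => rw [smul_mul_assoc]; exact Submodule.smul_mem _ z hx

variable {c} in
theorem star_mem_idealSpan {Z : Set (OrbitSpace Γ Y)}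
    {x : TwistedCrossedProduct (translation Γ Y) c} (hx : x ∈ idealSpan c Z) :
    star x ∈ idealSpan c Z := by
  induction hx using Submodule.span_induction with
  | mem x h =>
    obtain ⟨f, hf, a, rfl⟩ := h
    exact Submodule.subset_span ⟨star f, star_mem hf, star a, star_centralMul f a⟩
  | zero => simp
  | add x y _ _ hx hy => rw [star_add]; exact add_mem hx hy
  | smul z x _ hx => rw [star_smul]; exact Submodule.smul_mem _ _ hx

/-- The closed ideal `C₀(Y / Γ, Z) A` of `A = C(Y) ⋊ ℂ[Γ, ♮]`. -/
def relIdeal (Z : Set (OrbitSpace Γ Y)) :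
    NonUnitalStarSubalgebra ℂ (TwistedCrossedProduct (translation Γ Y) c) where
  carrier := closure (idealSpan c Z)
  add_mem' hx hy := (idealSpan c Z).topologicalClosure.add_mem hx hy
  zero_mem' := (idealSpan c Z).topologicalClosure.zero_mem
  smul_mem' z _ hx := (idealSpan c Z).topologicalClosure.smul_mem z hx
  mul_mem' {a} {_} _ hx := map_mem_closure (continuous_const_mul a) hx
    fun _ hy => mul_mem_idealSpan a hy
  star_mem' hx := map_mem_closure continuous_star hx fun _ hy => star_mem_idealSpan hy

instance (Z : Set (OrbitSpace Γ Y)) : IsClosedIdeal (relIdeal c Z) where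
  mul_mem_left a {_} hx := map_mem_closure (continuous_const_mul a) hx
    fun _ hy => mul_mem_idealSpan a hy
  mul_mem_right a {_} hx := map_mem_closure (f := (· * a)) (continuous_mul_const a) hx
    fun _ hy => mem_idealSpan_mul a hy
  isClosed := isClosed_closure

/-- For closed ideals `I, J` of `A`, the ideal `I ∩ J` of the C⋆-algebra `J`. -/
def idealInside {A : Type*} [NonUnitalCStarAlgebra A] (I J : NonUnitalStarSubalgebra ℂ A)
    [IsClosedIdeal J] :
    @NonUnitalStarSubalgebra ℂ J _
      NonUnitalCStarAlgebra.toNonUnitalNormedRing.toNonUnitalRing.toNonUnitalNonAssocSemiring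
      NonUnitalCStarAlgebra.toNormedSpace.toModule
      NonUnitalCStarAlgebra.toStarRing.toStar :=
  I.comap (NonUnitalStarSubalgebraClass.subtype J)

instance {A : Type*} [NonUnitalCStarAlgebra A] (I J : NonUnitalStarSubalgebra ℂ A)
    [hI : IsClosedIdeal I] [IsClosedIdeal J] : IsClosedIdeal (idealInside I J) where
  mul_mem_left a {_} hx := hI.mul_mem_left (a : A) hx
  mul_mem_right a {_} hx := hI.mul_mem_right (a : A) hx
  isClosed := hI.isClosed.preimage continuous_subtype_val

/-- The subquotient C⋆-algebra `C₀(Y / Γ, Z₁) A / C₀(Y / Γ, Z₂) A`, for `Z₁ ⊆ Z₂`. -/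
abbrev RelSubquotient (Z₁ Z₂ : Set (OrbitSpace Γ Y)) : Type _ :=
  CStarQuotient (A := relIdeal c Z₁) (idealInside (relIdeal c Z₂) (relIdeal c Z₁))

end Functions

/-! ### Equivariant triangulations -/

section Triangulations

/-- A `Γ`-equivariant triangulation of `Y`: a homeomorphism from `Y` to a finite simplicial
complex, such that `Γ` acts simplicially (every `w ∈ Γ` maps each simplex affinely onto a simplex)
and all points in the interior of one simplex have the same stabilizer in `Γ`. -/
structure EquivariantTriangulation (Γ Y E : Type*) [Group Γ] [TopologicalSpace Y] [MulAction Γ Y]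
    [NormedAddCommGroup E] [NormedSpace ℝ E] where
  complex : Geometry.SimplicialComplex ℝ E
  finite : complex.faces.Finite
  homeo : Y ≃ₜ complex.space
  simplicial : ∀ w : Γ, ∀ s ∈ complex.faces, ∃ t ∈ complex.faces, ∃ φ : E →ᵃ[ℝ] E,
    φ '' (s : Set E) = t ∧
    ∀ y : Y, (homeo y : E) ∈ convexHull ℝ (s : Set E) → (homeo (w • y) : E) = φ (homeo y)
  stabilizer_eq : ∀ s ∈ complex.faces, ∀ y y' : Y,
    (homeo y : E) ∈ convexHull ℝ (s : Set E) → (homeo y' : E) ∈ convexHull ℝ (s : Set E) →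
    (∀ t ⊂ s, (homeo y : E) ∉ convexHull ℝ (t : Set E)) →
    (∀ t ⊂ s, (homeo y' : E) ∉ convexHull ℝ (t : Set E)) →
    MulAction.stabilizer Γ y = MulAction.stabilizer Γ y'

namespace EquivariantTriangulation

variable {Γ Y E : Type*} [Group Γ] [TopologicalSpace Y] [MulAction Γ Y]
  [NormedAddCommGroup E] [NormedSpace ℝ E]

/-- The simplex `τ'` of `Y` with vertex set `s`. -/
def simplex (T : EquivariantTriangulation Γ Y E) (s : Finset E) : Set Y :=
  {y | (T.homeo y : E) ∈ convexHull ℝ (s : Set E)}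

/-- The boundary `∂τ'` of the simplex `τ'` with vertex set `s`: the union of its proper faces. -/
def boundary (T : EquivariantTriangulation Γ Y E) (s : Finset E) : Set Y :=
  {y | ∃ t ⊂ s, (T.homeo y : E) ∈ convexHull ℝ (t : Set E)}

/-- The image `τ = Γ τ' / Γ` of `τ'` in `Y / Γ`. -/
def orbitSimplex (T : EquivariantTriangulation Γ Y E) (s : Finset E) : Set (OrbitSpace Γ Y) :=
  orbitMap Γ '' T.simplex s

/-- The boundary `∂τ` of `τ`: the image of `∂τ'` in `Y / Γ`. -/
def orbitBoundary (T : EquivariantTriangulation Γ Y E) (s : Finset E) : Set (OrbitSpace Γ Y) :=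
  orbitMap Γ '' T.boundary s

instance [CompactSpace Y] (T : EquivariantTriangulation Γ Y E) (s : Finset E) :
    CompactSpace (T.orbitSimplex s) := by
  have h1 : IsClosed (T.simplex s) :=
    (s.finite_toSet.isCompact_convexHull ℝ).isClosed.preimage
      (continuous_subtype_val.comp T.homeo.continuous)
  exact isCompact_iff_compactSpace.mp (h1.isCompact.image continuous_quotient_mk')

/-- The setwise stabilizer `Γ_{τ'} = {w ∈ Γ : w τ' = τ'}` of the simplex `τ'`. -/
def simplexStabilizer (T : EquivariantTriangulation Γ Y E) (s : Finset E) : Subgroup Γ :=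
  MulAction.stabilizer Γ (T.simplex s)

/-- The C⋆-algebra `C₀(τ, ∂τ) ⊗ B`, realized as `{f ∈ C(τ, B) : f = 0 on ∂τ}`. -/
abbrev simplexC0 [CompactSpace Y] (T : EquivariantTriangulation Γ Y E) (s : Finset E)
    (B : Type*) [NonUnitalCStarAlgebra B] :=
  RelC0 ((↑) ⁻¹' T.orbitBoundary s : Set (T.orbitSimplex s)) B

end EquivariantTriangulation

end Triangulations

/-! ### Unramified characters and the group `W^e` -/

section Bernstein

instance Homeomorph.applyMulAction (Y : Type*) [TopologicalSpace Y] : MulAction (Y ≃ₜ Y) Y where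
  smul f y := f y
  one_smul _ := rfl
  mul_smul _ _ _ := rfl

instance Homeomorph.applyContinuousConstSMul (Y : Type*) [TopologicalSpace Y] :
    ContinuousConstSMul (Y ≃ₜ Y) Y := ⟨fun f => f.continuous⟩

instance Homeomorph.subgroupContinuousConstSMul (Y : Type*) [TopologicalSpace Y]
    (H : Subgroup (Y ≃ₜ Y)) : ContinuousConstSMul H Y := ⟨fun f => f.1.continuous⟩

/-- The group `X_nr^u(L)` of unitary unramified characters of `L`: the homomorphisms `L → S¹` that
are trivial on every compact subgroup of `L`. (If `L` is locally profinite, it has compact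
open subgroups, so these are automatically continuous.) -/
def unitaryUnramified (L : Type*) [Group L] [TopologicalSpace L] : Subgroup (L →* Circle) where
  carrier := {χ | ∀ K : Subgroup L, IsCompact (K : Set L) → ∀ k ∈ K, χ k = 1}
  mul_mem' {χ ψ} hχ hψ K hK k hk := by simp [hχ K hK k hk, hψ K hK k hk]
  one_mem' _ _ _ _ := rfl
  inv_mem' {χ} hχ K hK k hk := by simp [hχ K hK k hk]

namespace unitaryUnramified

variable {L : Type*} [Group L] [TopologicalSpace L]

/-- `X_nr^u(L)` carries the topology of pointwise convergence. -/
instance : TopologicalSpace (unitaryUnramified L) :=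
  TopologicalSpace.induced (fun χ (l : L) => χ.1 l) inferInstance

theorem isEmbedding : Topology.IsEmbedding fun (χ : unitaryUnramified L) (l : L) => χ.1 l where
  eq_induced := rfl
  injective χ ψ h := by
    ext l
    exact congrArg Subtype.val (congrFun h l)

instance : CompactSpace (unitaryUnramified L) := by
  have hcl : IsClosed (Set.range fun (χ : unitaryUnramified L) (l : L) => χ.1 l) := by
    have : (Set.range fun (χ : unitaryUnramified L) (l : L) => χ.1 l) =
        {f | ∀ l l', f (l * l') = f l * f l'} ∩
          ⋂ (K : Subgroup L) (_ : IsCompact (K : Set L)) (k : L) (_ : k ∈ K),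
            {f | f k = 1} := by
      ext f
      constructor
      · rintro ⟨χ, rfl⟩
        refine ⟨fun l l' => map_mul χ.1 l l', ?_⟩
        simp only [Set.mem_iInter]
        exact fun K hK k hk => χ.2 K hK k hk
      · rintro ⟨h1, h2⟩
        simp only [Set.mem_iInter] at h2
        exact ⟨⟨MonoidHom.mk' f h1, fun K hK k hk => h2 K hK k hk⟩, rfl⟩
    rw [this]
    refine IsClosed.inter ?_ ?_
    · simp only [Set.ofPred_forall]
      exact isClosed_iInter fun l => isClosed_iInter fun l' =>
        isClosed_eq (continuous_apply _) ((continuous_apply l).mul (continuous_apply l'))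
    · exact isClosed_iInter fun K => isClosed_iInter fun _ => isClosed_iInter fun k =>
        isClosed_iInter fun _ => isClosed_eq (continuous_apply _) continuous_const
  exact (Topology.IsClosedEmbedding.mk isEmbedding hcl).compactSpace

end unitaryUnramified

variable {G : Type*} [Group G] [TopologicalSpace G] [IsTopologicalGroup G] {L : Subgroup G}

/-- Conjugation `l ↦ n⁻¹ l n` on `L`, for `n ∈ N_G(L)`. -/
def conjInv (n : Subgroup.normalizer (L : Set G)) : L ≃* L := (L.normalizerMonoidHom n)⁻¹

theorem conjInv_apply (n : Subgroup.normalizer (L : Set G)) (l : L) :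
    (conjInv n l : G) = (n : G)⁻¹ * l * n := by
  rw [conjInv, ← map_inv, Subgroup.normalizerMonoidHom_apply_apply_coe]
  simp

theorem continuous_conjInv (n : Subgroup.normalizer (L : Set G)) : Continuous (conjInv n) := by
  rw [continuous_induced_rng]
  have : (Subtype.val ∘ conjInv n) = fun l : L => (n : G)⁻¹ * l * n :=
    funext fun l => conjInv_apply n l
  rw [this]
  fun_prop

/-- The action of `N_G(L)` on `X_nr^u(L)`: `(n · χ)(l) = χ(n⁻¹ l n)`. -/
def conjChar (n : Subgroup.normalizer (L : Set G)) (χ : unitaryUnramified L) :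
    unitaryUnramified L :=
  ⟨χ.1.comp (conjInv n).toMonoidHom, fun K hK k hk => by
    refine χ.2 (K.map (conjInv n).toMonoidHom) ?_ _ ⟨k, hk, rfl⟩
    exact hK.image (continuous_conjInv n)⟩

theorem conjChar_inv_conjChar (n : Subgroup.normalizer (L : Set G)) (χ : unitaryUnramified L) :
    conjChar n⁻¹ (conjChar n χ) = χ := by
  ext l
  change ((χ.1 (conjInv n (conjInv n⁻¹ l)) : Circle) : ℂ) = _
  congr 2
  ext
  rw [conjInv_apply, conjInv_apply]
  simp [mul_assoc]

theorem continuous_conjChar (n : Subgroup.normalizer (L : Set G)) :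
    Continuous (conjChar n) :=
  continuous_induced_rng.mpr <| continuous_pi fun l =>
    (continuous_apply (conjInv n l)).comp continuous_induced_dom

theorem continuous_mul_char (χ₁ : unitaryUnramified L) :
    Continuous fun χ : unitaryUnramified L => χ₁ * χ :=
  continuous_induced_rng.mpr <| continuous_pi fun l =>
    continuous_const.mul ((continuous_apply l).comp continuous_induced_dom)

/-- The homeomorphism `χ ↦ χ₁ ⊗ (n · χ)` of `X_nr^u(L)`. -/
def affineHomeo (n : Subgroup.normalizer (L : Set G)) (χ₁ : unitaryUnramified L) :
    unitaryUnramified L ≃ₜ unitaryUnramified L where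
  toFun χ := χ₁ * conjChar n χ
  invFun χ := conjChar n⁻¹ (χ₁⁻¹ * χ)
  left_inv χ := by simp only [inv_mul_cancel_left, conjChar_inv_conjChar]
  right_inv χ := by
    have := conjChar_inv_conjChar n⁻¹ (χ₁⁻¹ * χ)
    rw [inv_inv] at this
    simp only [this, mul_inv_cancel_left]
  continuous_toFun := (continuous_mul_char χ₁).comp (continuous_conjChar n)
  continuous_invFun := (continuous_conjChar n⁻¹).comp (continuous_mul_char χ₁⁻¹)

/-- `n · σ ≅ σ ⊗ χ₁` as representations of `L`, where `(n · σ)(l) = σ(n⁻¹ l n)`. -/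
def TwistIso {V : Type*} [AddCommGroup V] [Module ℂ V] (σ : Representation ℂ L V)
    (n : Subgroup.normalizer (L : Set G)) (χ₁ : unitaryUnramified L) : Prop :=
  ∃ φ : V ≃ₗ[ℂ] V, ∀ (l : L) (v : V), φ (σ (conjInv n l) v) = (χ₁.1 l : ℂ) • σ l (φ v)

/-- The group `W_𝔰^e`, for `𝔰 = [L, σ]`: the group of transformations of `X_nr^u(L)` generated by
the maps `χ ↦ χ₁ ⊗ (n · χ)` with `n ∈ N_G(L)`, `χ₁ ∈ X_nr^u(L)` and `n · σ ≅ σ ⊗ χ₁`. For `n = 1`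
these are the translations by the `χ₁` with `σ ≅ σ ⊗ χ₁`. -/
def extWeylGroup (L : Subgroup G) {V : Type*} [AddCommGroup V] [Module ℂ V]
    (σ : Representation ℂ L V) : Subgroup (unitaryUnramified L ≃ₜ unitaryUnramified L) :=
  Subgroup.closure {f | ∃ n χ₁, TwistIso σ n χ₁ ∧ f = affineHomeo n χ₁}

end Bernstein

end

/-! Write Γ for the finite group, Y for the space of characters, H for the stabilizer of the simplex
τ', and r_i for representatives of the cosets i in Γ/H. Two geometric facts drive the proof. An
element of H acts on τ' by an affine map that permutes the vertices; it fixes the barycenter, hence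
every interior point because interior stabilizers coincide, hence all of τ'. An element outside H
carries τ' to a different simplex, which meets τ' only in ∂τ'. These facts are recorded as `IsCell`,
and imply that τ is τ' with identifications only inside ∂τ'.

Restriction of an element of A to the orbit of a point y in τ' gives a matrix indexed by Γ/H with
entries in the twisted group algebra of H: the (i, j) entry collects the coefficients at r_i h
r_j⁻¹, evaluated at r_i y and multiplied by a scalar that absorbs the cocycle (`localEntry`).
Letting y vary, one obtains a ⋆-homomorphism from the ideal of ∂τ to matrices over C₀(τ, ∂τ; ℂ[H,
♮⁻¹]). Its kernel is the ideal of τ, because these ideals are described by the vanishing of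
coefficients (`mem_relIdeal_iff`), and it is surjective by Tietze extension
(`IsCell.exists_localEntry_eq`). So the subquotient is a full matrix algebra over C₀(τ, ∂τ) ⊗ ℂ[H,
♮⁻¹] (`IsCell.nonempty_starAlgEquiv`).

A column of the matrices is an imprimitivity bimodule (`MoritaEquivalent.of_matrix`). For K-theory,
ℂ[H, ♮⁻¹] is a finite dimensional C⋆-algebra, hence a product of matrix algebras over ℂ indexed by a
finite set J, and the subquotient becomes a product over J of matrix algebras over C₀(τ, ∂τ). K₀ of
such a product is K₀(C₀(τ, ∂τ))^J (`K0.nonempty_addEquiv_pi`); since the algebras have no unit, this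
rests on excision for a split cartesian square of unitizations. Applied to suspensions it also
yields K₁. Finally R(ℂ[H, ♮⁻¹]) is free on the simple modules (`RepGroup.nonempty_addEquiv_pi`), so
the power indexed by J is a tensor product with it. -/

noncomputable section

/-! ### Equivalence of idempotent matrices and classes in `K₀` -/

namespace UnitalK0

open Matrix

section Equivalence

variable {R S : Type*} [Ring R] [Ring S]
  {l m n p : Type*} [Fintype l] [Fintype m] [Fintype n] [Fintype p]

/-- Equivalence of idempotent matrices indexed by arbitrary finite types. -/
def Equivalent (e : Matrix m m R) (f : Matrix n n R) : Prop :=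
  ∃ (x : Matrix m n R) (y : Matrix n m R), x * y = e ∧ y * x = f

theorem Equivalent.refl {e : Matrix m m R} (he : e * e = e) : Equivalent e e := ⟨e, e, he, he⟩

theorem Equivalent.symm {e : Matrix m m R} {f : Matrix n n R} (h : Equivalent e f) :
    Equivalent f e := by
  obtain ⟨x, y, h1, h2⟩ := h
  exact ⟨y, x, h2, h1⟩

/-- With e = xy, f = yx = zw and g = wz, the witnesses are xz and wy, since (xz)(wy) = x(yx)y = e².
Only the outer matrices have to be assumed idempotent. -/
theorem Equivalent.trans {e : Matrix m m R} {f : Matrix n n R} {g : Matrix p p R}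
    (he : e * e = e) (hg : g * g = g) (h : Equivalent e f) (h' : Equivalent f g) :
    Equivalent e g := by
  obtain ⟨x, y, rfl, h2⟩ := h
  obtain ⟨z, w, h3, rfl⟩ := h'
  refine ⟨x * z, w * y, ?_, ?_⟩
  · calc x * z * (w * y) = x * (z * w) * y := by simp only [Matrix.mul_assoc]
      _ = x * y * (x * y) := by rw [h3, ← h2]; simp only [Matrix.mul_assoc]
      _ = x * y := he
  · calc w * y * (x * z) = w * (y * x) * z := by simp only [Matrix.mul_assoc]
      _ = w * z * (w * z) := by rw [h2, ← h3]; simp only [Matrix.mul_assoc]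
      _ = w * z := hg

theorem Equivalent.submatrix {e : Matrix m m R} (he : e * e = e) (σ : n ≃ m) :
    Equivalent e (e.submatrix σ σ) := by
  refine ⟨e.submatrix id σ, e.submatrix σ id, ?_, ?_⟩
  · rw [Matrix.submatrix_mul_equiv, he, Matrix.submatrix_id_id]
  · rw [← Matrix.submatrix_mul _ _ _ _ _ Function.bijective_id, he]

theorem Equivalent.fromBlocks {e : Matrix m m R} {e' : Matrix n n R} {f : Matrix l l R}
    {f' : Matrix p p R} (h : Equivalent e e') (h' : Equivalent f f') :
    Equivalent (Matrix.fromBlocks e 0 0 f) (Matrix.fromBlocks e' 0 0 f') := by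
  obtain ⟨x, y, rfl, rfl⟩ := h
  obtain ⟨z, w, rfl, rfl⟩ := h'
  exact ⟨Matrix.fromBlocks x 0 0 z, Matrix.fromBlocks y 0 0 w, by simp [fromBlocks_multiply],
    by simp [fromBlocks_multiply]⟩

theorem fromBlocks_idem {e : Matrix m m R} {f : Matrix n n R} (he : e * e = e) (hf : f * f = f) :
    Matrix.fromBlocks e 0 0 f * Matrix.fromBlocks e 0 0 f = Matrix.fromBlocks e 0 0 f := by
  simp [fromBlocks_multiply, he, hf]

theorem submatrix_idem {e : Matrix m m R} (he : e * e = e) (σ : n ≃ m) :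
    e.submatrix σ σ * e.submatrix σ σ = e.submatrix σ σ := by
  rw [Matrix.submatrix_mul_equiv, he]

theorem map_idem {e : Matrix m m R} (he : e * e = e) (φ : R →+* S) :
    e.map φ * e.map φ = e.map φ := by
  rw [← Matrix.map_mul, he]

theorem compl_idem [DecidableEq m] {e : Matrix m m R} (he : e * e = e) :
    (1 - e) * (1 - e) = 1 - e := by
  rw [sub_mul, mul_sub, mul_sub, he]
  simp

theorem Equivalent.fromBlocks_comm {e : Matrix m m R} {f : Matrix n n R} (he : e * e = e)
    (hf : f * f = f) :
    Equivalent (Matrix.fromBlocks e 0 0 f) (Matrix.fromBlocks f 0 0 e) := by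
  have h := Equivalent.submatrix (fromBlocks_idem he hf) (Equiv.sumComm n m)
  rwa [show (Matrix.fromBlocks e 0 0 f).submatrix (Equiv.sumComm n m) (Equiv.sumComm n m) =
    Matrix.fromBlocks f 0 0 e by ext (i | i) (j | j) <;> rfl] at h

theorem Equivalent.fromBlocks_assoc {e : Matrix m m R} {f : Matrix n n R} {g : Matrix p p R}
    (he : e * e = e) (hf : f * f = f) (hg : g * g = g) :
    Equivalent (Matrix.fromBlocks (Matrix.fromBlocks e 0 0 f) 0 0 g)
      (Matrix.fromBlocks e 0 0 (Matrix.fromBlocks f 0 0 g)) := by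
  have h := Equivalent.submatrix (fromBlocks_idem (fromBlocks_idem he hf) hg)
    (Equiv.sumAssoc m n p).symm
  rwa [show (Matrix.fromBlocks (Matrix.fromBlocks e 0 0 f) 0 0 g).submatrix
    (Equiv.sumAssoc m n p).symm (Equiv.sumAssoc m n p).symm =
    Matrix.fromBlocks e 0 0 (Matrix.fromBlocks f 0 0 g) by
      ext (i | i | i) (j | j | j) <;> rfl] at h

/-- A free module is the direct sum of the image and the kernel of e; the two blocks are the
projections to these summands. -/
theorem Equivalent.fromBlocks_compl [DecidableEq m] {e : Matrix m m R} (he : e * e = e) :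
    Equivalent (Matrix.fromBlocks e 0 0 (1 - e)) (1 : Matrix m m R) := by
  refine ⟨Matrix.fromRows e (1 - e), Matrix.fromCols e (1 - e), ?_, ?_⟩
  · rw [Matrix.fromRows_mul_fromCols, he, compl_idem he, mul_sub, sub_mul, he]
    simp
  · rw [Matrix.fromCols_mul_fromRows, he, compl_idem he]
    simp

theorem Equivalent.fromBlocks_zero {e : Matrix m m R} (he : e * e = e) :
    Equivalent (Matrix.fromBlocks e 0 0 (0 : Matrix n n R)) e :=
  ⟨Matrix.fromRows e 0, Matrix.fromCols e 0, by rw [Matrix.fromRows_mul_fromCols, he]; simp,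
    by rw [Matrix.fromCols_mul_fromRows, he]; simp⟩

theorem Equivalent.zero_fromBlocks {e : Matrix m m R} (he : e * e = e) :
    Equivalent (Matrix.fromBlocks (0 : Matrix n n R) 0 0 e) e :=
  (fromBlocks_comm (by simp) he).trans (fromBlocks_idem (by simp) he) he (fromBlocks_zero he)

theorem fromBlocks_one_one [DecidableEq m] [DecidableEq n] :
    Matrix.fromBlocks (1 : Matrix m m R) 0 0 (1 : Matrix n n R) = 1 := Matrix.fromBlocks_one

end Equivalence

section Classes

variable {R S : Type*} [Ring R] [Ring S]
  {m n p : Type*} [Fintype m] [Fintype n] [Fintype p]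

/-- The quotient map from the free abelian group on idempotent matrices. -/
def mk : FreeAbelianGroup (IdempotentMatrix R) →+ UnitalK0 R :=
  QuotientAddGroup.mk' (K0Relations R)

theorem mk_surjective : Function.Surjective (mk (R := R)) :=
  QuotientAddGroup.mk'_surjective (K0Relations R)

theorem mk_eq_zero {x : FreeAbelianGroup (IdempotentMatrix R)} :
    mk x = 0 ↔ x ∈ K0Relations R :=
  QuotientAddGroup.eq_zero_iff x

theorem map_mk (φ : R →+* S) (x : FreeAbelianGroup (IdempotentMatrix R)) :
    UnitalK0.map φ (mk x) = mk (FreeAbelianGroup.map (IdempotentMatrix.map φ) x) := rfl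

/-- An idempotent matrix indexed by a finite type, reindexed by an initial segment. -/
def toIdempotentMatrix (e : Matrix m m R) (he : e * e = e) : IdempotentMatrix R :=
  ⟨Fintype.card m, e.submatrix (Fintype.equivFin m).symm (Fintype.equivFin m).symm,
    submatrix_idem he _⟩

/-- The class in `K₀` of an idempotent matrix indexed by a finite type. -/
def cls (e : Matrix m m R) (he : e * e = e) : UnitalK0 R :=
  mk (FreeAbelianGroup.of (toIdempotentMatrix e he))

theorem mk_eq_of_equivalent {e f : IdempotentMatrix R} (h : e.Equivalent f) :
    mk (FreeAbelianGroup.of e) = mk (FreeAbelianGroup.of f) := by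
  rw [← sub_eq_zero, ← map_sub]
  exact mk_eq_zero.mpr (AddSubgroup.subset_closure (Or.inl ⟨e, f, h, rfl⟩))

theorem mk_sum (e f : IdempotentMatrix R) :
    mk (FreeAbelianGroup.of (e.sum f)) =
      mk (FreeAbelianGroup.of e) + mk (FreeAbelianGroup.of f) := by
  rw [← sub_eq_zero, ← map_add, ← map_sub]
  exact mk_eq_zero.mpr (AddSubgroup.subset_closure (Or.inr ⟨e, f, rfl⟩))

theorem cls_eq {e : Matrix m m R} {f : Matrix n n R} {he : e * e = e} {hf : f * f = f}
    (h : Equivalent e f) : cls e he = cls f hf :=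
  mk_eq_of_equivalent <|
    ((Equivalent.submatrix he _).symm.trans (submatrix_idem he _) hf h).trans
      (submatrix_idem he _) (submatrix_idem hf _) (Equivalent.submatrix hf _)

theorem mk_of (e : IdempotentMatrix R) :
    mk (FreeAbelianGroup.of e) = cls e.2.1 e.2.2 :=
  mk_eq_of_equivalent (Equivalent.submatrix e.2.2 _)

theorem cls_fromBlocks {e : Matrix m m R} {f : Matrix n n R} (he : e * e = e) (hf : f * f = f) :
    cls (Matrix.fromBlocks e 0 0 f) (fromBlocks_idem he hf) = cls e he + cls f hf := by
  rw [cls, cls, cls, ← mk_sum]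
  refine mk_eq_of_equivalent ?_
  refine ((Equivalent.submatrix (fromBlocks_idem he hf) _).symm.trans (submatrix_idem
    (fromBlocks_idem he hf) _) ?_ ((Equivalent.submatrix he _).fromBlocks
    (Equivalent.submatrix hf _))).trans (submatrix_idem (fromBlocks_idem he hf) _) ?_
    (Equivalent.submatrix ?_ finSumFinEquiv.symm)
  · exact fromBlocks_idem (submatrix_idem he _) (submatrix_idem hf _)
  · exact submatrix_idem (fromBlocks_idem (submatrix_idem he _) (submatrix_idem hf _)) _
  · exact fromBlocks_idem (submatrix_idem he _) (submatrix_idem hf _)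

theorem cls_zero : cls (0 : Matrix m m R) (by simp) = 0 := by
  have h := cls_fromBlocks (R := R) (m := m) (n := m) (e := 0) (f := 0) (by simp) (by simp)
  rw [cls_eq (Equivalent.fromBlocks_zero (by simp)) (hf := by simp)] at h
  simpa using h

theorem map_cls (φ : R →+* S) (e : Matrix m m R) (he : e * e = e) :
    UnitalK0.map φ (cls e he) = cls (e.map φ) (map_idem he φ) := by
  rw [cls, map_mk, FreeAbelianGroup.map_of_apply]
  rfl

theorem cls_add_compl [DecidableEq m] {e : Matrix m m R} (he : e * e = e) :
    cls e he + cls (1 - e) (compl_idem he) = cls (1 : Matrix m m R) (by simp) := by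
  rw [← cls_fromBlocks]
  exact cls_eq (Equivalent.fromBlocks_compl he)

/-- Every class in `K₀` has the form `[e] - [1]`. -/
theorem exists_eq_cls_sub (a : UnitalK0 R) : ∃ (k l : ℕ) (e : Matrix (Fin k) (Fin k) R)
    (he : e * e = e), a = cls e he - cls (1 : Matrix (Fin l) (Fin l) R) (by simp) := by
  have h1 : ∃ (k l : ℕ) (e : Matrix (Fin k) (Fin k) R) (f : Matrix (Fin l) (Fin l) R)
      (he : e * e = e) (hf : f * f = f), a = cls e he - cls f hf := by
    obtain ⟨x, rfl⟩ := mk_surjective a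
    have h0 : cls (0 : Matrix (Fin 0) (Fin 0) R) (by simp) = 0 := cls_zero
    induction x using FreeAbelianGroup.induction_on with
    | zero => exact ⟨0, 0, 0, 0, by simp, by simp, by simp⟩
    | of e => exact ⟨_, _, e.2.1, 0, e.2.2, by simp, by rw [mk_of, h0, sub_zero]⟩
    | neg e _ => exact ⟨_, _, 0, e.2.1, by simp, e.2.2, by rw [map_neg, mk_of, h0, zero_sub]⟩
    | add x y hx hy =>
      obtain ⟨k, l, e, f, he, hf, h⟩ := hx
      obtain ⟨k', l', e', f', he', hf', h'⟩ := hy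
      refine ⟨_, _, _, _, submatrix_idem (fromBlocks_idem he he') finSumFinEquiv.symm,
        submatrix_idem (fromBlocks_idem hf hf') finSumFinEquiv.symm, ?_⟩
      rw [← cls_eq (he := fromBlocks_idem he he')
        (Equivalent.submatrix (fromBlocks_idem he he') finSumFinEquiv.symm),
        ← cls_eq (he := fromBlocks_idem hf hf')
        (Equivalent.submatrix (fromBlocks_idem hf hf') finSumFinEquiv.symm),
        cls_fromBlocks he he', cls_fromBlocks hf hf', map_add, h, h']
      abel
  obtain ⟨k, l, e, f, he, hf, rfl⟩ := h1
  -- Since [f] + [1 - f] = [1], the difference [e] - [f] equals [e ⊕ (1 - f)] - [1].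
  have hi := fromBlocks_idem he (compl_idem hf)
  refine ⟨_, l, _, submatrix_idem hi finSumFinEquiv.symm, ?_⟩
  rw [← cls_eq (he := hi) (Equivalent.submatrix hi finSumFinEquiv.symm),
    cls_fromBlocks he (compl_idem hf),
    ← cls_add_compl hf]
  abel

end Classes

section Equality

variable {R : Type*} [Ring R]

variable (R) in
/-- Equivalence of idempotent matrices as a setoid. -/
def idemSetoid : Setoid (IdempotentMatrix R) where
  r := IdempotentMatrix.Equivalent
  iseqv :=
    { refl := fun e => Equivalent.refl e.2.2
      symm := fun {e f} h => Equivalent.symm (e := e.2.1) (f := f.2.1) h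
      trans := fun {e f g} h h' => Equivalent.trans (e := e.2.1) (f := f.2.1) (g := g.2.1)
        e.2.2 g.2.2 h h' }

variable (R) in
/-- The monoid of equivalence classes of idempotent matrices. -/
def IdemClass : Type _ := Quotient (idemSetoid R)

namespace IdemClass

/-- The equivalence class of an idempotent matrix. -/
def mk (e : IdempotentMatrix R) : IdemClass R := Quotient.mk (idemSetoid R) e

theorem mk_eq {e f : IdempotentMatrix R} : mk e = mk f ↔ e.Equivalent f :=
  Quotient.eq (r := idemSetoid R)

theorem sum_equivalent (e f : IdempotentMatrix R) :
    UnitalK0.Equivalent (Matrix.fromBlocks e.2.1 0 0 f.2.1) (e.sum f).2.1 :=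
  Equivalent.submatrix (fromBlocks_idem e.2.2 f.2.2) _

instance : Add (IdemClass R) :=
  ⟨Quotient.map₂ IdempotentMatrix.sum (by
    intro e e' he f f' hf
    have h1 := (sum_equivalent e f).symm
    have h2 := sum_equivalent e' f'
    exact (h1.trans (e.sum f).2.2 (fromBlocks_idem e'.2.2 f'.2.2)
      (Equivalent.fromBlocks he hf)).trans (e.sum f).2.2 (e'.sum f').2.2 h2)⟩

theorem mk_sum (e f : IdempotentMatrix R) : mk (e.sum f) = mk e + mk f := rfl

theorem mk_sum_comm (e f : IdempotentMatrix R) : mk (e.sum f) = mk (f.sum e) := by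
  refine mk_eq.mpr ?_
  exact ((sum_equivalent e f).symm.trans (e.sum f).2.2 (fromBlocks_idem f.2.2 e.2.2)
    (Equivalent.fromBlocks_comm e.2.2 f.2.2)).trans (e.sum f).2.2 (f.sum e).2.2
    (sum_equivalent f e)

theorem mk_sum_assoc (e f g : IdempotentMatrix R) :
    mk ((e.sum f).sum g) = mk (e.sum (f.sum g)) := by
  refine mk_eq.mpr ?_
  have i1 := fromBlocks_idem (fromBlocks_idem e.2.2 f.2.2) g.2.2
  have i2 := fromBlocks_idem e.2.2 (fromBlocks_idem f.2.2 g.2.2)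
  have i3 := ((e.sum f).sum g).2.2
  have i4 := (e.sum (f.sum g)).2.2
  have h1 := (sum_equivalent (e.sum f) g).symm.trans i3 i1
    ((sum_equivalent e f).symm.fromBlocks (Equivalent.refl g.2.2))
  have h2 := ((Equivalent.refl e.2.2).fromBlocks (sum_equivalent f g)).trans i2 i4
    (sum_equivalent e (f.sum g))
  exact (h1.trans i3 i2 (Equivalent.fromBlocks_assoc e.2.2 f.2.2 g.2.2)).trans i3 i4 h2

/-- The empty idempotent matrix. -/
def empty : IdempotentMatrix R := ⟨0, 0, by simp⟩

theorem mk_sum_empty (e : IdempotentMatrix R) : mk (e.sum empty) = mk e := by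
  refine mk_eq.mpr ?_
  exact (sum_equivalent e empty).symm.trans (e.sum empty).2.2 e.2.2
    (Equivalent.fromBlocks_zero e.2.2)

theorem mk_surjective : Function.Surjective (mk (R := R)) := Quotient.mk_surjective

instance : Zero (IdemClass R) := ⟨mk empty⟩

theorem add_comm' (a b : IdemClass R) : a + b = b + a := by
  obtain ⟨e, rfl⟩ := mk_surjective a
  obtain ⟨f, rfl⟩ := mk_surjective b
  exact mk_sum_comm e f

theorem add_zero' (a : IdemClass R) : a + 0 = a := by
  obtain ⟨e, rfl⟩ := mk_surjective a
  exact mk_sum_empty e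

instance : AddCommMonoid (IdemClass R) where
  add_assoc a b c := by
    obtain ⟨e, rfl⟩ := mk_surjective a
    obtain ⟨f, rfl⟩ := mk_surjective b
    obtain ⟨g, rfl⟩ := mk_surjective c
    exact mk_sum_assoc e f g
  zero_add a := by rw [add_comm', add_zero']
  add_zero := add_zero'
  add_comm := add_comm'
  nsmul := nsmulRec

end IdemClass

/-- Comparison of `K₀` with the Grothendieck group of the monoid of idempotent matrices. -/
def toGrothendieck : UnitalK0 R →+ Algebra.GrothendieckAddGroup (IdemClass R) :=
  QuotientAddGroup.lift (K0Relations R)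
    (FreeAbelianGroup.lift fun e => Algebra.GrothendieckAddGroup.of (IdemClass.mk e)) (by
      rw [K0Relations, AddSubgroup.closure_le]
      rintro x (⟨e, f, h, rfl⟩ | ⟨e, f, rfl⟩)
      · simp [IdemClass.mk_eq.mpr h]
      · simp [IdemClass.mk_sum])

theorem toGrothendieck_mk (e : IdempotentMatrix R) :
    toGrothendieck (mk (FreeAbelianGroup.of e)) =
      Algebra.GrothendieckAddGroup.of (IdemClass.mk e) :=
  FreeAbelianGroup.lift_apply_of _ _

variable {m n p : Type*} [Fintype m] [Fintype n] [Fintype p]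

/-- As 1 is equivalent to g ⊕ (1 - g), adding an identity matrix amounts to adding g and then 1 - g.
This turns stabilization by an arbitrary idempotent g into stabilization by an identity matrix. -/
theorem fromBlocks_one_equivalent (g : IdempotentMatrix R) (a : Matrix m m R) (ha : a * a = a) :
    Equivalent (Matrix.fromBlocks a 0 0 (1 : Matrix (Fin g.1) (Fin g.1) R))
      (Matrix.fromBlocks ((toIdempotentMatrix a ha).sum g).2.1 0 0 (1 - g.2.1)) := by
  have ig := g.2.2
  have ig' := compl_idem ig
  have i0 := fromBlocks_idem ha (show (1 : Matrix (Fin g.1) (Fin g.1) R) * 1 = 1 by simp)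
  have i2 := fromBlocks_idem (fromBlocks_idem ha ig) ig'
  have i3 := fromBlocks_idem ha (fromBlocks_idem ig ig')
  have i4 := fromBlocks_idem ((toIdempotentMatrix a ha).sum g).2.2 ig'
  have h1 := (Equivalent.refl ha).fromBlocks (Equivalent.fromBlocks_compl ig).symm
  have h2 := (Equivalent.fromBlocks_assoc ha ig ig').symm
  have h3 : Equivalent (Matrix.fromBlocks a 0 0 g.2.1)
      ((toIdempotentMatrix a ha).sum g).2.1 :=
    ((Equivalent.submatrix ha _).fromBlocks (Equivalent.refl ig)).trans
      (fromBlocks_idem ha ig) ((toIdempotentMatrix a ha).sum g).2.2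
      (IdemClass.sum_equivalent (toIdempotentMatrix a ha) g)
  exact (h1.trans i0 i2 h2).trans i0 i4 (h3.fromBlocks (Equivalent.refl ig'))

/-- Two idempotent matrices have the same class in `K₀` only if they become equivalent after
addition of an identity matrix. -/
theorem exists_equivalent_of_cls_eq {e : Matrix m m R} {f : Matrix n n R} {he : e * e = e}
    {hf : f * f = f} (h : cls e he = cls f hf) :
    ∃ k : ℕ, Equivalent (Matrix.fromBlocks e 0 0 (1 : Matrix (Fin k) (Fin k) R))
      (Matrix.fromBlocks f 0 0 (1 : Matrix (Fin k) (Fin k) R)) := by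
  have h1 := congrArg toGrothendieck h
  rw [cls, cls, toGrothendieck_mk, toGrothendieck_mk] at h1
  -- The Grothendieck group is the localization of the monoid at all of its elements, so equality
  -- there means equality after adding one common class.
  obtain ⟨c, hc⟩ : ∃ c, c + IdemClass.mk (toIdempotentMatrix e he) =
      c + IdemClass.mk (toIdempotentMatrix f hf) := by
    replace h1 : AddLocalization.mk (IdemClass.mk (toIdempotentMatrix e he))
        (0 : (⊤ : AddSubmonoid (IdemClass R))) =
      AddLocalization.mk (IdemClass.mk (toIdempotentMatrix f hf)) 0 := h1
    rw [AddLocalization.mk_eq_mk_iff, AddLocalization.r_iff_exists] at h1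
    obtain ⟨c, hc⟩ := h1
    exact ⟨c, by simpa using hc⟩
  obtain ⟨g, rfl⟩ := IdemClass.mk_surjective c
  rw [add_comm, add_comm (IdemClass.mk g), ← IdemClass.mk_sum, ← IdemClass.mk_sum] at hc
  have i1 := fromBlocks_idem he (show (1 : Matrix (Fin g.1) (Fin g.1) R) * 1 = 1 by simp)
  have i2 := fromBlocks_idem hf (show (1 : Matrix (Fin g.1) (Fin g.1) R) * 1 = 1 by simp)
  have ig' := compl_idem g.2.2
  exact ⟨g.1, ((fromBlocks_one_equivalent g e he).trans i1
    (fromBlocks_idem ((toIdempotentMatrix f hf).sum g).2.2 ig')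
    (Equivalent.fromBlocks (IdemClass.mk_eq.mp hc) (Equivalent.refl ig'))).trans i1 i2
    (fromBlocks_one_equivalent g f hf).symm⟩

end Equality

end UnitalK0
end

/-! ### Stabilization of idempotents and excision -/

noncomputable section

namespace UnitalK0

open Matrix

section Stabilization

variable {R S : Type*} [Ring R] [Ring S] {m n p : Type*} [Fintype m] [Fintype n] [Fintype p]

theorem cls_fromBlocks_one_sub [DecidableEq n] (p : Type*) [Fintype p] [DecidableEq p]
    {e : Matrix m m R} (he : e * e = e) :
    cls (fromBlocks e 0 0 (1 : Matrix p p R)) (fromBlocks_idem he (by simp)) -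
      cls (1 : Matrix (n ⊕ p) (n ⊕ p) R) (by simp) =
    cls e he - cls (1 : Matrix n n R) (by simp) := by
  have h1 : cls (1 : Matrix (n ⊕ p) (n ⊕ p) R) (by simp) =
      cls (1 : Matrix n n R) (by simp) + cls (1 : Matrix p p R) (by simp) := by
    rw [← cls_fromBlocks]
    simp only [fromBlocks_one_one]
  rw [cls_fromBlocks he (by simp), h1]
  abel

theorem map_fromBlocks_one [DecidableEq n] (φ : R →+* S) (e : Matrix m m R) :
    (fromBlocks e 0 0 (1 : Matrix n n R)).map φ = fromBlocks (e.map φ) 0 0 1 := by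
  rw [fromBlocks_map, Matrix.map_one _ (map_zero _) (map_one _), Matrix.map_zero _ (map_zero _),
    Matrix.map_zero _ (map_zero _)]

/-- Equality of classes gives an equivalence only after adding 1ₖ. That block is added to e before φ
is applied, so that one may simply replace e by e ⊕ 1ₖ. -/
theorem exists_equivalent_map [DecidableEq n] (φ : R →+* S) (e : Matrix m m R) (he : e * e = e)
    (h : UnitalK0.map φ (cls e he - cls (1 : Matrix n n R) (by simp)) = 0) :
    ∃ k : ℕ, Equivalent ((fromBlocks e 0 0 (1 : Matrix (Fin k) (Fin k) R)).map φ)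
      (1 : Matrix (n ⊕ Fin k) (n ⊕ Fin k) S) := by
  rw [map_sub, map_cls, map_cls, sub_eq_zero] at h
  obtain ⟨k, hk⟩ := exists_equivalent_of_cls_eq h
  rw [Matrix.map_one _ (map_zero _) (map_one _), fromBlocks_one_one] at hk
  exact ⟨k, by rwa [map_fromBlocks_one]⟩

end Stabilization

/-! ### Excision for split quotients -/

section Excision

variable {S S₀ S' S₀' : Type*} [Ring S] [Ring S₀] [Ring S'] [Ring S₀']
  {φ : S' →+* S} {φ₀ : S₀' →+* S₀} {ε : S →+* S₀} {ε' : S' →+* S₀'} {ι : S₀ →+* S}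
  {m n : Type*} [Fintype m] [Fintype n]

/-- The square formed by `φ`, `φ₀`, `ε`, `ε'` is cartesian, and `ε` is split by `ι`. -/
structure IsSplitCartesian (φ : S' →+* S) (φ₀ : S₀' →+* S₀) (ε : S →+* S₀) (ε' : S' →+* S₀')
    (ι : S₀ →+* S) : Prop where
  comm : ∀ x, ε (φ x) = φ₀ (ε' x)
  split : ∀ x, ε (ι x) = x
  exists_lift : ∀ x y, ε x = φ₀ y → ∃ z, φ z = x ∧ ε' z = y
  eq_of : ∀ x y, φ x = φ y → ε' x = ε' y → x = y

namespace IsSplitCartesian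

variable (h : IsSplitCartesian φ φ₀ ε ε' ι)
include h

theorem exists_lift_matrix (x : Matrix m n S) (y : Matrix m n S₀') (hxy : x.map ε = y.map φ₀) :
    ∃ z : Matrix m n S', z.map φ = x ∧ z.map ε' = y := by
  choose f hf using fun i j => h.exists_lift (x i j) (y i j) (congrFun (congrFun hxy i) j)
  exact ⟨Matrix.of f, by ext i j; exact (hf i j).1, by ext i j; exact (hf i j).2⟩

theorem eq_of_matrix {x y : Matrix m n S'} (h1 : x.map φ = y.map φ) (h2 : x.map ε' = y.map ε') :
    x = y := by
  ext i j
  exact h.eq_of _ _ (congrFun (congrFun h1 i) j) (congrFun (congrFun h2 i) j)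

theorem map_map_comm (x : Matrix m n S') : (x.map φ).map ε = (x.map ε').map φ₀ := by
  ext i j
  exact h.comm _

theorem map_split (x : Matrix m n S₀) : (x.map ι).map ε = x := by
  ext i j
  exact h.split _

/-- The given equivalences over S₀' and over S need not agree over S₀. They differ by the invertible
matrix ε(y)φ₀(u), with inverse φ₀(v)ε(x). The section ι lifts both to S, and once x and y are
corrected by these lifts, the two equivalences glue along the cartesian square. -/
theorem equivalent_one [DecidableEq n] {e : Matrix m m S'}
    (h1 : Equivalent (e.map ε') (1 : Matrix n n S₀'))
    (h2 : Equivalent (e.map φ) (1 : Matrix n n S)) : Equivalent e (1 : Matrix n n S') := by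
  obtain ⟨u, v, huv, hvu⟩ := h1
  obtain ⟨x, y, hxy, hyx⟩ := h2
  have k1 : x.map ε * y.map ε = u.map φ₀ * v.map φ₀ := by
    rw [← Matrix.map_mul, ← Matrix.map_mul, hxy, huv, h.map_map_comm]
  have k2 : v.map φ₀ * u.map φ₀ = 1 := by
    rw [← Matrix.map_mul, hvu, Matrix.map_one _ (map_zero _) (map_one _)]
  have k3 : y.map ε * x.map ε = 1 := by
    rw [← Matrix.map_mul, hyx, Matrix.map_one _ (map_zero _) (map_one _)]
  have k4 : (v.map φ₀ * x.map ε) * (y.map ε * u.map φ₀) = 1 := by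
    rw [Matrix.mul_assoc, ← Matrix.mul_assoc (x.map ε), k1, Matrix.mul_assoc, k2, Matrix.mul_one,
      k2]
  have k5 : (y.map ε * u.map φ₀) * (v.map φ₀ * x.map ε) = 1 := by
    rw [Matrix.mul_assoc, ← Matrix.mul_assoc (u.map φ₀), ← k1, Matrix.mul_assoc, k3,
      Matrix.mul_one, k3]
  have k6 : (y.map ε * u.map φ₀).map ι * (v.map φ₀ * x.map ε).map ι = 1 := by
    rw [← Matrix.map_mul, k5, Matrix.map_one _ (map_zero _) (map_one _)]
  have k7 : (v.map φ₀ * x.map ε).map ι * (y.map ε * u.map φ₀).map ι = 1 := by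
    rw [← Matrix.map_mul, k4, Matrix.map_one _ (map_zero _) (map_one _)]
  obtain ⟨x', hx1, hx2⟩ := h.exists_lift_matrix (x * (y.map ε * u.map φ₀).map ι) u (by
    rw [Matrix.map_mul, h.map_split, ← Matrix.mul_assoc, k1, Matrix.mul_assoc, k2,
      Matrix.mul_one])
  obtain ⟨y', hy1, hy2⟩ := h.exists_lift_matrix ((v.map φ₀ * x.map ε).map ι * y) v (by
    rw [Matrix.map_mul, h.map_split, Matrix.mul_assoc, k1, ← Matrix.mul_assoc, k2,
      Matrix.one_mul])
  refine ⟨x', y', h.eq_of_matrix ?_ ?_, h.eq_of_matrix ?_ ?_⟩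
  · rw [Matrix.map_mul, hx1, hy1, Matrix.mul_assoc, ← Matrix.mul_assoc _ _ y, k6,
      Matrix.one_mul, hxy]
  · rw [Matrix.map_mul, hx2, hy2, huv]
  · rw [Matrix.map_mul, hx1, hy1, Matrix.mul_assoc, ← Matrix.mul_assoc y, hyx, Matrix.one_mul,
      k7, Matrix.map_one _ (map_zero _) (map_one _)]
  · rw [Matrix.map_mul, hx2, hy2, hvu, Matrix.map_one _ (map_zero _) (map_one _)]

/-- The image of e in S₀ is merely equivalent to an identity matrix, so it need not come from S₀'.
Conjugation of e ⊕ 0 by the lift of an involution makes this image equal to 0 ⊕ 1, which does come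
from S₀'; then the cartesian property applies. -/
theorem exists_equivalent [DecidableEq m] [DecidableEq n] {e : Matrix m m S} (he : e * e = e)
    (h1 : Equivalent (e.map ε) (1 : Matrix n n S₀)) :
    ∃ e' : Matrix (m ⊕ n) (m ⊕ n) S', e' * e' = e' ∧ Equivalent (e'.map φ) e ∧
      Equivalent (e'.map ε') (1 : Matrix n n S₀') := by
  obtain ⟨u, v, huv, hvu⟩ := h1
  set p := e.map ε with hp
  have hpp : p * p = p := map_idem he ε
  have hpu : p * u = u := by rw [← huv, Matrix.mul_assoc, hvu, Matrix.mul_one]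
  have hvp : v * p = v := by rw [← huv, ← Matrix.mul_assoc, hvu, Matrix.one_mul]
  -- The involution w exchanges the image of p with the second summand, through u and v, and is the
  -- identity on the kernel of p.
  let w : Matrix (m ⊕ n) (m ⊕ n) S₀ := fromBlocks (1 - p) u v 0
  have hw : w * w = 1 := by
    simp only [w, fromBlocks_multiply, compl_idem hpp, huv, hvu]
    simp [hpu, hvp, Matrix.sub_mul, Matrix.mul_sub]
  have hwp : w * fromBlocks p 0 0 0 * w = fromBlocks 0 0 0 1 := by
    simp only [w, fromBlocks_multiply]
    simp [hvp, Matrix.sub_mul, Matrix.mul_sub, hpp, hvu]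
  have hW : w.map ι * w.map ι = 1 := by
    rw [← Matrix.map_mul, hw, Matrix.map_one _ (map_zero _) (map_one _)]
  have hE : fromBlocks e 0 0 (0 : Matrix n n S) * fromBlocks e 0 0 0 = fromBlocks e 0 0 0 :=
    fromBlocks_idem he (by simp)
  obtain ⟨e', h2, h3⟩ := h.exists_lift_matrix (w.map ι * fromBlocks e 0 0 0 * w.map ι)
    (fromBlocks 0 0 0 (1 : Matrix n n S₀')) (by
      rw [Matrix.map_mul, Matrix.map_mul, h.map_split, fromBlocks_map, fromBlocks_map,
        Matrix.map_one _ (map_zero _) (map_one _), Matrix.map_zero _ (map_zero _),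
        Matrix.map_zero _ (map_zero _), Matrix.map_zero _ (map_zero _), ← hp, hwp]
      simp)
  have h4 : (w.map ι * fromBlocks e 0 0 0 * w.map ι) * (w.map ι * fromBlocks e 0 0 0 * w.map ι) =
      w.map ι * fromBlocks e 0 0 0 * w.map ι := by
    calc _ = w.map ι * fromBlocks e 0 0 0 * (w.map ι * w.map ι) * (fromBlocks e 0 0 0 * w.map ι) := by
          simp only [Matrix.mul_assoc]
      _ = w.map ι * (fromBlocks e 0 0 0 * fromBlocks e 0 0 0) * w.map ι := by
          rw [hW, Matrix.mul_one]
          simp only [Matrix.mul_assoc]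
      _ = _ := by rw [hE]
  have h5 : fromBlocks 0 0 0 (1 : Matrix n n S₀') * fromBlocks (0 : Matrix m m S₀') 0 0 1 =
      fromBlocks 0 0 0 1 := by simp [fromBlocks_multiply]
  refine ⟨e', h.eq_of_matrix ?_ ?_, ?_, ?_⟩
  · rw [Matrix.map_mul, h2, h4]
  · rw [Matrix.map_mul, h3, h5]
  · rw [h2]
    refine Equivalent.trans (f := fromBlocks e 0 0 (0 : Matrix n n S)) h4 he ?_
      (Equivalent.fromBlocks_zero he)
    refine ⟨w.map ι * fromBlocks e 0 0 0, fromBlocks e 0 0 0 * w.map ι, ?_, ?_⟩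
    · rw [Matrix.mul_assoc, ← Matrix.mul_assoc _ _ (w.map ι), hE, Matrix.mul_assoc]
    · rw [Matrix.mul_assoc, ← Matrix.mul_assoc (w.map ι), hW, Matrix.one_mul, hE]
  · rw [h3]
    exact Equivalent.zero_fromBlocks (by simp)

/-- The injective half of excision: φ is injective on the kernel of ε'. A first stabilization
trivializes e over S₀', a second one over S, and the first trivialization survives the second
enlargement. -/
theorem eq_zero {a : UnitalK0 S'} (h1 : UnitalK0.map ε' a = 0)
    (h2 : UnitalK0.map φ a = 0) : a = 0 := by
  obtain ⟨k, l, e, he, rfl⟩ := exists_eq_cls_sub a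
  obtain ⟨i, hi⟩ := exists_equivalent_map ε' e he h1
  rw [← cls_fromBlocks_one_sub (Fin i) he] at h2 ⊢
  obtain ⟨j, hj⟩ := exists_equivalent_map φ _ _ h2
  rw [← cls_fromBlocks_one_sub (Fin j), sub_eq_zero]
  refine cls_eq (h.equivalent_one ?_ hj)
  rw [map_fromBlocks_one, ← fromBlocks_one_one]
  exact hi.fromBlocks (Equivalent.refl (by simp))

/-- The surjective half of excision: the kernel of ε' maps onto the kernel of ε. -/
theorem exists_map_eq {b : UnitalK0 S} (h1 : UnitalK0.map ε b = 0) :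
    ∃ a : UnitalK0 S', UnitalK0.map ε' a = 0 ∧ UnitalK0.map φ a = b := by
  obtain ⟨k, l, e, he, rfl⟩ := exists_eq_cls_sub b
  obtain ⟨i, hi⟩ := exists_equivalent_map ε e he h1
  obtain ⟨e', he', h2, h3⟩ := h.exists_equivalent (fromBlocks_idem he (by simp)) hi
  refine ⟨cls e' he' - cls (1 : Matrix (Fin l ⊕ Fin i) (Fin l ⊕ Fin i) S') (by simp), ?_, ?_⟩
  · rw [map_sub, map_cls, map_cls, sub_eq_zero]
    refine cls_eq ?_
    rwa [Matrix.map_one _ (map_zero _) (map_one _)]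
  · rw [← cls_fromBlocks_one_sub (Fin i) he, map_sub, map_cls, map_cls,
      cls_eq (hf := fromBlocks_idem he (by simp)) h2]
    congr 1
    refine cls_eq ?_
    rw [Matrix.map_one _ (map_zero _) (map_one _)]
    exact Equivalent.refl (by simp)

end IsSplitCartesian

end Excision

end UnitalK0
end

noncomputable section

namespace UnitalK0

open Matrix

/-! ### `K₀` of products of matrix rings -/

section MatrixProduct

variable {R R' : Type*} [Ring R] [Ring R'] {J : Type*} {d : J → Type*} [∀ j, Fintype (d j)]
  {m n p : Type*} [Fintype m] [Fintype n] [Fintype p]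

/-- The `j`-th component of a matrix over `∏ⱼ M_{d j}(R)`, as a matrix over `R`. -/
def flatten (j : J) (x : Matrix m n (∀ j, Matrix (d j) (d j) R)) :
    Matrix (m × d j) (n × d j) R :=
  Matrix.of fun a b => x a.1 b.1 j a.2 b.2

theorem flatten_injective {x y : Matrix m n (∀ j, Matrix (d j) (d j) R)}
    (h : ∀ j, flatten j x = flatten j y) : x = y := by
  ext a b j s t
  exact congrFun (congrFun (h j) (a, s)) (b, t)

theorem exists_flatten (x : ∀ j, Matrix (m × d j) (n × d j) R) :
    ∃ y : Matrix m n (∀ j, Matrix (d j) (d j) R), ∀ j, flatten j y = x j :=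
  ⟨Matrix.of fun a b j => Matrix.of fun s t => x j (a, s) (b, t), fun j => by ext; rfl⟩

theorem flatten_mul (j : J) (x : Matrix m n (∀ j, Matrix (d j) (d j) R))
    (y : Matrix n p (∀ j, Matrix (d j) (d j) R)) :
    flatten j (x * y) = flatten j x * flatten j y := by
  ext a b
  simp only [flatten, Matrix.of_apply, Matrix.mul_apply, Fintype.sum_prod_type, Finset.sum_apply,
    Matrix.sum_apply, Pi.mul_apply]

variable [∀ j, DecidableEq (d j)]

theorem flatten_one [DecidableEq m] (j : J) :
    flatten j (1 : Matrix m m (∀ j, Matrix (d j) (d j) R)) = 1 := by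
  ext a b
  rw [flatten, Matrix.of_apply, Matrix.one_apply, Matrix.one_apply]
  by_cases h : a.1 = b.1
  · simp [h, Matrix.one_apply, Prod.ext_iff]
  · simp [h, Prod.ext_iff]

theorem flatten_idem (j : J) {e : Matrix m m (∀ j, Matrix (d j) (d j) R)} (he : e * e = e) :
    flatten j e * flatten j e = flatten j e := by
  rw [← flatten_mul, he]

theorem Equivalent.flatten (j : J) {e : Matrix m m (∀ j, Matrix (d j) (d j) R)}
    {f : Matrix n n (∀ j, Matrix (d j) (d j) R)} (h : Equivalent e f) :
    Equivalent (UnitalK0.flatten j e) (UnitalK0.flatten j f) := by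
  obtain ⟨x, y, rfl, rfl⟩ := h
  exact ⟨UnitalK0.flatten j x, UnitalK0.flatten j y, (flatten_mul j x y).symm,
    (flatten_mul j y x).symm⟩

theorem Equivalent.of_flatten {e : Matrix m m (∀ j, Matrix (d j) (d j) R)}
    {f : Matrix n n (∀ j, Matrix (d j) (d j) R)}
    (h : ∀ j, Equivalent (UnitalK0.flatten j e) (UnitalK0.flatten j f)) : Equivalent e f := by
  choose x y h1 h2 using h
  obtain ⟨x', hx⟩ := exists_flatten x
  obtain ⟨y', hy⟩ := exists_flatten y
  refine ⟨x', y', flatten_injective fun j => ?_, flatten_injective fun j => ?_⟩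
  · rw [flatten_mul, hx, hy, h1]
  · rw [flatten_mul, hx, hy, h2]

theorem flatten_fromBlocks_equivalent (j : J) {e : Matrix m m (∀ j, Matrix (d j) (d j) R)}
    {f : Matrix n n (∀ j, Matrix (d j) (d j) R)} (he : e * e = e) (hf : f * f = f) :
    Equivalent (flatten j (fromBlocks e 0 0 f))
      (fromBlocks (flatten j e) 0 0 (flatten j f)) := by
  have h := Equivalent.submatrix (flatten_idem j (fromBlocks_idem he hf))
    (Equiv.sumProdDistrib m n (d j)).symm
  rwa [show (flatten j (fromBlocks e 0 0 f)).submatrix (Equiv.sumProdDistrib m n (d j)).symm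
    (Equiv.sumProdDistrib m n (d j)).symm = fromBlocks (flatten j e) 0 0 (flatten j f) by
      ext (a | a) (b | b) <;> rfl] at h

/-- The component `K₀(∏ⱼ M_{d j}(R)) → K₀(M_{d j}(R)) = K₀(R)`. -/
def component (j : J) : UnitalK0 (∀ j, Matrix (d j) (d j) R) →+ UnitalK0 R :=
  QuotientAddGroup.lift (K0Relations (∀ j, Matrix (d j) (d j) R))
    (FreeAbelianGroup.lift fun e => cls (flatten j e.2.1) (flatten_idem j e.2.2)) (by
      rw [K0Relations, AddSubgroup.closure_le]
      rintro x (⟨e, f, h, rfl⟩ | ⟨e, f, rfl⟩)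
      · simp only [SetLike.mem_coe, AddMonoidHom.mem_ker, map_sub, FreeAbelianGroup.lift_apply_of,
          sub_eq_zero]
        exact cls_eq (Equivalent.flatten j h)
      · simp only [SetLike.mem_coe, AddMonoidHom.mem_ker, map_sub, map_add,
          FreeAbelianGroup.lift_apply_of, sub_eq_zero]
        rw [← cls_fromBlocks]
        refine cls_eq ?_
        exact ((IdemClass.sum_equivalent e f).symm.flatten j).trans
          (flatten_idem j (e.sum f).2.2)
          (fromBlocks_idem (flatten_idem j e.2.2) (flatten_idem j f.2.2))
          (flatten_fromBlocks_equivalent j e.2.2 f.2.2))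

theorem component_cls (j : J) (e : Matrix m m (∀ j, Matrix (d j) (d j) R)) (he : e * e = e) :
    component j (cls e he) = cls (flatten j e) (flatten_idem j he) := by
  have h : component j (cls e he) = cls (flatten j (toIdempotentMatrix e he).2.1)
    (flatten_idem j (toIdempotentMatrix e he).2.2) := FreeAbelianGroup.lift_apply_of _ _
  rw [h]
  exact cls_eq ((Equivalent.submatrix he _).symm.flatten j)

theorem component_map (φ : R →+* R') (j : J) (a : UnitalK0 (∀ j, Matrix (d j) (d j) R)) :
    component j (UnitalK0.map (RingHom.pi fun j => φ.mapMatrix.comp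
      (Pi.evalRingHom (fun j => Matrix (d j) (d j) R) j)) a) = UnitalK0.map φ (component j a) := by
  obtain ⟨k, l, e, he, rfl⟩ := exists_eq_cls_sub a
  rw [map_sub, map_cls, map_cls, map_sub, component_cls, component_cls, map_sub, component_cls,
    component_cls, map_sub, map_cls, map_cls]
  rfl

theorem Equivalent.fromBlocks_one_sum {e : Matrix m m R} (he : e * e = e) {k l : ℕ}
    [DecidableEq p] (σ : Fin k ⊕ Fin l ≃ p) :
    Equivalent (Matrix.fromBlocks e 0 0 (1 : Matrix p p R))
      (Matrix.fromBlocks (Matrix.fromBlocks e 0 0 (1 : Matrix (Fin k) (Fin k) R)) 0 0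
        (1 : Matrix (Fin l) (Fin l) R)) := by
  have h1 := Equivalent.submatrix (e := (1 : Matrix p p R)) (by simp) σ
  rw [Matrix.submatrix_one_equiv, ← fromBlocks_one_one] at h1
  have io : ∀ i : ℕ, (1 : Matrix (Fin i) (Fin i) R) * 1 = 1 := fun i => by simp
  exact ((Equivalent.refl he).fromBlocks h1).trans (fromBlocks_idem he (by simp))
    (fromBlocks_idem (fromBlocks_idem he (io k)) (io l))
    (Equivalent.fromBlocks_assoc he (io k) (io l)).symm

/-- Stabilization of an equivalence by a larger identity matrix. -/
theorem Equivalent.fromBlocks_one_of_le {e : Matrix m m R} {f : Matrix n n R} (he : e * e = e)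
    (hf : f * f = f) {k : ℕ} [DecidableEq p] (hk : k ≤ Fintype.card p)
    (h : Equivalent (Matrix.fromBlocks e 0 0 (1 : Matrix (Fin k) (Fin k) R))
      (Matrix.fromBlocks f 0 0 (1 : Matrix (Fin k) (Fin k) R))) :
    Equivalent (Matrix.fromBlocks e 0 0 (1 : Matrix p p R))
      (Matrix.fromBlocks f 0 0 (1 : Matrix p p R)) := by
  obtain ⟨l, hl⟩ := Nat.exists_eq_add_of_le hk
  let σ : Fin k ⊕ Fin l ≃ p := finSumFinEquiv.trans ((finCongr hl.symm).trans
    (Fintype.equivFin p).symm)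
  have io : ∀ i : ℕ, (1 : Matrix (Fin i) (Fin i) R) * 1 = 1 := fun i => by simp
  have ip : (1 : Matrix p p R) * 1 = 1 := by simp
  exact ((Equivalent.fromBlocks_one_sum he σ).trans (fromBlocks_idem he ip)
    (fromBlocks_idem (fromBlocks_idem hf (io k)) (io l)) (h.fromBlocks
    (Equivalent.refl (io l)))).trans (fromBlocks_idem he ip) (fromBlocks_idem hf ip)
    (Equivalent.fromBlocks_one_sum hf σ).symm

variable [Fintype J] [∀ j, Nonempty (d j)]

theorem component_injective {a : UnitalK0 (∀ j, Matrix (d j) (d j) R)}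
    (h : ∀ j, component j a = 0) : a = 0 := by
  obtain ⟨l, l', e, he, rfl⟩ := exists_eq_cls_sub a
  have io : ∀ i : ℕ, (1 : Matrix (Fin i) (Fin i) (∀ j, Matrix (d j) (d j) R)) * 1 = 1 :=
    fun i => by simp
  have h1 : ∀ j, cls (flatten j e) (flatten_idem j he) =
      cls (flatten j (1 : Matrix (Fin l') (Fin l') (∀ j, Matrix (d j) (d j) R)))
      (flatten_idem j (io l')) := fun j => by
    have := h j
    rwa [map_sub, component_cls, component_cls, sub_eq_zero] at this
  choose k hk using fun j => exists_equivalent_of_cls_eq (h1 j)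
  -- The j-th component of 1_N is an identity matrix of size N · |d j|. As d j is nonempty and J is
  -- finite, this N is large enough for all components at once.
  let N := ∑ j, k j
  have hN : ∀ j, k j ≤ Fintype.card (Fin N × d j) := fun j => by
    rw [Fintype.card_prod, Fintype.card_fin]
    exact (Finset.single_le_sum (fun _ _ => Nat.zero_le _) (Finset.mem_univ j)).trans
      (Nat.le_mul_of_pos_right _ Fintype.card_pos)
  have h2 : Equivalent (fromBlocks e 0 0 (1 : Matrix (Fin N) (Fin N) _))
      (fromBlocks (1 : Matrix (Fin l') (Fin l') _) 0 0 (1 : Matrix (Fin N) (Fin N) _)) := by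
    refine Equivalent.of_flatten fun j => ?_
    have h3 := Equivalent.fromBlocks_one_of_le (flatten_idem j he) (flatten_idem j (io l'))
      (hN j) (hk j)
    rw [← flatten_one] at h3
    refine ((flatten_fromBlocks_equivalent j he (io N)).trans
      (flatten_idem j (fromBlocks_idem he (io N)))
      (fromBlocks_idem (flatten_idem j (io l')) (flatten_idem j (io N))) h3).trans
      (flatten_idem j (fromBlocks_idem he (io N)))
      (flatten_idem j (fromBlocks_idem (io l') (io N)))
      (flatten_fromBlocks_equivalent j (io l') (io N)).symm
  have h4 := cls_eq (he := fromBlocks_idem he (io N)) (hf := fromBlocks_idem (io l') (io N)) h2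
  rw [cls_fromBlocks he (io N), cls_fromBlocks (io l') (io N)] at h4
  rw [sub_eq_zero]
  exact add_right_cancel h4

variable [DecidableEq J]

theorem exists_component_eq_single (j : J) (b : UnitalK0 R) :
    ∃ a : UnitalK0 (∀ j, Matrix (d j) (d j) R), ∀ i, component i a = (Pi.single j b : J → UnitalK0 R) i := by
  have key : ∀ {l : ℕ} (e : Matrix (Fin l) (Fin l) R) (he : e * e = e),
      ∃ a : UnitalK0 (∀ j, Matrix (d j) (d j) R),
        ∀ i, component i a = (Pi.single j (cls e he) : J → UnitalK0 R) i := by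
    intro l e he
    obtain ⟨s⟩ := (inferInstance : Nonempty (d j))
    -- Here e is placed in the (s, s) corner of the j-th factor, with 0 in all other factors. The
    -- matrices x and y below show that a corner carries the same class as e.
    let f : Matrix (Fin l) (Fin l) (∀ j, Matrix (d j) (d j) R) :=
      Matrix.of fun a b => Pi.single j (Matrix.single s s (e a b))
    have hf1 : ∀ i, i ≠ j → flatten i f = 0 := fun i hi => by
      ext a b
      simp [flatten, f, Pi.single_eq_of_ne hi]
    have hf2 : flatten j f = Matrix.of fun a b => Matrix.single s s (e a.1 b.1) a.2 b.2 := by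
      ext a b
      simp [flatten, f]
    let x : Matrix (Fin l × d j) (Fin l) R :=
      Matrix.of fun a b => if a.2 = s then e a.1 b else 0
    let y : Matrix (Fin l) (Fin l × d j) R :=
      Matrix.of fun a b => if b.2 = s then e a b.1 else 0
    have hxy : x * y = flatten j f := by
      rw [hf2]
      ext a b
      simp only [x, y, Matrix.mul_apply, Matrix.of_apply, Matrix.single_apply]
      by_cases h1 : a.2 = s <;> by_cases h2 : b.2 = s
      · simp only [h1, h2, if_true, and_self]
        exact congrFun (congrFun he a.1) b.1
      · simp [h1, h2, Ne.symm h2]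
      · simp [h1, Ne.symm h1]
      · simp [h1, Ne.symm h1]
    have hyx : y * x = e := by
      ext a b
      simp only [x, y, Matrix.mul_apply, Matrix.of_apply, Fintype.sum_prod_type]
      simp only [mul_ite, ite_mul, mul_zero, zero_mul]
      simp only [← ite_and, and_self, Finset.sum_ite_eq', Finset.mem_univ, if_true]
      exact congrFun (congrFun he a) b
    have hf : f * f = f := flatten_injective fun i => by
      rw [flatten_mul]
      by_cases hi : i = j
      · subst hi
        rw [← hxy, Matrix.mul_assoc, ← Matrix.mul_assoc y, hyx]
        congr 1
        ext a b
        simp only [y, Matrix.mul_apply, Matrix.of_apply]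
        by_cases h2 : b.2 = s
        · simp only [h2, if_true]
          exact congrFun (congrFun he a) b.1
        · simp [h2]
      · rw [hf1 i hi, Matrix.zero_mul]
    refine ⟨cls f hf, fun i => ?_⟩
    rw [component_cls]
    by_cases hi : i = j
    · subst hi
      rw [Pi.single_eq_same]
      exact cls_eq ⟨x, y, hxy, hyx⟩
    · rw [Pi.single_eq_of_ne hi, ← cls_zero (m := Fin l × d i)]
      simp only [hf1 i hi]
  obtain ⟨k, l, e, he, rfl⟩ := exists_eq_cls_sub b
  obtain ⟨a, ha⟩ := key e he
  obtain ⟨a', ha'⟩ := key (1 : Matrix (Fin l) (Fin l) R) (by simp)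
  refine ⟨a - a', fun i => ?_⟩
  rw [map_sub, ha, ha', Pi.single_sub]
  rfl

theorem exists_component_eq (b : J → UnitalK0 R) :
    ∃ a : UnitalK0 (∀ j, Matrix (d j) (d j) R), ∀ i, component i a = b i := by
  choose a ha using fun j => exists_component_eq_single (d := d) j (b j)
  refine ⟨∑ j, a j, fun i => ?_⟩
  rw [map_sum, Finset.sum_congr rfl fun j _ => ha j i]
  exact congrFun (Finset.univ_sum_single b) i |>.symm ▸ (Finset.sum_apply i _ _).symm

end MatrixProduct

end UnitalK0
end

/-! ### K₀ of products of matrix algebras over non-unital algebras -/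

noncomputable section

theorem UnitalK0.map_map {R S T : Type*} [Ring R] [Ring S] [Ring T] (φ : R →+* S) (ψ : S →+* T)
    (a : UnitalK0 R) : UnitalK0.map ψ (UnitalK0.map φ a) = UnitalK0.map (ψ.comp φ) a := by
  obtain ⟨k, l, e, he, rfl⟩ := UnitalK0.exists_eq_cls_sub a
  simp only [map_sub, UnitalK0.map_cls]
  rfl

namespace K0

section Basic

variable (A : Type*) [NonUnitalRing A] [Module ℂ A] [IsScalarTower ℂ A A] [SMulCommClass ℂ A A]

/-- The augmentation of the unitization. -/
def augmentation : Unitization ℂ A →+* ℂ := (Unitization.fstHom ℂ A : _ →ₐ[ℂ] ℂ).toRingHom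

/-- The inclusion of `K₀(A)` in `K₀` of the unitization. -/
def incl : K0 A →+ UnitalK0 (Unitization ℂ A) :=
  (UnitalK0.map (Unitization.fstHom ℂ A : Unitization ℂ A →ₐ[ℂ] ℂ).toRingHom).ker.subtype

variable {A}

theorem incl_injective : Function.Injective (incl A) := Subtype.val_injective

theorem map_incl (a : K0 A) : UnitalK0.map (augmentation A) (incl A a) = 0 := a.2

theorem exists_incl {a : UnitalK0 (Unitization ℂ A)}
    (ha : UnitalK0.map (augmentation A) a = 0) : ∃ b : K0 A, incl A b = a := ⟨⟨a, ha⟩, rfl⟩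

end Basic

section MatrixProduct

variable {I D : Type*} [NonUnitalRing I] [Module ℂ I] [IsScalarTower ℂ I I] [SMulCommClass ℂ I I]
  [NonUnitalRing D] [Module ℂ D] [IsScalarTower ℂ D D] [SMulCommClass ℂ D D]
  {J : Type*} {d : J → Type*} [∀ j, Fintype (d j)] [∀ j, DecidableEq (d j)]

/-- The extension to unitizations of a homomorphism to a product of matrix algebras. -/
def unitizedHom (θ : I →ₙₐ[ℂ] ∀ j, Matrix (d j) (d j) D) :
    Unitization ℂ I →ₐ[ℂ] ∀ j, Matrix (d j) (d j) (Unitization ℂ D) :=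
  Unitization.lift
    { toFun := fun x j => (θ x j).map Unitization.inr
      map_smul' := fun z x => by
        funext j
        refine Matrix.ext fun s t => ?_
        rw [map_smul]
        exact Unitization.inr_smul ℂ z _
      map_zero' := by
        funext j
        refine Matrix.ext fun s t => ?_
        rw [map_zero]
        exact Unitization.inr_zero ℂ
      map_add' := fun x y => by
        funext j
        refine Matrix.ext fun s t => ?_
        rw [map_add]
        exact Unitization.inr_add ℂ _ _
      map_mul' := fun x y => by
        funext j
        rw [map_mul, Pi.mul_apply, Pi.mul_apply]
        exact Matrix.map_mul (f := Unitization.inrNonUnitalAlgHom ℂ D) }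

theorem unitizedHom_apply (θ : I →ₙₐ[ℂ] ∀ j, Matrix (d j) (d j) D) (x : Unitization ℂ I) (j : J)
    (s t : d j) : unitizedHom θ x j s t =
      algebraMap ℂ (Matrix (d j) (d j) (Unitization ℂ D)) x.fst s t +
        Unitization.inr (θ x.snd j s t) := by
  rfl

theorem unitizedHom_fst (θ : I →ₙₐ[ℂ] ∀ j, Matrix (d j) (d j) D) (x : Unitization ℂ I) (j : J)
    (s t : d j) : (unitizedHom θ x j s t).fst = algebraMap ℂ (Matrix (d j) (d j) ℂ) x.fst s t := by
  rw [unitizedHom_apply, Matrix.algebraMap_matrix_apply, Matrix.algebraMap_matrix_apply]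
  split_ifs <;> simp [Unitization.algebraMap_eq_inl]

theorem unitizedHom_snd (θ : I →ₙₐ[ℂ] ∀ j, Matrix (d j) (d j) D) (x : Unitization ℂ I) (j : J)
    (s t : d j) : (unitizedHom θ x j s t).snd = θ x.snd j s t := by
  rw [unitizedHom_apply, Matrix.algebraMap_matrix_apply]
  split_ifs <;> simp [Unitization.algebraMap_eq_inl]

/-- Entrywise augmentation. -/
def matrixAugmentation (J : Type*) (d : J → Type*) [∀ j, Fintype (d j)] [∀ j, DecidableEq (d j)]
    (D : Type*) [NonUnitalRing D] [Module ℂ D] [IsScalarTower ℂ D D] [SMulCommClass ℂ D D] :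
    (∀ j, Matrix (d j) (d j) (Unitization ℂ D)) →+* ∀ j, Matrix (d j) (d j) ℂ :=
  RingHom.pi fun j => (augmentation D).mapMatrix.comp
    (Pi.evalRingHom (fun j => Matrix (d j) (d j) (Unitization ℂ D)) j)

/-- The entrywise inclusion of scalars. -/
def matrixInclusion (J : Type*) (d : J → Type*) [∀ j, Fintype (d j)] [∀ j, DecidableEq (d j)]
    (D : Type*) [NonUnitalRing D] [Module ℂ D] [IsScalarTower ℂ D D] [SMulCommClass ℂ D D] :
    (∀ j, Matrix (d j) (d j) ℂ) →+* ∀ j, Matrix (d j) (d j) (Unitization ℂ D) :=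
  RingHom.pi fun j => (algebraMap ℂ (Unitization ℂ D)).mapMatrix.comp
    (Pi.evalRingHom (fun j => Matrix (d j) (d j) ℂ) j)

/-- A matrix over the unitization of D has a scalar part and a part with entries in D, and θ
identifies families of the latter with elements of I. So the unitization of I consists of the
families whose scalar part is one and the same scalar in all factors, which is a fibre product. -/
theorem isSplitCartesian_unitizedHom (θ : I →ₙₐ[ℂ] ∀ j, Matrix (d j) (d j) D)
    (hθ : Function.Bijective θ) :
    UnitalK0.IsSplitCartesian (unitizedHom θ : Unitization ℂ I →+* _)
      (algebraMap ℂ (∀ j, Matrix (d j) (d j) ℂ)) (matrixAugmentation J d D) (augmentation I)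
      (matrixInclusion J d D) where
  comm x := by
    funext j; ext s t
    exact unitizedHom_fst θ x j s t
  split x := by
    funext j; ext s t
    rfl
  exists_lift x y hxy := by
    obtain ⟨b, hb⟩ := hθ.2 fun j => Matrix.of fun s t => (x j s t).snd
    refine ⟨Unitization.inl y + Unitization.inr b, ?_, ?_⟩
    · funext j
      refine Matrix.ext fun s t => Unitization.ext ?_ ?_
      · have h := congrFun (congrFun (congrFun hxy j) s) t
        change (x j s t).fst = algebraMap ℂ (Matrix (d j) (d j) ℂ) y s t at h
        rw [h]
        exact (unitizedHom_fst θ _ j s t).trans (by simp)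
      · refine (unitizedHom_snd θ _ j s t).trans ?_
        simp [hb]
    · simp [augmentation]
  eq_of x y h1 h2 := by
    have h2' : x.fst = y.fst := h2
    refine Unitization.ext h2' (hθ.1 ?_)
    funext j; ext s t
    have h := congrArg (fun z : Unitization ℂ D => z.snd) (congrFun (congrFun (congrFun h1 j) s) t)
    exact ((unitizedHom_snd θ x j s t).symm.trans h).trans (unitizedHom_snd θ y j s t)

variable (θ : I →ₙₐ[ℂ] ∀ j, Matrix (d j) (d j) D) (hθ : Function.Bijective θ)
  [Fintype J] [∀ j, Nonempty (d j)]

theorem map_augmentation_component (j : J)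
    (a : UnitalK0 (∀ j, Matrix (d j) (d j) (Unitization ℂ D))) :
    UnitalK0.component j (UnitalK0.map (matrixAugmentation J d D) a) =
      UnitalK0.map (augmentation D) (UnitalK0.component j a) :=
  UnitalK0.component_map _ j a

include hθ in
/-- `K₀` of a finite product of matrix algebras over a possibly non-unital algebra. -/
theorem nonempty_addEquiv_pi : Nonempty (K0 I ≃+ (J → K0 D)) := by
  classical
  have hsq := isSplitCartesian_unitizedHom θ hθ
  have hker : ∀ a : UnitalK0 (Unitization ℂ I), UnitalK0.map (augmentation I) a = 0 →
      UnitalK0.map (matrixAugmentation J d D)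
        (UnitalK0.map (unitizedHom θ : Unitization ℂ I →+* _) a) = 0 := fun a ha => by
    rw [UnitalK0.map_map, show (matrixAugmentation J d D).comp (unitizedHom θ : _ →+* _) =
      (algebraMap ℂ (∀ j, Matrix (d j) (d j) ℂ)).comp (augmentation I) from
      RingHom.ext hsq.comm, ← UnitalK0.map_map, ha, map_zero]
  let G : J → K0 I →+ UnitalK0 (Unitization ℂ D) := fun j =>
    (UnitalK0.component (d := d) j).comp ((UnitalK0.map
      (unitizedHom θ : Unitization ℂ I →+* ∀ j, Matrix (d j) (d j) (Unitization ℂ D))).comp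
      (incl I))
  have hG : ∀ j a, UnitalK0.map (augmentation D) (G j a) = 0 := fun j a => by
    have h := congrArg (UnitalK0.component j) (hker _ (map_incl a))
    rwa [map_augmentation_component, map_zero] at h
  let F : K0 I →+ (J → K0 D) := AddMonoidHom.pi fun j => (G j).codRestrict
    (UnitalK0.map (Unitization.fstHom ℂ D : Unitization ℂ D →ₐ[ℂ] ℂ).toRingHom).ker (hG j)
  have hF : ∀ a j, incl D (F a j) = G j a := fun _ _ => rfl
  refine ⟨AddEquiv.ofBijective F ⟨?_, fun b => ?_⟩⟩
  -- A class with vanishing components vanishes in K₀ of the product of matrix rings, and then in K₀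
  -- of the unitization of I by excision.
  · rw [injective_iff_map_eq_zero]
    intro a ha
    refine incl_injective ?_
    rw [map_zero]
    refine hsq.eq_zero (map_incl a) (UnitalK0.component_injective (d := d) fun j => ?_)
    change G j a = 0
    rw [← hF, ha]
    exact map_zero _
  -- The class a assembled from the b j has zero augmentation, as can be seen in each component;
  -- excision lifts it.
  · obtain ⟨a, ha⟩ := UnitalK0.exists_component_eq (d := d) fun j => incl D (b j)
    obtain ⟨a', h1, h2⟩ := hsq.exists_map_eq (b := a)
      (UnitalK0.component_injective (d := d) fun j => by
        rw [map_augmentation_component, ha, map_incl])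
    obtain ⟨c, rfl⟩ := exists_incl h1
    refine ⟨c, funext fun j => incl_injective ?_⟩
    rw [hF]
    change UnitalK0.component j (UnitalK0.map _ (incl I c)) = _
    rw [h2, ha]

end MatrixProduct

end K0
end

noncomputable section

/-! ### The Grothendieck group of representations of a product of matrix algebras -/

namespace RepGroup

open Matrix

section Basic

variable {B : Type*} [Ring B] [Algebra ℂ B]

variable {n n₁ n₂ n₃ : ℕ} (ρ : B →ₐ[ℂ] Module.End ℂ (Fin n → ℂ))
  {ρ₁ : B →ₐ[ℂ] Module.End ℂ (Fin n₁ → ℂ)} {ρ₂ : B →ₐ[ℂ] Module.End ℂ (Fin n₂ → ℂ)}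
  {ρ₃ : B →ₐ[ℂ] Module.End ℂ (Fin n₃ → ℂ)}

/-- The class of a representation. -/
def cls : RepGroup B :=
  QuotientAddGroup.mk' (repRelations B) (FreeAbelianGroup.of ⟨n, ρ⟩)

variable (ρ₁ ρ₂ ρ₃) in
/-- Short exact sequences of representations. -/
def ShortExact : Prop :=
  ∃ (i : (Fin n₁ → ℂ) →ₗ[ℂ] (Fin n₂ → ℂ)) (p : (Fin n₂ → ℂ) →ₗ[ℂ] (Fin n₃ → ℂ)),
    (∀ b v, i (ρ₁ b v) = ρ₂ b (i v)) ∧ (∀ b v, p (ρ₂ b v) = ρ₃ b (p v)) ∧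
    Function.Injective i ∧ Function.Surjective p ∧ LinearMap.range i = LinearMap.ker p

theorem cls_shortExact (h : ShortExact ρ₁ ρ₂ ρ₃) : cls ρ₂ = cls ρ₁ + cls ρ₃ :=
  (QuotientAddGroup.eq_iff_sub_mem (N := repRelations B)).mpr
    (AddSubgroup.subset_closure ⟨⟨n₁, ρ₁⟩, ⟨n₂, ρ₂⟩, ⟨n₃, ρ₃⟩, h, rfl⟩)

theorem mem_of_cls_mem {H : AddSubgroup (RepGroup B)}
    (h : ∀ (n : ℕ) (ρ : B →ₐ[ℂ] Module.End ℂ (Fin n → ℂ)), cls ρ ∈ H) (a : RepGroup B) :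
    a ∈ H := by
  obtain ⟨x, rfl⟩ := QuotientAddGroup.mk'_surjective (repRelations B) a
  induction x using FreeAbelianGroup.induction_on with
  | zero => exact zero_mem _
  | of ρ => exact h ρ.1 ρ.2
  | neg ρ h => exact neg_mem h
  | add x y hx hy => exact add_mem hx hy

/-- The zero representation is an extension of itself by itself. -/
theorem cls_eq_zero (ρ : B →ₐ[ℂ] Module.End ℂ (Fin 0 → ℂ)) : cls ρ = 0 := by
  have := cls_shortExact (ρ₁ := ρ) (ρ₂ := ρ) (ρ₃ := ρ) ⟨0, 0, fun b v => Subsingleton.elim _ _,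
    fun b v => Subsingleton.elim _ _, fun v w _ => Subsingleton.elim _ _,
    fun v => ⟨0, Subsingleton.elim _ _⟩, Subsingleton.elim _ _⟩
  simpa using this

/-- The dimension of the image of an element in a representation. -/
def dimRange (u : B) : ℕ := Module.finrank ℂ (LinearMap.range (ρ u))

/-- Passing to the image of an idempotent is exact: the image of ρ₂(u) maps onto that of ρ₃(u), and
the kernel of this map is the image of ρ₁(u), because u acts as the identity on its own image. -/
theorem dimRange_add (h : ShortExact ρ₁ ρ₂ ρ₃) {u : B}
    (hu : u * u = u) : dimRange ρ₂ u = dimRange ρ₁ u + dimRange ρ₃ u := by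
  obtain ⟨i, p, hi, hp, hinj, hsurj, hex⟩ := h
  have idem : ∀ {n : ℕ} (ρ : B →ₐ[ℂ] Module.End ℂ (Fin n → ℂ)) v, ρ u (ρ u v) = ρ u v := fun ρ v => by
    rw [← Module.End.mul_apply, ← map_mul, hu]
  let W := LinearMap.range (ρ₂ u)
  have hrn := LinearMap.finrank_range_add_finrank_ker (p.domRestrict W)
  have h1 : LinearMap.range (p.domRestrict W) = LinearMap.range (ρ₃ u) := by
    ext x
    constructor
    · rintro ⟨⟨_, v, rfl⟩, rfl⟩
      exact ⟨p v, (hp u v).symm⟩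
    · rintro ⟨y, rfl⟩
      obtain ⟨v, rfl⟩ := hsurj y
      exact ⟨⟨ρ₂ u v, v, rfl⟩, hp u v⟩
  have h2 : (LinearMap.ker (p.domRestrict W)).map W.subtype =
      (LinearMap.range (ρ₁ u)).map i := by
    ext x
    constructor
    · rintro ⟨⟨_, v, rfl⟩, hx, rfl⟩
      have hx' : ρ₂ u v ∈ LinearMap.range i := hex ▸ hx
      obtain ⟨w, hw⟩ := hx'
      refine ⟨ρ₁ u w, ⟨w, rfl⟩, ?_⟩
      rw [hi, hw, idem]
      rfl
    · rintro ⟨_, ⟨w, rfl⟩, rfl⟩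
      refine ⟨⟨i (ρ₁ u w), i w, (hi u w).symm⟩, ?_, rfl⟩
      have : i (ρ₁ u w) ∈ LinearMap.ker p := hex ▸ ⟨_, rfl⟩
      exact this
  have h3 : Module.finrank ℂ (LinearMap.ker (p.domRestrict W)) = dimRange ρ₁ u := by
    rw [(Submodule.equivMapOfInjective _ W.injective_subtype _).finrank_eq, h2]
    exact (Submodule.equivMapOfInjective i hinj _).finrank_eq.symm
  rw [h1, h3] at hrn
  rw [add_comm]
  exact hrn.symm

/-- The dimension of the image of an idempotent, as a homomorphism on the Grothendieck group. -/
def dimHom (u : B) (hu : u * u = u) : RepGroup B →+ ℤ :=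
  QuotientAddGroup.lift (repRelations B) (FreeAbelianGroup.lift fun ρ => (dimRange ρ.2 u : ℤ)) (by
    rw [repRelations, AddSubgroup.closure_le]
    rintro x ⟨ρ₁, ρ₂, ρ₃, h, rfl⟩
    simp [dimRange_add (ρ₁ := ρ₁.2) (ρ₂ := ρ₂.2) (ρ₃ := ρ₃.2) h hu])

theorem dimHom_cls (u : B) (hu : u * u = u) :
    dimHom u hu (cls ρ) = dimRange ρ u := FreeAbelianGroup.lift_apply_of _ _

/-- An injective intertwiner has a cokernel. -/
theorem exists_shortExact (i : (Fin n₁ → ℂ) →ₗ[ℂ] (Fin n₂ → ℂ))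
    (hi : ∀ b v, i (ρ₁ b v) = ρ₂ b (i v)) (hinj : Function.Injective i) :
    ∃ (n₃ : ℕ) (ρ₃ : B →ₐ[ℂ] Module.End ℂ (Fin n₃ → ℂ)), ShortExact ρ₁ ρ₂ ρ₃ ∧ n₁ + n₃ = n₂ := by
  let Q := (Fin n₂ → ℂ) ⧸ LinearMap.range i
  let φ : Q ≃ₗ[ℂ] (Fin (Module.finrank ℂ Q) → ℂ) := (Module.finBasis ℂ Q).equivFun
  let p : (Fin n₂ → ℂ) →ₗ[ℂ] (Fin (Module.finrank ℂ Q) → ℂ) :=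
    φ.toLinearMap ∘ₗ (LinearMap.range i).mkQ
  have hp : Function.Surjective p := φ.surjective.comp (Submodule.mkQ_surjective _)
  have hker : LinearMap.ker p = LinearMap.range i := by
    rw [LinearEquiv.ker_comp, Submodule.ker_mkQ]
  have hinv : ∀ b v, p v = 0 → p (ρ₂ b v) = 0 := fun b v hv => by
    have hv' : v ∈ LinearMap.range i := hker ▸ hv
    obtain ⟨w, rfl⟩ := hv'
    rw [← hi]
    have : i (ρ₁ b w) ∈ LinearMap.ker p := by rw [hker]; exact ⟨_, rfl⟩
    exact this
  -- The quotient action is written through a linear section s of p. The section need not commute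
  -- with B, but p ∘ ρ₂(b) does not depend on the chosen preimage, since the kernel of p is
  -- invariant.
  obtain ⟨s, hs⟩ := p.exists_rightInverse_of_surjective (LinearMap.range_eq_top.mpr hp)
  have hs' : ∀ x, p (s x) = x := fun x => LinearMap.congr_fun hs x
  have hσ : ∀ b v, p (ρ₂ b (s (p v))) = p (ρ₂ b v) := fun b v => by
    rw [← sub_eq_zero, ← map_sub, ← map_sub]
    exact hinv b _ (by rw [map_sub, hs', sub_self])
  let ρ : B →ₐ[ℂ] Module.End ℂ (Fin (Module.finrank ℂ Q) → ℂ) :=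
    AlgHom.ofLinearMap
      { toFun := fun b => p ∘ₗ ρ₂ b ∘ₗ s
        map_add' := fun b b' => by rw [map_add]; exact LinearMap.ext fun x => by simp
        map_smul' := fun z b => by rw [map_smul]; exact LinearMap.ext fun x => by simp }
      (LinearMap.ext fun x => by simp [hs'])
      (fun b b' => LinearMap.ext fun x => by simp [hσ])
  refine ⟨_, ρ, ⟨i, p, hi, fun b v => (hσ b v).symm, hinj, hp, hker.symm⟩, ?_⟩
  have := (LinearMap.range i).finrank_quotient_add_finrank
  rw [LinearMap.finrank_range_of_inj hinj, Module.finrank_fin_fun, Module.finrank_fin_fun] at this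
  exact (add_comm _ _).trans this

end Basic

section MatrixProduct

variable {B : Type*} [Ring B] [Algebra ℂ B] {J : Type*} [Fintype J] [DecidableEq J] {d : J → ℕ}
  [∀ j, NeZero (d j)] (e : B ≃ₐ[ℂ] ∀ j, Matrix (Fin (d j)) (Fin (d j)) ℂ)

/-- The element of `B` with a single matrix component. -/
def component (j : J) (M : Matrix (Fin (d j)) (Fin (d j)) ℂ) : B := e.symm (Pi.single j M)

theorem mul_component (b : B) (j : J) (M : Matrix (Fin (d j)) (Fin (d j)) ℂ) :
    b * component e j M = component e j (e b j * M) := by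
  apply e.injective
  rw [map_mul, component, component, AlgEquiv.apply_symm_apply, AlgEquiv.apply_symm_apply]
  funext i
  by_cases h : i = j
  · subst h; simp
  · simp [Pi.single_eq_of_ne h]

theorem apply_component (j : J) (M : Matrix (Fin (d j)) (Fin (d j)) ℂ) :
    e (component e j M) = Pi.single j M := e.apply_symm_apply _

theorem component_mul (j : J) (M N : Matrix (Fin (d j)) (Fin (d j)) ℂ) :
    component e j M * component e j N = component e j (M * N) := by
  rw [mul_component, apply_component, Pi.single_eq_same]

/-- A minimal idempotent in the `j`-th matrix factor. -/
def minIdem (j : J) : B := component e j (Matrix.single 0 0 1)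

theorem minIdem_mul_self (j : J) : minIdem e j * minIdem e j = minIdem e j := by
  rw [minIdem, component_mul, Matrix.single_mul_single_same, one_mul]

/-- The irreducible representation on the column vectors of the `j`-th matrix factor. -/
def simple (j : J) : B →ₐ[ℂ] Module.End ℂ (Fin (d j) → ℂ) :=
  (Matrix.toLinAlgEquiv' : Matrix (Fin (d j)) (Fin (d j)) ℂ ≃ₐ[ℂ] _).toAlgHom.comp
    ((Pi.evalAlgHom ℂ (fun j => Matrix (Fin (d j)) (Fin (d j)) ℂ) j).comp e.toAlgHom)

theorem simple_apply (j : J) (b : B) (v : Fin (d j) → ℂ) : simple e j b v = e b j *ᵥ v := rfl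

theorem dimRange_simple (i j : J) : dimRange (simple e j) (minIdem e i) = if i = j then 1 else 0 := by
  have hv : ∀ v, simple e j (minIdem e i) v = (Pi.single i (Matrix.single 0 0 1) :
      ∀ i, Matrix (Fin (d i)) (Fin (d i)) ℂ) j *ᵥ v := fun v => by
    rw [simple_apply, minIdem, apply_component]
  by_cases h : i = j
  · subst h
    rw [if_pos rfl]
    have h1 : LinearMap.range (simple e i (minIdem e i)) =
        Submodule.span ℂ {(Pi.single 0 1 : Fin (d i) → ℂ)} := by
      ext x
      rw [Submodule.mem_span_singleton]
      constructor
      · rintro ⟨v, rfl⟩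
        refine ⟨v 0, ?_⟩
        rw [hv, Pi.single_eq_same, Matrix.single_mulVec]
        ext k
        simp [Pi.single_apply, Function.update_apply]
      · rintro ⟨z, rfl⟩
        refine ⟨Pi.single 0 z, ?_⟩
        rw [hv, Pi.single_eq_same, Matrix.single_mulVec]
        ext k
        simp [Pi.single_apply, Function.update_apply]
    rw [dimRange, h1]
    exact finrank_span_singleton (by simp)
  · rw [if_neg h]
    have h1 : simple e j (minIdem e i) = 0 := LinearMap.ext fun v => by
      rw [hv, Pi.single_eq_of_ne (Ne.symm h), Matrix.zero_mulVec]
      rfl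
    rw [dimRange, h1, LinearMap.range_zero]
    exact finrank_bot ℂ _

variable {n : ℕ} (ρ : B →ₐ[ℂ] Module.End ℂ (Fin n → ℂ))

/-- The unit is the sum of the products E_{s0} E_{00} E_{0s} over all factors. If every minimal
idempotent acted by zero, then so would 1. -/
theorem exists_minIdem_ne_zero (h : n ≠ 0) : ∃ j, ρ (minIdem e j) ≠ 0 := by
  by_contra! hcon
  have h1 : (1 : B) = ∑ j, ∑ s, component e j (Matrix.single s 0 1) *
      (minIdem e j * component e j (Matrix.single 0 s 1)) := by
    apply e.injective
    rw [map_one, map_sum]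
    simp only [map_sum, minIdem, component_mul, Matrix.single_mul_single_same, mul_one,
      apply_component]
    have h2 : ∀ j, ∑ s : Fin (d j), (Pi.single j (Matrix.single s s 1) :
        ∀ j, Matrix (Fin (d j)) (Fin (d j)) ℂ) = Pi.single j 1 := fun j => by
      rw [← Matrix.sum_single_one]
      exact (map_sum (AddMonoidHom.single (fun j => Matrix (Fin (d j)) (Fin (d j)) ℂ) j) _ _).symm
    rw [Finset.sum_congr rfl fun j _ => h2 j]
    exact (Finset.univ_sum_single (1 : ∀ j, Matrix (Fin (d j)) (Fin (d j)) ℂ)).symm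
  have h2 : ρ 1 = 0 := by
    rw [h1, map_sum]
    refine Finset.sum_eq_zero fun j _ => ?_
    rw [map_sum]
    exact Finset.sum_eq_zero fun s _ => by rw [map_mul, map_mul, hcon, zero_mul, mul_zero]
  rw [map_one] at h2
  have h3 := congrFun (LinearMap.congr_fun h2 (Pi.single ⟨0, Nat.pos_of_ne_zero h⟩ 1))
    ⟨0, Nat.pos_of_ne_zero h⟩
  simp at h3

/-- A nonzero vector w fixed by the minimal idempotent generates a copy of the column module, via x
↦ ρ(x e₀ᵀ) w. Injectivity holds because E_{0s} sends the image of x to x_s w. -/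
theorem exists_simple_embedding (j : J) (hj : ρ (minIdem e j) ≠ 0) :
    ∃ i : (Fin (d j) → ℂ) →ₗ[ℂ] (Fin n → ℂ),
      (∀ b v, i (simple e j b v) = ρ b (i v)) ∧ Function.Injective i := by
  obtain ⟨v, hv⟩ : ∃ v, ρ (minIdem e j) v ≠ 0 := by
    by_contra! h
    exact hj (LinearMap.ext h)
  let w := ρ (minIdem e j) v
  have hw : ρ (minIdem e j) w = w := by
    rw [← Module.End.mul_apply, ← map_mul, minIdem_mul_self]
  let c : (Fin (d j) → ℂ) →ₗ[ℂ] B :=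
    { toFun := fun x => component e j (Matrix.vecMulVec x (Pi.single 0 1))
      map_add' := fun x y => by
        rw [Matrix.add_vecMulVec, component, component, component, Pi.single_add, map_add]
      map_smul' := fun z x => by
        rw [Matrix.smul_vecMulVec, component, component, Pi.single_smul, map_smul]
        rfl }
  have hc : ∀ b x, b * c x = c (e b j *ᵥ x) := fun b x => by
    change b * component e j _ = component e j _
    rw [mul_component, Matrix.mul_vecMulVec]
  let i : (Fin (d j) → ℂ) →ₗ[ℂ] (Fin n → ℂ) :=
    { toFun := fun x => ρ (c x) w
      map_add' := fun x y => by rw [map_add, map_add, LinearMap.add_apply]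
      map_smul' := fun z x => by rw [map_smul, map_smul, LinearMap.smul_apply]; rfl }
  have hi : ∀ b x, i (e b j *ᵥ x) = ρ b (i x) := fun b x => by
    change ρ (c _) w = ρ b (ρ (c x) w)
    rw [← hc, map_mul, Module.End.mul_apply]
  refine ⟨i, hi, ?_⟩
  rw [injective_iff_map_eq_zero]
  intro x hx
  ext s
  have h1 := hi (component e j (Matrix.single 0 s 1)) x
  rw [hx, map_zero, apply_component, Pi.single_eq_same] at h1
  have h2 : c (Matrix.single 0 s 1 *ᵥ x) = x s • minIdem e j := by
    rw [minIdem, component, ← map_smul, ← Pi.single_smul]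
    change component e j _ = _
    rw [component]
    congr 2
    ext a b
    rw [Matrix.single_mulVec]
    simp [Matrix.vecMulVec_apply, Matrix.single_apply, Pi.single_apply, Function.update_apply,
      ← ite_and, eq_comm, and_comm]
  have h3 : x s • w = 0 := by
    rw [← hw, ← LinearMap.smul_apply, ← map_smul, ← h2]
    exact h1
  exact (smul_eq_zero.mp h3).resolve_right hv

/-- Induction on the dimension: a nonzero representation contains a simple one, and the quotient is
smaller. The relations from short exact sequences make complete reducibility unnecessary. -/
theorem cls_mem_closure :
    cls ρ ∈ AddSubgroup.closure (Set.range fun j => cls (simple e j)) := by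
  induction n using Nat.strong_induction_on with
  | _ n ih =>
    rcases Nat.eq_zero_or_pos n with rfl | h0
    · rw [cls_eq_zero ρ]
      exact zero_mem _
    · obtain ⟨j, hj⟩ := exists_minIdem_ne_zero e ρ h0.ne'
      obtain ⟨i, hi, hinj⟩ := exists_simple_embedding e ρ j hj
      obtain ⟨n₃, ρ₃, hex, hdim⟩ := exists_shortExact i hi hinj
      rw [cls_shortExact hex]
      have hpos : 0 < d j := Nat.pos_of_ne_zero (NeZero.ne (d j))
      exact add_mem (AddSubgroup.subset_closure ⟨j, rfl⟩) (ih n₃ (by omega) ρ₃)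

include e in
/-- The Grothendieck group of representations of a finite product of matrix algebras. -/
theorem nonempty_addEquiv_pi : Nonempty (RepGroup B ≃+ (J → ℤ)) := by
  -- The dimensions of the images of the minimal idempotents are coordinates dual to the simple
  -- modules, which proves that the simple classes are independent.
  let D : RepGroup B →+ (J → ℤ) := AddMonoidHom.pi fun j => dimHom (minIdem e j)
    (minIdem_mul_self e j)
  have hD : ∀ j, D (cls (simple e j)) = Pi.single j 1 := fun j => by
    funext i
    change dimHom (minIdem e i) (minIdem_mul_self e i) (cls (simple e j)) = _
    rw [dimHom_cls, dimRange_simple, Pi.single_apply]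
    simp
  let Z : (J → ℤ) →+ RepGroup B :=
    { toFun := fun f => ∑ j, f j • cls (simple e j)
      map_zero' := by simp
      map_add' := fun f g => by simp [add_smul, Finset.sum_add_distrib] }
  have hDZ : ∀ f, D (Z f) = f := fun f => by
    change D (∑ j, f j • cls (simple e j)) = f
    rw [map_sum]
    simp only [map_zsmul, hD]
    funext i
    simp [Finset.sum_apply, Pi.single_apply]
  have hZ : Function.Surjective Z := by
    intro a
    refine mem_of_cls_mem (B := B) (H := Z.range) (fun n ρ => ?_) a
    refine (AddSubgroup.closure_le _).mpr ?_ (cls_mem_closure e ρ)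
    rintro _ ⟨j, rfl⟩
    refine ⟨Pi.single j 1, ?_⟩
    change ∑ i, (Pi.single j 1 : J → ℤ) i • cls (simple e i) = _
    simp [Pi.single_apply]
  exact ⟨(AddEquiv.ofBijective Z ⟨Function.LeftInverse.injective hDZ, hZ⟩).symm⟩

end MatrixProduct

end RepGroup
end

noncomputable section

/-! ### Finite dimensional C⋆-algebras -/

/-- A finite dimensional C⋆-algebra is semisimple. -/
theorem CStarAlgebra.isSemisimpleRing (N : Type*) [CStarAlgebra N] [FiniteDimensional ℂ N] :
    IsSemisimpleRing N := by
  have hA : IsArtinianRing N := IsArtinianRing.of_finite ℂ N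
  rw [IsArtinianRing.isSemisimpleRing_iff_jacobson, eq_bot_iff]
  intro x hx
  obtain ⟨n, hn⟩ := IsSemiprimaryRing.isNilpotent (R := N)
  have hy : star x * x ∈ Ring.jacobson N := Ideal.mul_mem_left _ _ hx
  have h1 : (star x * x) ^ n = 0 := by
    have := Ideal.pow_mem_pow hy n
    rw [hn] at this
    exact this
  -- The exponent is raised to a power of 2, for which the C⋆-identity gives ‖y^(2ⁿ)‖ = ‖y‖^(2ⁿ)
  -- when y is self-adjoint. Hence the nilpotent element star x * x is zero.
  have h2 : (star x * x) ^ 2 ^ n = 0 := by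
    rw [← Nat.sub_add_cancel n.lt_two_pow_self.le, pow_add, h1, mul_zero]
  have h3 := (IsSelfAdjoint.star_mul_self x).nnnorm_pow_two_pow n
  rw [h2, nnnorm_zero] at h3
  have h4 : star x * x = 0 := by
    rw [← nnnorm_eq_zero]
    exact eq_zero_of_pow_eq_zero h3.symm
  exact CStarRing.star_mul_self_eq_zero_iff x |>.mp h4

instance TwistedCrossedProduct.finiteDimensional {Γ : Type*} [Group Γ] [Finite Γ]
    (c : TwoCocycle Γ) : FiniteDimensional ℂ (TwistedGroupAlgebra Γ c) :=
  Module.Finite.of_injective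
    ({ toFun := TwistedCrossedProduct.coeff
       map_add' := fun _ _ => rfl
       map_smul' := fun _ _ => rfl } : TwistedGroupAlgebra Γ c →ₗ[ℂ] (Γ → ℂ))
    fun _ _ h => TwistedCrossedProduct.ext fun w => congrFun h w

/-! ### Suspensions of matrix algebras -/

namespace Suspension

variable {A D : Type*} [NonUnitalCStarAlgebra A] [NonUnitalCStarAlgebra D]

/-- Evaluation at a point of the circle. -/
def eval (A : Type*) [NonUnitalCStarAlgebra A] (z : Circle) : Suspension A →+ A where
  toFun f := f.1 z
  map_zero' := rfl
  map_add' _ _ := rfl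

theorem ext {f g : Suspension A} (h : ∀ z, eval A z f = eval A z g) : f = g :=
  Subtype.ext (ContinuousMap.ext h)

theorem eval_mul (z : Circle) (f g : Suspension A) :
    eval A z (f * g) = eval A z f * eval A z g := rfl

theorem eval_smul (z : Circle) (w : ℂ) (f : Suspension A) :
    eval A z (w • f) = w • eval A z f := rfl

variable {J : Type*} {d : J → Type*} [∀ j, Fintype (d j)]

/-- Suspension commutes with finite products of matrix algebras. -/
theorem exists_bijective_hom (θ : A →ₙₐ[ℂ] ∀ j, Matrix (d j) (d j) D) (hθ : IsHomeomorph θ) :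
    ∃ θ' : Suspension A →ₙₐ[ℂ] ∀ j, Matrix (d j) (d j) (Suspension D), Function.Bijective θ' := by
  have hc : ∀ j s t, Continuous fun a => θ a j s t := fun j s t =>
    ((continuous_apply j).comp hθ.continuous).matrix_elem s t
  let F : Suspension A → ∀ j, Matrix (d j) (d j) (Suspension D) := fun f j => Matrix.of fun s t =>
    ⟨⟨fun z => θ (f.1 z) j s t, (hc j s t).comp f.1.continuous⟩, by
      change θ (f.1 1) j s t = 0
      rw [show f.1 1 = 0 from f.2, map_zero]
      rfl⟩
  have hF : ∀ f j s t z, eval D z (F f j s t) = θ (eval A z f) j s t := fun _ _ _ _ _ => rfl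
  refine ⟨{ toFun := F, map_smul' := ?_, map_zero' := ?_, map_add' := ?_, map_mul' := ?_ },
    fun f g h => ?_, fun G => ?_⟩
  · intro z f
    funext j
    refine Matrix.ext fun s t => ext fun w => ?_
    rw [hF, eval_smul, map_smul]
    rfl
  · funext j
    refine Matrix.ext fun s t => ext fun w => ?_
    rw [hF, map_zero, map_zero]
    exact (map_zero (eval D w)).symm
  · intro f g
    funext j
    refine Matrix.ext fun s t => ext fun w => ?_
    rw [hF, map_add, map_add]
    exact (map_add (eval D w) (F f j s t) (F g j s t)).symm
  · intro f g
    funext j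
    refine Matrix.ext fun s t => ext fun w => ?_
    rw [hF, eval_mul, map_mul, Pi.mul_apply, Pi.mul_apply, Matrix.mul_apply, Matrix.mul_apply,
      map_sum]
    rfl
  · refine ext fun z => hθ.injective ?_
    funext j
    refine Matrix.ext fun s t => ?_
    rw [← hF, ← hF]
    exact congrArg (eval D z) (congrFun (congrFun (congrFun h j) s) t)
  · let φ := hθ.homeomorph
    have hφ : ∀ x, θ (φ.symm x) = x := fun x => φ.apply_symm_apply x
    refine ⟨⟨⟨fun z => φ.symm fun j => Matrix.of fun s t => (G j s t).1 z,
      φ.symm.continuous.comp (continuous_pi fun j => continuous_matrix fun s t =>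
        (G j s t).1.continuous)⟩, ?_⟩, ?_⟩
    · refine hθ.injective ?_
      change θ (φ.symm _) = θ 0
      rw [hφ, map_zero]
      funext j
      refine Matrix.ext fun s t => ?_
      exact (G j s t).2
    · funext j
      refine Matrix.ext fun s t => ext fun z => ?_
      change θ (φ.symm _) j s t = _
      rw [hφ]
      rfl

end Suspension

/-! ### Matrices over algebras of functions with values in a product of matrix algebras -/

namespace RelC0

variable {T : Type*} [TopologicalSpace T] [CompactSpace T] {Z : Set T}
  {N : Type*} [NonUnitalCStarAlgebra N]

/-- Evaluation at a point. -/
def eval (Z : Set T) (N : Type*) [NonUnitalCStarAlgebra N] (z : T) : RelC0 Z N →+ N where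
  toFun f := f.1 z
  map_zero' := rfl
  map_add' _ _ := rfl

theorem ext {f g : RelC0 Z N} (h : ∀ z, eval Z N z f = eval Z N z g) : f = g :=
  Subtype.ext (ContinuousMap.ext h)

theorem eval_mul (z : T) (f g : RelC0 Z N) :
    eval Z N z (f * g) = eval Z N z f * eval Z N z g := rfl

theorem eval_smul (z : T) (w : ℂ) (f : RelC0 Z N) :
    eval Z N z (w • f) = w • eval Z N z f := rfl

theorem eval_star (z : T) (f : RelC0 Z N) : eval Z N z (star f) = star (eval Z N z f) := rfl

end RelC0

section AutomaticContinuity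

attribute [local instance] CStarAlgebra.spectralOrder CStarAlgebra.spectralOrderedRing

/-- A ⋆-isomorphism of C⋆-algebras is isometric. Continuity in both directions is what allows such
an isomorphism to be applied to suspensions. -/
theorem CStarMatrix.isHomeomorph_starAlgEquiv {A P ι : Type*} [Fintype ι] [NonUnitalCStarAlgebra A]
    [NonUnitalCStarAlgebra P] (Ψ : A ≃⋆ₐ[ℂ] CStarMatrix ι ι P) : IsHomeomorph Ψ :=
  (Homeomorph.mk Ψ.toEquiv (StarAlgEquiv.isometry Ψ).continuous
    (StarAlgEquiv.isometry Ψ.symm).continuous).isHomeomorph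

end AutomaticContinuity

section MatrixFunctions

variable {T : Type*} [TopologicalSpace T] [CompactSpace T] (Z : Set T)
  {N : Type*} [CStarAlgebra N] [FiniteDimensional ℂ N] (ι : Type*) [Fintype ι]
  {J : Type*} [Fintype J] {d : J → Type*} [∀ j, Fintype (d j)] [∀ j, DecidableEq (d j)]

/-- If `N ≅ ∏ⱼ M_{d j}(ℂ)`, then `M_ι(C₀(T, Z; N)) ≅ ∏ⱼ M_{ι × d j}(C₀(T, Z))`. -/
theorem exists_isHomeomorph_matrix (e : N ≃ₐ[ℂ] ∀ j, Matrix (d j) (d j) ℂ) :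
    ∃ θ : CStarMatrix ι ι (RelC0 Z N) →ₙₐ[ℂ] ∀ j, Matrix (ι × d j) (ι × d j) (RelC0 Z ℂ),
      IsHomeomorph θ := by
  have he : Continuous e := e.toLinearMap.continuous_of_finiteDimensional
  have he' : Continuous e.symm := e.symm.toLinearMap.continuous_of_finiteDimensional
  have hc : ∀ j s t, Continuous fun a => e a j s t := fun j s t =>
    ((continuous_apply j).comp he).matrix_elem s t
  let F : CStarMatrix ι ι (RelC0 Z N) → ∀ j, Matrix (ι × d j) (ι × d j) (RelC0 Z ℂ) :=
    fun M j => Matrix.of fun s t =>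
      ⟨⟨fun z => e ((M s.1 t.1).1 z) j s.2 t.2, (hc j s.2 t.2).comp (M s.1 t.1).1.continuous⟩,
      fun z hz => by
        change e ((M s.1 t.1).1 z) j s.2 t.2 = 0
        rw [(M s.1 t.1).2 z hz, map_zero]
        rfl⟩
  let G : (∀ j, Matrix (ι × d j) (ι × d j) (RelC0 Z ℂ)) → CStarMatrix ι ι (RelC0 Z N) :=
    fun M => CStarMatrix.ofMatrix <| Matrix.of fun a b =>
      ⟨⟨fun z => e.symm fun j => Matrix.of fun s t => (M j (a, s) (b, t)).1 z,
        he'.comp (continuous_pi fun j => continuous_matrix fun s t =>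
          (M j (a, s) (b, t)).1.continuous)⟩,
      fun z hz => by
        change e.symm (fun j => Matrix.of fun s t => (M j (a, s) (b, t)).1 z) = 0
        rw [← map_zero e.symm]
        congr 1
        funext j
        exact Matrix.ext fun s t => (M j (a, s) (b, t)).2 z hz⟩
  have hF : ∀ M j s t z, RelC0.eval Z ℂ z (F M j s t) =
    e (RelC0.eval Z N z (M s.1 t.1)) j s.2 t.2 := fun _ _ _ _ _ => rfl
  have hG : ∀ M a b z, RelC0.eval Z N z (G M a b) =
    e.symm fun j => Matrix.of fun s t => RelC0.eval Z ℂ z (M j (a, s) (b, t)) :=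
    fun _ _ _ _ => rfl
  have hFG : ∀ M, F (G M) = M := fun M => by
    funext j
    refine Matrix.ext fun s t => RelC0.ext fun z => ?_
    rw [hF, hG, AlgEquiv.apply_symm_apply]
    rfl
  have hGF : ∀ M, G (F M) = M := fun M => by
    refine CStarMatrix.ext fun a b => RelC0.ext fun z => ?_
    rw [hG]
    simp only [hF]
    exact e.symm_apply_apply _
  let θ : CStarMatrix ι ι (RelC0 Z N) →ₙₐ[ℂ] ∀ j, Matrix (ι × d j) (ι × d j) (RelC0 Z ℂ) :=
    { toFun := F
      map_smul' := fun w M => by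
        funext j
        refine Matrix.ext fun s t => RelC0.ext fun z => ?_
        rw [hF, CStarMatrix.smul_apply, RelC0.eval_smul, map_smul]
        rfl
      map_zero' := by
        funext j
        refine Matrix.ext fun s t => RelC0.ext fun z => ?_
        rw [hF, CStarMatrix.zero_apply, map_zero, map_zero]
        exact (map_zero (RelC0.eval Z ℂ z)).symm
      map_add' := fun M M' => by
        funext j
        refine Matrix.ext fun s t => RelC0.ext fun z => ?_
        rw [hF, CStarMatrix.add_apply, map_add, map_add]
        exact (map_add (RelC0.eval Z ℂ z) (F M j s t) (F M' j s t)).symm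
      map_mul' := fun M M' => by
        funext j
        refine Matrix.ext fun s t => RelC0.ext fun z => ?_
        rw [hF, CStarMatrix.mul_apply, map_sum, map_sum, Pi.mul_apply, Matrix.mul_apply, map_sum,
          Fintype.sum_prod_type, Finset.sum_apply, Matrix.sum_apply]
        refine Finset.sum_congr rfl fun k _ => ?_
        rw [RelC0.eval_mul, map_mul, Pi.mul_apply, Matrix.mul_apply]
        rfl }
  refine ⟨θ, (Homeomorph.mk (Equiv.mk F G hGF hFG) ?_ ?_).isHomeomorph⟩
  -- Continuity of a map into functions on T follows from joint continuity in the matrix and the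
  -- point of T.
  · refine continuous_pi fun j => continuous_matrix fun s t => Continuous.subtype_mk ?_ _
    refine ContinuousMap.continuous_of_continuous_uncurry _ ?_
    have h : Continuous fun M : CStarMatrix ι ι (RelC0 Z N) => M s.1 t.1 :=
      (continuous_apply (A := fun _ : ι => RelC0 Z N) t.1).comp
        (continuous_apply (A := fun _ : ι => ι → RelC0 Z N) s.1)
    exact (hc j s.2 t.2).comp
      ((continuous_subtype_val.comp (h.comp continuous_fst)).eval continuous_snd)
  · refine continuous_pi fun a => continuous_pi fun b => Continuous.subtype_mk ?_ _
    refine ContinuousMap.continuous_of_continuous_uncurry _ ?_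
    refine he'.comp (continuous_pi fun j => continuous_matrix fun s t => ?_)
    have h : Continuous fun M : ∀ j, Matrix (ι × d j) (ι × d j) (RelC0 Z ℂ) =>
      M j (a, s) (b, t) := (continuous_apply j).matrix_elem _ _
    exact (continuous_subtype_val.comp (h.comp continuous_fst)).eval continuous_snd

end MatrixFunctions

/-- As R is free of finite rank, K ⊗ R is a finite power of K. This converts one copy of K-theory
per simple module into a tensor product with the representation group. -/
theorem nonempty_pi_addEquiv_tensor {n : Type*} [Fintype n] {R : Type*} [AddCommGroup R]
    (r : R ≃+ (n → ℤ)) (K : Type*) [AddCommGroup K] : Nonempty ((n → K) ≃+ K ⊗[ℤ] R) := by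
  classical
  exact ⟨((TensorProduct.congr (LinearEquiv.refl ℤ K) r.toIntLinearEquiv).trans
    (TensorProduct.piScalarRight ℤ ℤ K n)).symm.toAddEquiv⟩

theorem nonempty_K0_K1_addEquiv_of_isHomeomorph {A D : Type*} [NonUnitalCStarAlgebra A]
    [NonUnitalCStarAlgebra D] {J : Type*} [Fintype J] {d : J → Type*} [∀ j, Fintype (d j)]
    [∀ j, DecidableEq (d j)] [∀ j, Nonempty (d j)] {R : Type*} [AddCommGroup R] (r : R ≃+ (J → ℤ))
    (θ : A →ₙₐ[ℂ] ∀ j, Matrix (d j) (d j) D) (hθ : IsHomeomorph θ) :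
    Nonempty (K0 A ≃+ K0 D ⊗[ℤ] R) ∧ Nonempty (K1 A ≃+ K1 D ⊗[ℤ] R) := by
  obtain ⟨θ₁, hθ₁⟩ := Suspension.exists_bijective_hom θ hθ
  obtain ⟨k⟩ := K0.nonempty_addEquiv_pi θ hθ.bijective
  obtain ⟨k₁⟩ := K0.nonempty_addEquiv_pi θ₁ hθ₁
  obtain ⟨t⟩ := nonempty_pi_addEquiv_tensor r (K0 D)
  obtain ⟨t₁⟩ := nonempty_pi_addEquiv_tensor r (K1 D)
  exact ⟨⟨k.trans t⟩, ⟨k₁.trans t₁⟩⟩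

/-- The K-theory of an algebra isomorphic to matrices over `C₀(T, Z; N)`, with `N` a finite
dimensional C⋆-algebra. -/
theorem nonempty_K0_K1_addEquiv {T : Type*} [TopologicalSpace T] [CompactSpace T] (Z : Set T)
    {N : Type*} [CStarAlgebra N] [FiniteDimensional ℂ N] (ι : Type*) [Fintype ι]
    [Nonempty ι] {A : Type*} [NonUnitalCStarAlgebra A]
    (Ψ : A ≃⋆ₐ[ℂ] CStarMatrix ι ι (RelC0 Z N)) :
    Nonempty (K0 A ≃+ K0 (RelC0 Z ℂ) ⊗[ℤ] RepGroup N) ∧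
      Nonempty (K1 A ≃+ K1 (RelC0 Z ℂ) ⊗[ℤ] RepGroup N) := by
  classical
  have hss : IsSemisimpleRing N := CStarAlgebra.isSemisimpleRing N
  -- This is Wedderburn's theorem over ℂ. The isomorphism e may ignore the involution of N: K₀ is
  -- defined by idempotents rather than projections.
  obtain ⟨n, d, hd, ⟨e⟩⟩ := IsSemisimpleRing.exists_algEquiv_pi_matrix_of_isAlgClosed ℂ N
  obtain ⟨r⟩ := RepGroup.nonempty_addEquiv_pi e
  obtain ⟨θ, hθ⟩ := exists_isHomeomorph_matrix Z ι e
  have hΨ := CStarMatrix.isHomeomorph_starAlgEquiv Ψ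
  exact nonempty_K0_K1_addEquiv_of_isHomeomorph r
    (θ.comp (Ψ : A →ₙₐ[ℂ] CStarMatrix ι ι (RelC0 Z N))) (hθ.comp hΨ)

end

noncomputable section

/-! ### Morita equivalence of an algebra with its matrix algebras -/

section Morita

universe u

attribute [local instance] CStarAlgebra.spectralOrder CStarAlgebra.spectralOrderedRing

variable {P ι : Type u} [NonUnitalCStarAlgebra P] [Fintype ι]

/-- The matrices that are supported in one column. -/
def columnSubmodule (P : Type u) [NonUnitalCStarAlgebra P] (o : ι) :
    Submodule ℂ (CStarMatrix ι ι P) where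
  carrier := {M | ∀ i j, j ≠ o → M i j = 0}
  add_mem' {M M'} h h' i j hj := by rw [CStarMatrix.add_apply, h i j hj, h' i j hj, add_zero]
  zero_mem' _ _ _ := rfl
  smul_mem' z M h i j hj := by rw [CStarMatrix.smul_apply, h i j hj, smul_zero]

variable {o : ι}

theorem CStarMatrix.continuous_entry (i j : ι) : Continuous fun M : CStarMatrix ι ι P => M i j :=
  (continuous_apply (A := fun _ : ι => P) j).comp
    (continuous_apply (A := fun _ : ι => ι → P) i)

theorem isClosed_columnSubmodule : IsClosed (columnSubmodule P o : Set (CStarMatrix ι ι P)) := by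
  have : (columnSubmodule P o : Set (CStarMatrix ι ι P)) =
      ⋂ (i : ι) (j : ι) (_ : j ≠ o), {M | M i j = 0} := by
    ext M
    simp only [Set.mem_iInter]
    rfl
  rw [this]
  exact isClosed_iInter fun i => isClosed_iInter fun j => isClosed_iInter fun _ =>
    isClosed_eq (CStarMatrix.continuous_entry i j) continuous_const

theorem mul_mem_columnSubmodule (M : CStarMatrix ι ι P) {x : CStarMatrix ι ι P}
    (hx : x ∈ columnSubmodule P o) : M * x ∈ columnSubmodule P o := fun i j hj => by
  rw [CStarMatrix.mul_apply]
  exact Finset.sum_eq_zero fun k _ => by rw [hx k j hj, mul_zero]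

variable [DecidableEq ι]

/-- The matrix with a single entry. -/
def CStarMatrix.entry (i j : ι) : P →ₗ[ℂ] CStarMatrix ι ι P where
  toFun b := CStarMatrix.ofMatrix (Matrix.single i j b)
  map_add' _ _ := by rw [Matrix.single_add]; rfl
  map_smul' z _ := by
    rw [← Matrix.smul_single]
    rfl

open CStarMatrix

theorem CStarMatrix.entry_apply (i j a b : ι) (p : P) :
    entry i j p a b = if i = a ∧ j = b then p else 0 := Matrix.single_apply _ _ _ _ _

theorem CStarMatrix.entry_apply_same (i j : ι) (p : P) : entry i j p i j = p := by
  simp [entry_apply]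

theorem CStarMatrix.entry_mul_entry (i j k : ι) (p q : P) :
    entry i j p * entry j k q = entry i k (p * q) := Matrix.single_mul_single_same _ _ _ _ _

theorem CStarMatrix.star_entry (i j : ι) (p : P) : star (entry i j p) = entry j i (star p) := by
  refine CStarMatrix.ext fun a b => ?_
  rw [star_apply, entry_apply, entry_apply]
  simp only [and_comm (a := i = b)]
  split_ifs <;> simp

theorem CStarMatrix.sum_entry (M : CStarMatrix ι ι P) : ∑ i, ∑ j, entry i j (M i j) = M :=
  (Matrix.matrix_eq_sum_single M).symm

theorem entry_mem_columnSubmodule (i : ι) (p : P) : entry i o p ∈ columnSubmodule P o :=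
  fun a b hb => by
    rw [entry_apply, if_neg fun h => hb h.2.symm]

/-- For two columns x and y, the matrix x⋆y is concentrated in the corner (o, o). Placing the
`P`-valued inner product there turns the axioms of a Hilbert module into matrix identities. -/
theorem entry_eq_of_mem {x y : CStarMatrix ι ι P} (hx : x ∈ columnSubmodule P o)
    (hy : y ∈ columnSubmodule P o) : entry o o ((star x * y) o o) = star x * y := by
  refine CStarMatrix.ext fun a b => ?_
  rw [entry_apply]
  split_ifs with h
  · rw [← h.1, ← h.2]
  · rw [CStarMatrix.mul_apply]
    refine (Finset.sum_eq_zero fun k _ => ?_).symm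
    by_cases h1 : o = a
    · rw [hy k b fun h2 => h ⟨h1, h2.symm⟩, mul_zero]
    · rw [CStarMatrix.star_apply, hx k a (Ne.symm h1), star_zero, zero_mul]

/-- The embedding of P as a corner is an injective ⋆-homomorphism, hence isometric. -/
theorem CStarMatrix.norm_entry (i : ι) (p : P) : ‖entry i i p‖ = ‖p‖ := by
  let D : P →⋆ₙₐ[ℂ] CStarMatrix ι ι P :=
    { entry i i with
      map_zero' := map_zero (entry i i)
      map_mul' := fun p q => (entry_mul_entry i i i p q).symm
      map_star' := fun p => (star_entry i i p).symm }
  exact NonUnitalStarAlgHom.norm_map D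
    (fun p q h => by
      have := congrArg (fun M : CStarMatrix ι ι P => M i i) h
      simpa [D, entry_apply_same] using this) p

theorem exists_star_mul_self_entry (x : CStarMatrix ι ι P) : ∃ b, (star x * x) o o = star b * b := by
  have h : 0 ≤ (star x * x) o o := by
    rw [CStarMatrix.mul_apply]
    exact Finset.sum_nonneg fun k _ => star_mul_self_nonneg (x k o)
  exact CStarAlgebra.nonneg_iff_eq_star_mul_self.mp h

theorem span_star_mul : Submodule.span ℂ {b : P | ∃ p, star p * p = b} = ⊤ := by
  rw [← CStarAlgebra.span_nonneg]
  congr 1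
  ext b
  rw [Set.mem_ofPred_eq, Set.mem_ofPred_eq, CStarAlgebra.nonneg_iff_eq_star_mul_self]
  exact exists_congr fun p => eq_comm

/-- A C⋆-algebra that is isomorphic to the matrices over `P` is Morita equivalent to `P`. -/
theorem MoritaEquivalent.of_matrix {A : Type u} [NonUnitalCStarAlgebra A] (o : ι)
    (Ψ : A ≃⋆ₐ[ℂ] CStarMatrix ι ι P) : MoritaEquivalent A P := by
  -- The bimodule is one column of the matrix algebra. A acts on the left through Ψ, P acts on the
  -- right through the corner (o, o), and the inner products are xy⋆ and x⋆y.
  let E := columnSubmodule P o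
  have hE : CompleteSpace E := isClosed_columnSubmodule.completeSpace_coe
  let l : A →ₗ[ℂ] E →ₗ[ℂ] E := LinearMap.mk₂ ℂ
    (fun a x => ⟨Ψ a * x.1, mul_mem_columnSubmodule _ x.2⟩)
    (fun a a' x => Subtype.ext (by simp [add_mul]))
    (fun z a x => Subtype.ext (by simp [smul_mul_assoc]))
    (fun a x y => Subtype.ext (by simp [mul_add]))
    (fun z a x => Subtype.ext (by simp [mul_smul_comm]))
  let r : P →ₗ[ℂ] E →ₗ[ℂ] E := LinearMap.mk₂ ℂ
    (fun b x => ⟨x.1 * entry o o b, mul_mem_columnSubmodule _ (entry_mem_columnSubmodule o b)⟩)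
    (fun b b' x => Subtype.ext (by simp [mul_add]))
    (fun z b x => Subtype.ext (by simp [mul_smul_comm]))
    (fun b x y => Subtype.ext (by simp [add_mul]))
    (fun z b x => Subtype.ext (by simp [smul_mul_assoc]))
  let ipA : E →ₗ[ℂ] E →ₗ⋆[ℂ] A := LinearMap.mk₂'ₛₗ _ _
    (fun x y => Ψ.symm (x.1 * star y.1))
    (fun x x' y => by simp [add_mul])
    (fun z x y => by simp [smul_mul_assoc])
    (fun x y y' => by simp [mul_add])
    (fun z x y => by simp [mul_smul_comm])
  let ipB : E →ₗ⋆[ℂ] E →ₗ[ℂ] P := LinearMap.mk₂'ₛₗ _ _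
    (fun x y => (star x.1 * y.1) o o)
    (fun x x' y => by simp [add_mul])
    (fun z x y => by simp [smul_mul_assoc])
    (fun x y y' => by simp [mul_add])
    (fun z x y => by simp [mul_smul_comm])
  have hl : ∀ a x, (l a x : CStarMatrix ι ι P) = Ψ a * x := fun _ _ => rfl
  have hr : ∀ b x, (r b x : CStarMatrix ι ι P) = x * entry o o b := fun _ _ => rfl
  have hA : ∀ x y, ipA x y = Ψ.symm (x.1 * star y.1) := fun _ _ => rfl
  have hB : ∀ x y, ipB x y = (star x.1 * y.1) o o := fun _ _ => rfl
  have hB' : ∀ x y : E, entry o o (ipB x y) = star x.1 * y.1 := fun x y => entry_eq_of_mem x.2 y.2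
  refine ⟨E, inferInstance, inferInstance, hE, l, r, ipA, ipB, ?_, ?_, ?_, ?_, ?_, ?_, ?_, ?_, ?_,
    ?_, ?_, ?_, ?_, ?_, ?_, ?_⟩
  · intro a a' x
    refine Subtype.ext ?_
    simp only [hl, map_mul, mul_assoc]
  · intro b b' x
    refine Subtype.ext ?_
    simp only [hr, ← entry_mul_entry o o o, mul_assoc]
  · intro a b x
    refine Subtype.ext ?_
    simp only [hl, hr, mul_assoc]
  · intro a x y
    rw [hA, hA, hl, mul_assoc, map_mul, StarAlgEquiv.symm_apply_apply]
  · intro x y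
    rw [hA, hA, ← map_star, star_mul, star_star]
  · intro x
    refine ⟨Ψ.symm (star x.1), ?_⟩
    rw [hA, ← map_star, star_star, map_mul]
  · intro x
    rw [hA, StarAlgEquiv.norm_map Ψ.symm, CStarRing.norm_self_mul_star, sq]
    rfl
  · intro b x y
    have h := entry_mul_entry o o o (ipB x y) b
    rw [hB', mul_assoc, ← hr, ← hB'] at h
    have := congrArg (fun M : CStarMatrix ι ι P => M o o) h
    simpa [entry_apply_same] using this
  · intro x y
    rw [hB, hB, ← CStarMatrix.star_apply, star_mul, star_star]
  · intro x
    exact exists_star_mul_self_entry x.1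
  · intro x
    rw [← CStarMatrix.norm_entry o (ipB x x), hB', CStarRing.norm_star_mul_self, sq]
    rfl
  · intro a x y
    rw [hB, hB, hl, hl, star_mul, map_star, mul_assoc]
  · intro b x y
    rw [hA, hA, hr, hr, star_mul, star_entry, star_star, mul_assoc]
  · intro x y z
    refine Subtype.ext ?_
    rw [hl, hr, hB', hA, StarAlgEquiv.apply_symm_apply, mul_assoc]
  -- P need not have a unit, so p is first written as a combination of elements q⋆q. A single entry
  -- q⋆q is then the inner product of two columns with entry q⋆.
  · have h1 : ∀ (i j : ι) (p : P),
        Ψ.symm (entry i j p) ∈ Submodule.span ℂ {a | ∃ x y, ipA x y = a} := by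
      intro i j p
      have hp : p ∈ Submodule.span ℂ {b : P | ∃ p, star p * p = b} := by
        rw [span_star_mul]
        exact Submodule.mem_top
      induction hp using Submodule.span_induction with
      | mem x h =>
        obtain ⟨q, rfl⟩ := h
        refine Submodule.subset_span ⟨⟨entry i o (star q), entry_mem_columnSubmodule i _⟩,
          ⟨entry j o (star q), entry_mem_columnSubmodule j _⟩, ?_⟩
        rw [hA, star_entry, star_star, entry_mul_entry]
      | zero => simp
      | add x y _ _ hx hy => rw [map_add, map_add]; exact add_mem hx hy
      | smul z x _ hx => rw [map_smul, map_smul]; exact Submodule.smul_mem _ z hx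
    have h2 : Submodule.span ℂ {a | ∃ x y, ipA x y = a} = ⊤ := by
      refine eq_top_iff.mpr fun a _ => ?_
      rw [← Ψ.symm_apply_apply a, ← CStarMatrix.sum_entry (Ψ a), map_sum]
      refine sum_mem fun i _ => ?_
      rw [map_sum]
      exact sum_mem fun j _ => h1 i j _
    rw [h2]
    exact dense_univ
  · have h2 : Submodule.span ℂ {b | ∃ x y, ipB x y = b} = ⊤ := by
      rw [eq_top_iff, ← span_star_mul, Submodule.span_le]
      rintro _ ⟨p, rfl⟩
      refine Submodule.subset_span ⟨⟨entry o o p, entry_mem_columnSubmodule o _⟩,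
          ⟨entry o o p, entry_mem_columnSubmodule o _⟩, ?_⟩
      rw [hB, star_entry, entry_mul_entry, entry_apply_same]
    rw [h2]
    exact dense_univ

end Morita
end

/-! ### Cocycle identities and the topology of the crossed product -/

noncomputable section

namespace TwoCocycle

variable {Γ : Type*} [Group Γ] [Finite Γ] (c : TwoCocycle Γ)

/-- The two scales are products over different groups, but both satisfy `scale_mul`. Their ratio is
a homomorphism from the finite group H to the positive reals, so it is trivial. -/
theorem scale_restrict (H : Subgroup Γ) (h : H) : (c.restrict H).scale h = c.scale h := by
  have hpos : ∀ h : H, 0 < (c.restrict H).scale h / c.scale h := fun h =>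
    div_pos ((c.restrict H).scale_pos h) (c.scale_pos h)
  have hmul : ∀ a b : H, (c.restrict H).scale (a * b) / c.scale (a * b : H) =
      ((c.restrict H).scale a / c.scale a) * ((c.restrict H).scale b / c.scale b) := by
    intro a b
    have h1 := (c.restrict H).scale_mul a b
    have h2 := c.scale_mul a b
    have h3 : ‖((c.restrict H) a b : ℂ)‖ = ‖(c a b : ℂ)‖ := rfl
    have n0 : ‖(c a b : ℂ)‖ ≠ 0 := by simp
    rw [div_mul_div_comm, ← h1, ← h2, h3, mul_div_mul_left _ _ n0, Subgroup.coe_mul]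
  let f : H →* ℝ :=
    { toFun := fun h => (c.restrict H).scale h / c.scale h
      map_one' := by
        rw [scale_one, Subgroup.coe_one, scale_one, div_one]
      map_mul' := hmul }
  have h1 : f h ^ orderOf h = 1 := by rw [← map_pow, pow_orderOf_eq_one, map_one]
  have h2 : f h = 1 :=
    (pow_eq_one_iff_of_nonneg (hpos h).le (orderOf_pos h).ne').mp h1
  exact (div_eq_one_iff_eq (c.scale_pos h).ne').mp h2

theorem inv_comm (w : Γ) : c w w⁻¹ = c w⁻¹ w := by
  have h := c.cocycle w w⁻¹ w
  rwa [mul_inv_cancel, inv_mul_cancel, c.one_left, c.one_right, one_mul, one_mul] at h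

/-- The scalar relating `T_w` and `T_h` when `w q = p h`. -/
def transfer (p h q : Γ) : ℂ :=
  (c (p * h * q⁻¹) q : ℂ) * c.scale p / ((c p h : ℂ) * c.scale q)

theorem transfer_ne_zero (p h q : Γ) : c.transfer p h q ≠ 0 := by
  have h1 : (c.scale p : ℂ) ≠ 0 := Complex.ofReal_ne_zero.mpr (c.scale_pos p).ne'
  have h2 : (c.scale q : ℂ) ≠ 0 := Complex.ofReal_ne_zero.mpr (c.scale_pos q).ne'
  exact div_ne_zero (mul_ne_zero (Units.ne_zero _) h1) (mul_ne_zero (Units.ne_zero _) h2)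

/-- With the unitaries U_p = s(p)⁻¹ T_p one has U_p⁻¹ T_w U_q = `transfer p h q` • T_h for w = p h
q⁻¹. The identity compares the two ways to multiply such expressions; in terms of the cocycle it
combines three instances of the cocycle relation. -/
theorem transfer_mul (p u q r t : Γ) :
    c.transfer p (u * r) t * c (p * u * q⁻¹) (q * r * t⁻¹) =
      c u r * (c.transfer p u q * c.transfer q r t) := by
  have h1 := congrArg Units.val (c.cocycle (p * u * q⁻¹) (q * r * t⁻¹) t)
  have h2 := congrArg Units.val (c.cocycle (p * u * q⁻¹) q r)
  have h3 := congrArg Units.val (c.cocycle p u r)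
  simp only [Units.val_mul] at h1 h2 h3
  rw [show p * u * q⁻¹ * (q * r * t⁻¹) = p * (u * r) * t⁻¹ by group,
    show q * r * t⁻¹ * t = q * r by group] at h1
  rw [show p * u * q⁻¹ * q = p * u by group] at h2
  have n1 : (c.scale p : ℂ) ≠ 0 := Complex.ofReal_ne_zero.mpr (c.scale_pos p).ne'
  have n2 : (c.scale q : ℂ) ≠ 0 := Complex.ofReal_ne_zero.mpr (c.scale_pos q).ne'
  have n3 : (c.scale t : ℂ) ≠ 0 := Complex.ofReal_ne_zero.mpr (c.scale_pos t).ne'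
  have m1 := (c p (u * r)).ne_zero
  have m2 := (c p u).ne_zero
  have m3 := (c q r).ne_zero
  have m4 := (c (p * u) r).ne_zero
  unfold transfer
  rw [div_mul_eq_mul_div, div_mul_div_comm, ← mul_div_assoc, div_eq_div_iff (by positivity) (by positivity)]
  linear_combination (c.scale p * c.scale q * c.scale t * c p u * c q r : ℂ) * h1
    - (c.scale p * c.scale q * c.scale t * c (q * r * t⁻¹) t * c p u : ℂ) * h2
    + (c.scale p * c.scale q * c.scale t * c (q * r * t⁻¹) t * c (p * u * q⁻¹) q : ℂ) * h3

/-- The scalar compares T_w with T_h up to unitaries, and these are unitaries multiplied by s(w) and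
s(h). -/
theorem norm_transfer (p h q : Γ) :
    ‖c.transfer p h q‖ = c.scale (p * h * q⁻¹) / c.scale h := by
  have h1 := c.scale_mul (p * h * q⁻¹) q
  have h2 := c.scale_mul p h
  rw [inv_mul_cancel_right] at h1
  have n1 := (c.scale_pos p).ne'
  have n2 := (c.scale_pos q).ne'
  have n3 := (c.scale_pos h).ne'
  have n4 := (c.scale_pos (p * h)).ne'
  have n0 : ‖(c p h : ℂ)‖ ≠ 0 := by simp
  have e : ∀ g : Γ, ‖(c.scale g : ℂ)‖ = c.scale g := fun g => by
    rw [Complex.norm_real, Real.norm_of_nonneg (c.scale_pos g).le]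
  rw [transfer, norm_div, norm_mul, norm_mul, e, e, div_eq_div_iff (mul_ne_zero n0 n2) n3]
  refine mul_right_cancel₀ n4 ?_
  linear_combination (c.scale p * c.scale h) * h1 -
    (c.scale (p * h * q⁻¹) * c.scale q) * h2

/-- This is the compatibility of U_p⁻¹ T_w U_q with the involution. It follows from `transfer_mul`
for the product of h and h⁻¹, where `transfer p 1 p` is 1, together with the absolute value from
`norm_transfer`. -/
theorem transfer_star (p h q : Γ) :
    c.transfer p h q * (((c.scale (p * h * q⁻¹) : ℂ) ^ 2)⁻¹ *
        star (c (p * h * q⁻¹)⁻¹ (p * h * q⁻¹) : ℂ)) =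
      ((c.scale h : ℂ) ^ 2)⁻¹ * star (c h⁻¹ h : ℂ) * star (c.transfer q h⁻¹ p) := by
  have h1 := c.transfer_mul p h q h⁻¹ p
  rw [show q * h⁻¹ * p⁻¹ = (p * h * q⁻¹)⁻¹ by group, c.inv_comm, c.inv_comm, mul_inv_cancel] at h1
  have n1 : (c.scale p : ℂ) ≠ 0 := Complex.ofReal_ne_zero.mpr (c.scale_pos p).ne'
  have h2 : c.transfer p 1 p = 1 := by
    simp [transfer, c.one_left, c.one_right, div_self n1]
  rw [h2, one_mul] at h1
  have h3 : c.transfer p h q * star (c.transfer p h q) =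
      ((c.scale (p * h * q⁻¹) : ℂ) / c.scale h) ^ 2 := by
    rw [Complex.star_def, Complex.mul_conj', norm_transfer]
    push_cast
    rfl
  have n2 : (c.scale h : ℂ) ≠ 0 := Complex.ofReal_ne_zero.mpr (c.scale_pos h).ne'
  have n3 : (c.scale (p * h * q⁻¹) : ℂ) ≠ 0 :=
    Complex.ofReal_ne_zero.mpr (c.scale_pos (p * h * q⁻¹)).ne'
  rw [h1, star_mul', star_mul']
  have h4 : ∀ x y z s : ℂ, x * (s * (y * (star x * z))) = (x * star x) * s * y * z := by
    intros; ring
  rw [h4, h3]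
  field_simp

end TwoCocycle

namespace TwistedCrossedProduct

variable {Γ D : Type*} [Group Γ] [Finite Γ] [CStarAlgebra D]
  {α : Γ →* (D ≃⋆ₐ[ℂ] D)} {c : TwoCocycle Γ}

attribute [local instance] Fintype.ofFinite Classical.decEq
attribute [local instance] CStarAlgebra.spectralOrder CStarAlgebra.spectralOrderedRing

theorem continuous_action (w : Γ) : Continuous (α w) :=
  (AddMonoidHomClass.isometry_of_norm (α w) (fun x => StarAlgEquiv.norm_map (α w) x)).continuous

/-- The coefficient at w can be recovered from one entry of the regular matrix, whose norm defines
the topology. With `continuous_mk` this says that the topology is that of the product of copies of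
D. -/
theorem continuous_coeff (w : Γ) :
    Continuous fun a : TwistedCrossedProduct α c => a.coeff w := by
  have h : (fun a : TwistedCrossedProduct α c => a.coeff w) =
      fun a => α w ((c.scale w : ℂ)⁻¹ • regular a w 1) := by
    funext a
    rw [regular_one_col, inv_smul_smul₀ (scale_ne c _), ← StarAlgEquiv.mul_apply, ← map_mul,
      mul_inv_cancel, map_one, StarAlgEquiv.one_apply]
  rw [h]
  have hcoe : Continuous fun M : CStarMatrix Γ Γ D => M w 1 :=
    (continuous_apply (A := fun _ : Γ => D) 1).comp (continuous_apply (A := fun _ : Γ => Γ → D) w)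
  exact (continuous_action w).comp
    ((hcoe.comp isometry_regular.continuous).const_smul _)

theorem continuous_mk : Continuous fun f : Γ → D => (⟨f⟩ : TwistedCrossedProduct α c) := by
  rw [isometry_regular.isEmbedding.continuous_iff]
  refine continuous_pi (A := fun _ : Γ => Γ → D) fun h => continuous_pi fun g => ?_
  exact ((continuous_action h⁻¹).comp (continuous_apply (h * g⁻¹))).const_smul _

end TwistedCrossedProduct
end

/-! ### The ideals as vanishing conditions on coefficients -/

noncomputable section

section RelIdeal

variable {Γ Y : Type*} [Group Γ] [Finite Γ] [TopologicalSpace Y] [CompactSpace Y] [T2Space Y]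
  [MulAction Γ Y] [ContinuousConstSMul Γ Y]

attribute [local instance] Fintype.ofFinite Classical.decEq

instance OrbitSpace.t2Space : T2Space (OrbitSpace Γ Y) :=
  t2Space_of_properlyDiscontinuousSMul_of_t2Space

/-- A closed ideal of C(Y) is determined by its common zeros. By Urysohn's lemma on the compact
Hausdorff orbit space, the pullbacks of functions vanishing on Z have no common zero outside the
preimage of Z. -/
theorem mem_closure_of_vanishing {Z : Set (OrbitSpace Γ Y)} (hZ : IsClosed Z) {d : C(Y, ℂ)}
    (hd : ∀ y, orbitMap Γ y ∈ Z → d y = 0) :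
    d ∈ (Ideal.span {x : C(Y, ℂ) | ∃ f ∈ RelC0 Z ℂ, x = pullback f}).closure := by
  rw [← ContinuousMap.idealOfSet_ofIdeal_eq_closure, ContinuousMap.mem_idealOfSet]
  intro y hy
  refine hd y (by_contra fun hyZ => hy ?_)
  have hcl : IsClosed ({orbitMap Γ y} : Set (OrbitSpace Γ Y)) := isClosed_singleton
  obtain ⟨f, hf0, hf1, -⟩ := exists_continuous_zero_one_of_isClosed hZ hcl
    (Set.disjoint_singleton_right.mpr hyZ)
  rw [ContinuousMap.mem_setOfIdeal]
  refine ⟨pullback ((⟨Complex.ofReal, Complex.continuous_ofReal⟩ : C(ℝ, ℂ)).comp f),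
    Ideal.subset_span ⟨_, ?_, rfl⟩, ?_⟩
  · intro z hz
    simp [hf0 hz]
  · change ((f (orbitMap Γ y) : ℝ) : ℂ) ≠ 0
    simp [hf1 (Set.mem_singleton _)]

/-- Vanishing is a closed condition that holds on generators. Conversely a is a finite sum of terms
d T_w, and each d is approximated by elements of the ideal of C(Y) generated by pullbacks. -/
theorem mem_relIdeal_iff {c : TwoCocycle Γ} {Z : Set (OrbitSpace Γ Y)} (hZ : IsClosed Z)
    {a : TwistedCrossedProduct (translation Γ Y) c} :
    a ∈ relIdeal c Z ↔ ∀ w y, orbitMap Γ y ∈ Z → a.coeff w y = 0 := by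
  constructor
  · intro ha w y hy
    have hcl : IsClosed {x : TwistedCrossedProduct (translation Γ Y) c | x.coeff w y = 0} :=
      isClosed_eq ((continuous_eval_const y).comp (TwistedCrossedProduct.continuous_coeff w))
        continuous_const
    have ha' : a ∈ closure (idealSpan c Z : Set (TwistedCrossedProduct (translation Γ Y) c)) := ha
    refine closure_minimal ?_ hcl ha'
    intro x hx
    change x ∈ idealSpan c Z at hx
    change x.coeff w y = 0
    induction hx using Submodule.span_induction with
    | mem x h =>
      obtain ⟨f, hf, b, rfl⟩ := h
      change f (orbitMap Γ y) * b.coeff w y = 0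
      rw [hf _ hy, zero_mul]
    | zero => rfl
    | add x z _ _ hx hz =>
      change x.coeff w y + z.coeff w y = 0
      rw [hx, hz, add_zero]
    | smul k x _ hx =>
      change k * x.coeff w y = 0
      rw [hx, mul_zero]
  · intro ha
    let single : Γ → C(Y, ℂ) → TwistedCrossedProduct (translation Γ Y) c :=
      fun w d => ⟨Pi.single w d⟩
    have hsum : a = ∑ w, single w (a.coeff w) := by
      have h : a.coeff = ∑ w, Pi.single w (a.coeff w) := (Finset.univ_sum_single a.coeff).symm
      let φ : TwistedCrossedProduct (translation Γ Y) c →+ (Γ → C(Y, ℂ)) :=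
        ⟨⟨TwistedCrossedProduct.coeff, rfl⟩, fun _ _ => rfl⟩
      refine TwistedCrossedProduct.ext fun w => congrFun ?_ w
      refine h.trans ?_
      exact (map_sum φ (fun w => single w (a.coeff w)) Finset.univ).symm
    rw [hsum]
    refine sum_mem fun w _ => ?_
    have hc : Continuous (single w) :=
      TwistedCrossedProduct.continuous_mk.comp (continuous_single (A := fun _ : Γ => C(Y, ℂ)) w)
    refine map_mem_closure hc (mem_closure_of_vanishing hZ (ha w)) fun d hd => ?_
    induction (show d ∈ Ideal.span _ from hd) using Submodule.span_induction with
    | mem x h =>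
      obtain ⟨f, hf, rfl⟩ := h
      refine Submodule.subset_span ⟨f, hf, single w 1, TwistedCrossedProduct.ext fun v => ?_⟩
      change (Pi.single w (pullback f) : Γ → C(Y, ℂ)) v = pullback f * (Pi.single w 1 : Γ → _) v
      by_cases h : v = w
      · subst h; simp
      · simp [h]
    | zero =>
      have : single w 0 = 0 := TwistedCrossedProduct.ext fun v => by simp [single]
      rw [this]
      exact zero_mem _
    | add x z hx' hz' hx hz =>
      have : single w (x + z) = single w x + single w z :=
        TwistedCrossedProduct.ext fun v => by simp [single, Pi.single_add]
      rw [this]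
      exact add_mem (hx hx') (hz hz')
    | smul k x hx' hx =>
      -- Multiplying the coefficient by k in C(Y) is left multiplication by k T_1, which preserves
      -- the ideal.
      have : single w (k • x) = single 1 k * single w x := TwistedCrossedProduct.ext fun v => by
        rw [TwistedCrossedProduct.coeff_mul, Finset.sum_eq_single 1]
        · simp only [inv_one, one_mul, c.one_left, map_one, single, Pi.single_eq_same]
          by_cases h : v = w
          · subst h; simp
          · simp [h]
        · intro u _ hu
          simp [single, hu]
        · simp
      rw [this]
      exact mul_mem_idealSpan _ (hx hx')

theorem isClosed_orbitMap_image {S : Set Y} (hS : IsClosed S) : IsClosed (orbitMap Γ '' S) :=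
  (hS.isCompact.image continuous_orbitMap).isClosed

theorem orbitMap_eq_iff {y z : Y} : orbitMap Γ y = orbitMap Γ z ↔ ∃ g : Γ, g • z = y :=
  Quotient.eq

theorem mem_relIdeal_image_iff {c : TwoCocycle Γ} {S : Set Y} (hS : IsClosed S)
    {a : TwistedCrossedProduct (translation Γ Y) c} :
    a ∈ relIdeal c (orbitMap Γ '' S) ↔ ∀ w, ∀ g : Γ, ∀ y ∈ S, a.coeff w (g • y) = 0 := by
  rw [mem_relIdeal_iff (isClosed_orbitMap_image hS)]
  constructor
  · intro h w g y hy
    exact h w _ ⟨y, hy, (orbitMap_smul g y).symm⟩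
  · rintro h w y ⟨z, hz, hzy⟩
    obtain ⟨g, rfl⟩ := orbitMap_eq_iff.mp hzy.symm
    exact h w g z hz

end RelIdeal
end

/-! ### Restriction of the crossed product to one orbit -/

noncomputable section

section Localization

variable {Γ Y : Type*} [Group Γ] [Finite Γ] [TopologicalSpace Y] [CompactSpace Y] [T2Space Y]
  [MulAction Γ Y] [ContinuousConstSMul Γ Y] {c : TwoCocycle Γ} (H : Subgroup Γ)

attribute [local instance] Fintype.ofFinite Classical.decEq

/-- For a fixed row i, each v in Γ has the form r_i u r_k⁻¹ in one way: k must be the coset of v⁻¹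
r_i, and u is then determined. -/
theorem bijective_out_mul (i : Γ ⧸ H) :
    Function.Bijective fun p : (Γ ⧸ H) × H => i.out * p.2 * p.1.out⁻¹ := by
  constructor
  · rintro ⟨k, u⟩ ⟨k', u'⟩ h
    have h' : (u : Γ) * k.out⁻¹ = u' * k'.out⁻¹ := by simpa [mul_assoc] using h
    have hk : k = k' := by
      rw [← QuotientGroup.out_eq' k, ← QuotientGroup.out_eq' k', QuotientGroup.eq]
      have : k.out⁻¹ * k'.out = ((u⁻¹ * u' : H) : Γ) := by
        rw [Subgroup.coe_mul, Subgroup.coe_inv, eq_inv_mul_iff_mul_eq, ← mul_assoc, h',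
          inv_mul_cancel_right]
      rw [this]
      exact SetLike.coe_mem _
    subst hk
    exact Prod.ext rfl (Subtype.ext (mul_right_cancel h'))
  · intro v
    let k : Γ ⧸ H := QuotientGroup.mk (v⁻¹ * i.out)
    have hk : (v⁻¹ * i.out)⁻¹ * k.out ∈ H := by
      rw [← QuotientGroup.eq, QuotientGroup.out_eq']
    refine ⟨(k, ⟨_, hk⟩), ?_⟩
    simp only
    group

/-- The entry with index `(i, j)` of the restriction to the orbit of `y` of an element of
`C(Y) ⋊ ℂ[Γ, ♮]`, where `y` is fixed by `H`. -/
def localEntry (a : TwistedCrossedProduct (translation Γ Y) c) (i j : Γ ⧸ H) (y : Y) :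
    TwistedGroupAlgebra H (c.restrict H) :=
  ⟨fun h => c.transfer i.out h j.out * a.coeff (i.out * h * j.out⁻¹) (i.out • y)⟩

variable (a b : TwistedCrossedProduct (translation Γ Y) c) (i j : Γ ⧸ H)

theorem coeff_localEntry (y : Y) (h : H) : (localEntry H a i j y).coeff h =
    c.transfer i.out h j.out * a.coeff (i.out * h * j.out⁻¹) (i.out • y) := rfl

theorem continuous_localEntry : Continuous (localEntry H a i j) :=
  TwistedCrossedProduct.continuous_mk.comp <| continuous_pi fun _ =>
    continuous_const.mul ((map_continuous _).comp (continuous_const_smul _))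

theorem localEntry_add (y : Y) :
    localEntry H (a + b) i j y = localEntry H a i j y + localEntry H b i j y :=
  TwistedCrossedProduct.ext fun _ => mul_add _ _ _

theorem localEntry_sub (y : Y) :
    localEntry H (a - b) i j y = localEntry H a i j y - localEntry H b i j y :=
  TwistedCrossedProduct.ext fun _ => mul_sub _ _ _

theorem localEntry_smul (z : ℂ) (y : Y) :
    localEntry H (z • a) i j y = z • localEntry H a i j y :=
  TwistedCrossedProduct.ext fun _ => mul_left_comm _ _ _

variable {H} in
-- The sum over Γ in the product is reindexed by pairs (k, u) through `bijective_out_mul`. Because H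
-- fixes y, the second factor gets evaluated at r_k y, and the scalars match by `transfer_mul`.
theorem localEntry_mul {y : Y} (hy : ∀ h ∈ H, h • y = y) :
    localEntry H (a * b) i j y = ∑ k, localEntry H a i k y * localEntry H b k j y := by
  let φ : H → (TwistedGroupAlgebra H (c.restrict H) →+ ℂ) := fun h =>
    ⟨⟨fun x => x.coeff h, rfl⟩, fun _ _ => rfl⟩
  refine TwistedCrossedProduct.ext fun h => ?_
  have h0 : ∀ x : TwistedGroupAlgebra H (c.restrict H), x.coeff h = φ h x := fun _ => rfl
  rw [h0 (∑ k, _), map_sum, coeff_localEntry, TwistedCrossedProduct.coeff_mul]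
  have h1 : ∀ f : Γ → C(Y, ℂ), ∀ z : Y, (∑ v, f v) z = ∑ v, f v z := fun f z => by
    rw [ContinuousMap.coe_sum, Finset.sum_apply]
  rw [h1, Finset.mul_sum, ← (bijective_out_mul H i).sum_comp, Fintype.sum_prod_type]
  refine Finset.sum_congr rfl fun k _ => ?_
  rw [← h0, TwistedCrossedProduct.coeff_mul]
  refine Finset.sum_congr rfl fun u _ => ?_
  rw [coeff_localEntry, MonoidHom.one_apply, StarAlgEquiv.one_apply, coeff_localEntry]
  change _ * ((c _ _ : ℂ) * (a.coeff _ _ * b.coeff _ ((i.out * u * k.out⁻¹)⁻¹ • i.out • y))) =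
    (c u (u⁻¹ * h : H) : ℂ) * _
  have e1 : (i.out * u * k.out⁻¹)⁻¹ • i.out • y = k.out • y := by
    rw [smul_smul, show (i.out * (u : Γ) * k.out⁻¹)⁻¹ * i.out = k.out * (u : Γ)⁻¹ by group,
      mul_smul, hy _ (inv_mem u.2)]
  have e2 : (i.out * u * k.out⁻¹)⁻¹ * (i.out * h * j.out⁻¹) =
      k.out * (u⁻¹ * h : H) * j.out⁻¹ := by
    push_cast
    group
  rw [e1, e2]
  have h2 := c.transfer_mul i.out u k.out (u⁻¹ * h : H) j.out
  rw [show (u : Γ) * (u⁻¹ * h : H) = h by push_cast; group] at h2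
  linear_combination (a.coeff (i.out * u * k.out⁻¹) (i.out • y) *
    b.coeff (k.out * (u⁻¹ * h : H) * j.out⁻¹) (k.out • y)) * h2

variable {H} in
theorem localEntry_star {y : Y} (hy : ∀ h ∈ H, h • y = y) :
    localEntry H (star a) i j y = star (localEntry H a j i y) := by
  refine TwistedCrossedProduct.ext fun h => ?_
  rw [coeff_localEntry, TwistedCrossedProduct.coeff_star, TwistedCrossedProduct.coeff_star,
    coeff_localEntry, MonoidHom.one_apply, StarAlgEquiv.one_apply]
  change _ * ((_ * _) * star (a.coeff _ ((i.out * h * j.out⁻¹)⁻¹ • i.out • y))) =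
    ((((c.restrict H).scale h : ℂ) ^ 2)⁻¹ * star (c (h⁻¹ : H) h : ℂ)) * _
  have e1 : (i.out * h * j.out⁻¹)⁻¹ • i.out • y = j.out • y := by
    rw [smul_smul, show (i.out * (h : Γ) * j.out⁻¹)⁻¹ * i.out = j.out * (h : Γ)⁻¹ by group,
      mul_smul, hy _ (inv_mem h.2)]
  rw [e1, c.scale_restrict, ← mul_assoc, c.transfer_star, star_mul', Subgroup.coe_inv,
    show (i.out * (h : Γ) * j.out⁻¹)⁻¹ = j.out * (h : Γ)⁻¹ * i.out⁻¹ by group]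
  ring

theorem localEntry_eq_zero_iff (y : Y) :
    localEntry H a i j y = 0 ↔ ∀ h : H, a.coeff (i.out * h * j.out⁻¹) (i.out • y) = 0 := by
  constructor
  · intro h0 h
    have h1 := coeff_localEntry H a i j y h
    rw [h0] at h1
    exact (mul_eq_zero.mp h1.symm).resolve_left (c.transfer_ne_zero _ _ _)
  · intro h0
    refine TwistedCrossedProduct.ext fun h => ?_
    rw [coeff_localEntry, h0, mul_zero]
    rfl

variable {H} in
-- Since H fixes y, every point of the orbit is some r_i y; and every w occurs as r_i u r_k⁻¹. So
-- the entries together see all values of the coefficients on the orbit.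
theorem forall_localEntry_eq_zero_iff {y : Y} (hy : ∀ h ∈ H, h • y = y) :
    (∀ i j, localEntry H a i j y = 0) ↔ ∀ w, ∀ g : Γ, a.coeff w (g • y) = 0 := by
  simp only [localEntry_eq_zero_iff]
  constructor
  · intro h0 w g
    let i : Γ ⧸ H := QuotientGroup.mk g
    have hi : i.out⁻¹ * g ∈ H := by
      rw [← QuotientGroup.eq, QuotientGroup.out_eq']
    have hg : g • y = i.out • y := by
      conv_rhs => rw [← hy _ hi]
      rw [smul_smul, mul_inv_cancel_left]
    obtain ⟨⟨k, u⟩, hw⟩ := (bijective_out_mul H i).surjective w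
    rw [hg, ← hw]
    exact h0 i k u
  · intro h0 i j h
    exact h0 _ _

end Localization
end

/-! ### The subquotient as a matrix algebra -/

noncomputable section

section MainIso

variable {Γ Y : Type*} [Group Γ] [Finite Γ] [TopologicalSpace Y] [CompactSpace Y] [T2Space Y]
  [MulAction Γ Y] [ContinuousConstSMul Γ Y]

attribute [local instance] Fintype.ofFinite

/-- A closed subset `S` of a `Γ`-space, with a closed subset `B`, such that the elements of `H` fix
`S` pointwise and all other elements of `Γ` move `S` off itself outside `B`. -/
structure IsCell (H : Subgroup Γ) (S B : Set Y) : Prop where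
  isClosed : IsClosed S
  isClosed_boundary : IsClosed B
  subset : B ⊆ S
  smul_eq : ∀ h ∈ H, ∀ y ∈ S, h • y = y
  mem_boundary : ∀ g ∉ H, ∀ y ∈ S, g • y ∈ S → g • y ∈ B

/-- The orbit map from a subset of `Y` to its image. -/
def orbitMapOn (Γ : Type*) {Y : Type*} [Group Γ] [MulAction Γ Y] (S : Set Y) (y : S) :
    orbitMap Γ '' S := ⟨orbitMap Γ y, y, y.2, rfl⟩

theorem orbitMapOn_surjective (S : Set Y) : Function.Surjective (orbitMapOn Γ S) := by
  rintro ⟨_, y, hy, rfl⟩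
  exact ⟨⟨y, hy⟩, rfl⟩

namespace IsCell

variable {H : Subgroup Γ} {S B : Set Y} (hS : IsCell H S B)

include hS

theorem isQuotientMap_orbitMapOn : Topology.IsQuotientMap (orbitMapOn Γ S) := by
  have : CompactSpace S := isCompact_iff_compactSpace.mp hS.isClosed.isCompact
  have hc : Continuous (orbitMapOn Γ S) :=
    Continuous.subtype_mk (continuous_orbitMap.comp continuous_subtype_val) _
  exact hc.isClosedMap.isQuotientMap hc (orbitMapOn_surjective S)

theorem mem_boundary_of_smul_mem {g : Γ} {y : Y} (hy : y ∈ B) (h : g • y ∈ S) : g • y ∈ B := by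
  by_cases hg : g ∈ H
  · rwa [hS.smul_eq g hg y (hS.subset hy)]
  · exact hS.mem_boundary g hg y (hS.subset hy) h

theorem orbitMap_mem_image_iff {y : Y} (hy : y ∈ S) : orbitMap Γ y ∈ orbitMap Γ '' B ↔ y ∈ B := by
  refine ⟨?_, fun h => ⟨y, h, rfl⟩⟩
  rintro ⟨z, hz, hzy⟩
  obtain ⟨g, rfl⟩ := orbitMap_eq_iff.mp hzy.symm
  exact hS.mem_boundary_of_smul_mem hz hy

/-- Two points of S in the same orbit are either equal or both in B, where f vanishes. So f is
constant on the fibres of the orbit map, which is a quotient map from a compact to a Hausdorff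
space. -/
theorem exists_descend {N : Type*} [NonUnitalCStarAlgebra N] [CompactSpace (orbitMap Γ '' S)]
    (f : C(S, N)) (hf : ∀ y : S, (y : Y) ∈ B → f y = 0) :
    ∃ F : RelC0 ((↑) ⁻¹' (orbitMap Γ '' B) : Set (orbitMap Γ '' S)) N,
      ∀ y, F.1 (orbitMapOn Γ S y) = f y := by
  have hfac : Function.FactorsThrough f (orbitMapOn Γ S) := by
    intro y z hyz
    obtain ⟨g, hg⟩ := orbitMap_eq_iff.mp (congrArg Subtype.val hyz)
    by_cases hgH : g ∈ H
    · congr 1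
      exact Subtype.ext (hg.symm.trans (hS.smul_eq g hgH z z.2))
    · have hy : (y : Y) ∈ B := hg ▸ hS.mem_boundary g hgH z z.2 (hg.symm ▸ y.2)
      have hz : (z : Y) ∈ B := by
        rw [← hS.orbitMap_mem_image_iff z.2]
        exact ⟨y, hy, congrArg Subtype.val hyz⟩
      rw [hf y hy, hf z hz]
  let q : C(S, orbitMap Γ '' S) := ⟨_, hS.isQuotientMap_orbitMapOn.continuous⟩
  refine ⟨⟨hS.isQuotientMap_orbitMapOn.lift (f := q) f hfac, ?_⟩, fun y => ?_⟩
  · intro z hz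
    obtain ⟨y, rfl⟩ := orbitMapOn_surjective S z
    have h := congrArg (fun F : C(S, N) => F y)
      (Topology.IsQuotientMap.lift_comp (f := q) hS.isQuotientMap_orbitMapOn f hfac)
    refine h.trans (hf y ?_)
    exact (hS.orbitMap_mem_image_iff y.2).mp hz
  · exact congrArg (fun F : C(S, N) => F y)
      (Topology.IsQuotientMap.lift_comp (f := q) hS.isQuotientMap_orbitMapOn f hfac)

/-- The translates of S by elements outside H meet S only in B, where f vanishes. Thus f on S and 0
on these finitely many closed translates fit together continuously, and Tietze's theorem extends the
result to Y. -/
theorem exists_extend (f : C(S, ℂ)) (hf : ∀ y : S, (y : Y) ∈ B → f y = 0) :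
    ∃ F : C(Y, ℂ), (∀ y : S, F y = f y) ∧ ∀ g ∉ H, ∀ y : S, F (g • (y : Y)) = 0 := by
  classical
  let K : Set Y := ⋃ g : (Hᶜ : Set Γ), (fun y => (g : Γ) • y) '' S
  have hK : IsClosed K := isClosed_iUnion_of_finite fun g =>
    (Homeomorph.smul (g : Γ)).isClosedMap _ hS.isClosed
  let φ : Y → ℂ := fun y => if h : y ∈ S then f ⟨y, h⟩ else 0
  have hφS : ∀ y : S, φ y = f y := fun y => dif_pos y.2
  have hφK : ∀ y ∈ K, φ y = 0 := by
    intro y hy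
    obtain ⟨⟨g, hg⟩, z, hz, rfl⟩ := Set.mem_iUnion.mp hy
    by_cases h : g • z ∈ S
    · exact (dif_pos h).trans (hf _ (hS.mem_boundary g hg z hz h))
    · exact dif_neg h
  have h1 : ContinuousOn φ S := by
    rw [continuousOn_iff_continuous_domRestrict]
    have : S.domRestrict φ = f := funext hφS
    rw [this]
    exact f.continuous
  have h2 : ContinuousOn φ K := (continuousOn_const (c := 0)).congr hφK
  have h3 : ContinuousOn φ (S ∪ K) := h1.union_of_isClosed h2 hS.isClosed hK
  obtain ⟨F, hF⟩ := ContinuousMap.exists_restrict_eq (hS.isClosed.union hK)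
    (⟨(S ∪ K).domRestrict φ, continuousOn_iff_continuous_domRestrict.mp h3⟩ : C(_, ℂ))
  have hFφ : ∀ y ∈ S ∪ K, F y = φ y := fun y hy =>
    congrArg (fun f : C((S ∪ K : Set Y), ℂ) => f ⟨y, hy⟩) hF
  refine ⟨F, fun y => ?_, fun g hg y => ?_⟩
  · rw [hFφ y (Or.inl y.2), hφS]
  · have : g • (y : Y) ∈ K := Set.mem_iUnion.mpr ⟨⟨g, hg⟩, y, y.2, rfl⟩
    rw [hFφ _ (Or.inr this), hφK _ this]

variable {c : TwoCocycle Γ}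

/-- Each w is r_i h r_k⁻¹ for a unique (k, h), so the prescribed (i, k) entry dictates the
coefficient at w on r_i S. The function F i w encodes this on S and vanishes on gS for g outside H;
hence, in the sum of the translates r_i F i w, only the summand of the coset of g contributes on gS.
-/
theorem exists_localEntry_eq
    (f : Γ ⧸ H → Γ ⧸ H → C(S, TwistedGroupAlgebra H (c.restrict H)))
    (hf : ∀ i j, ∀ y : S, (y : Y) ∈ B → f i j y = 0) :
    ∃ a ∈ relIdeal c (orbitMap Γ '' B), ∀ i j, ∀ y : S, localEntry H a i j y = f i j y := by
  have h1 : ∀ (i : Γ ⧸ H) (w : Γ), ∃ F : C(Y, ℂ),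
      (∀ (y : S), F y = (c.transfer i.out ((bijective_out_mul H i).surjective w).choose.2
        ((bijective_out_mul H i).surjective w).choose.1.out)⁻¹ *
        (f i ((bijective_out_mul H i).surjective w).choose.1 y).coeff
          ((bijective_out_mul H i).surjective w).choose.2) ∧
      (∀ h ∈ H, ∀ y : S, F (h • (y : Y)) = F y) ∧
      ∀ g ∉ H, ∀ y : S, F (g • (y : Y)) = 0 := by
    intro i w
    obtain ⟨F, hF, hF'⟩ := hS.exists_extend ⟨fun y =>
      (c.transfer i.out ((bijective_out_mul H i).surjective w).choose.2
        ((bijective_out_mul H i).surjective w).choose.1.out)⁻¹ *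
        (f i ((bijective_out_mul H i).surjective w).choose.1 y).coeff
          ((bijective_out_mul H i).surjective w).choose.2,
      continuous_const.mul ((TwistedCrossedProduct.continuous_coeff _).comp (map_continuous _))⟩
      (fun y hy => by
        rw [ContinuousMap.coe_mk, hf _ _ y hy]
        exact mul_zero _)
    exact ⟨F, hF, fun h hh y => by rw [hS.smul_eq h hh y y.2], hF'⟩
  choose F hF1 hF2 hF3 using h1
  let a : TwistedCrossedProduct (translation Γ Y) c :=
    ⟨fun w => ∑ i : Γ ⧸ H, translation Γ Y i.out (F i w)⟩
  have ha : ∀ (w g : Γ) (y : S), a.coeff w (g • (y : Y)) = F (QuotientGroup.mk g) w y := by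
    intro w g y
    change (∑ i : Γ ⧸ H, translation Γ Y i.out (F i w)) (g • (y : Y)) = _
    rw [ContinuousMap.coe_sum, Finset.sum_apply, Finset.sum_eq_single (QuotientGroup.mk g)]
    · rw [translation_apply, smul_smul, hF2]
      rw [← QuotientGroup.eq, QuotientGroup.out_eq']
    · intro i _ hi
      rw [translation_apply, smul_smul, hF3]
      rw [← QuotientGroup.eq, QuotientGroup.out_eq']
      exact hi
    · simp
  refine ⟨a, ?_, fun i j y => TwistedCrossedProduct.ext fun h => ?_⟩
  · rw [mem_relIdeal_image_iff hS.isClosed_boundary]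
    intro w g y hy
    rw [ha w g ⟨y, hS.subset hy⟩, hF1, hf _ _ _ hy]
    exact mul_zero _
  · rw [coeff_localEntry, ha, QuotientGroup.out_eq', hF1]
    have hspec := ((bijective_out_mul H i).surjective (i.out * h * j.out⁻¹)).choose_spec
    -- The pair chosen for r_i h r_j⁻¹ is (j, h) by injectivity, so the factor built into F cancels
    -- the scalar in `localEntry`.
    have hp : ((bijective_out_mul H i).surjective (i.out * h * j.out⁻¹)).choose = (j, h) :=
      (bijective_out_mul H i).injective hspec
    rw [hp]
    exact mul_inv_cancel_left₀ (c.transfer_ne_zero _ _ _) _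

end IsCell

/-- The first isomorphism theorem for ⋆-algebras, with no condition on norms: between C⋆-algebras
the resulting isomorphism is automatically isometric. -/
theorem CStarQuotient.nonempty_starAlgEquiv {A M : Type*} [NonUnitalCStarAlgebra A]
    [NonUnitalNonAssocSemiring M] [Star M] [Module ℂ M] {I : NonUnitalStarSubalgebra ℂ A}
    [IsClosedIdeal I] (φ : A → M) (hadd : ∀ a b, φ (a + b) = φ a + φ b)
    (hsmul : ∀ (z : ℂ) a, φ (z • a) = z • φ a) (hmul : ∀ a b, φ (a * b) = φ a * φ b)
    (hstar : ∀ a, φ (star a) = star (φ a)) (hsurj : Function.Surjective φ)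
    (hker : ∀ a b, φ a = φ b ↔ a - b ∈ I) :
    Nonempty (CStarQuotient I ≃⋆ₐ[ℂ] M) := by
  let ψ : CStarQuotient I → M := fun x => φ (mk_surjective x).choose
  have hψ : ∀ a, ψ (mk I a) = φ a := fun a =>
    (hker _ _).mpr (mk_eq_iff.mp (mk_surjective (mk I a)).choose_spec)
  have hbij : Function.Bijective ψ := by
    constructor
    · intro x y h
      obtain ⟨a, rfl⟩ := mk_surjective x
      obtain ⟨b, rfl⟩ := mk_surjective y
      rw [hψ, hψ, hker] at h
      exact mk_eq_iff.mpr h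
    · intro m
      obtain ⟨a, rfl⟩ := hsurj m
      exact ⟨mk I a, hψ a⟩
  exact ⟨{ Equiv.ofBijective ψ hbij with
    map_mul' := fun x y => by
      obtain ⟨a, rfl⟩ := mk_surjective x
      obtain ⟨b, rfl⟩ := mk_surjective y
      change ψ _ = ψ _ * ψ _
      rw [← mk_mul, hψ, hψ, hψ, hmul]
    map_add' := fun x y => by
      obtain ⟨a, rfl⟩ := mk_surjective x
      obtain ⟨b, rfl⟩ := mk_surjective y
      change ψ _ = ψ _ + ψ _
      rw [← map_add, hψ, hψ, hψ, hadd]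
    map_star' := fun x => by
      obtain ⟨a, rfl⟩ := mk_surjective x
      change ψ _ = star (ψ _)
      rw [← mk_star, hψ, hψ, hstar]
    map_smul' := fun z x => by
      obtain ⟨a, rfl⟩ := mk_surjective x
      change ψ _ = z • (ψ _)
      rw [← map_smul, hψ, hψ, hsmul] }⟩

end MainIso
end

noncomputable section

section MainIso

/-- Surjectivity of q means that a matrix of functions on T is determined by its values at the
points q y, so every identity can be checked pointwise on P. -/
theorem CStarQuotient.nonempty_starAlgEquiv_matrix {A T N ι P : Type*} [NonUnitalCStarAlgebra A]
    {I : NonUnitalStarSubalgebra ℂ A} [IsClosedIdeal I] [TopologicalSpace T] [CompactSpace T]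
    (Z : Set T) [CStarAlgebra N] [Fintype ι] {q : P → T} (hq : Function.Surjective q)
    (e : A → ι → ι → P → N) (he : ∀ a i j, ∃ F : RelC0 Z N, ∀ y, F.1 (q y) = e a i j y)
    (hadd : ∀ a b i j y, e (a + b) i j y = e a i j y + e b i j y)
    (hsmul : ∀ (z : ℂ) a i j y, e (z • a) i j y = z • e a i j y)
    (hmul : ∀ a b i j y, e (a * b) i j y = ∑ k, e a i k y * e b k j y)
    (hstar : ∀ a i j y, e (star a) i j y = star (e a j i y))
    (hsurj : ∀ M : ι → ι → RelC0 Z N, ∃ a, ∀ i j y, e a i j y = (M i j).1 (q y))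
    (hker : ∀ a b, (∀ i j y, e a i j y = e b i j y) ↔ a - b ∈ I) :
    Nonempty (CStarQuotient I ≃⋆ₐ[ℂ] CStarMatrix ι ι (RelC0 Z N)) := by
  obtain ⟨Φ, hev⟩ : ∃ Φ : A → CStarMatrix ι ι (RelC0 Z N),
      ∀ a i j y, RelC0.eval Z N (q y) (Φ a i j) = e a i j y := by
    choose Φ hΦ using he
    exact ⟨fun a => CStarMatrix.ofMatrix (Matrix.of (Φ a)), hΦ⟩
  have hext : ∀ M M' : CStarMatrix ι ι (RelC0 Z N),
      (∀ i j y, RelC0.eval Z N (q y) (M i j) = RelC0.eval Z N (q y) (M' i j)) → M = M' := by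
    intro M M' h
    refine Matrix.ext fun i j => RelC0.ext fun z => ?_
    obtain ⟨y, rfl⟩ := hq z
    exact h i j y
  refine CStarQuotient.nonempty_starAlgEquiv Φ ?_ ?_ ?_ ?_ ?_ ?_
  · intro a b
    refine hext _ _ fun i j y => ?_
    rw [CStarMatrix.add_apply]
    simp only [map_add, hev, hadd]
  · intro z a
    refine hext _ _ fun i j y => ?_
    rw [CStarMatrix.smul_apply, RelC0.eval_smul]
    simp only [hev, hsmul]
  · intro a b
    refine hext _ _ fun i j y => ?_
    rw [CStarMatrix.mul_apply, map_sum]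
    simp only [RelC0.eval_mul, hev, hmul]
  · intro a
    refine hext _ _ fun i j y => ?_
    rw [CStarMatrix.star_apply, RelC0.eval_star]
    simp only [hev, hstar]
  · intro M
    obtain ⟨a, hM⟩ := hsurj M
    refine ⟨a, hext _ _ fun i j y => ?_⟩
    rw [hev]
    exact hM i j y
  · intro a b
    rw [← hker]
    constructor
    · intro h i j y
      have h2 := congrArg (fun M => RelC0.eval Z N (q y) (M i j)) h
      simpa only [hev] using h2
    · intro h
      refine hext _ _ fun i j y => ?_
      simp only [hev, h]

variable {Γ Y : Type*} [Group Γ] [Finite Γ] [TopologicalSpace Y] [CompactSpace Y] [T2Space Y]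
  [MulAction Γ Y] [ContinuousConstSMul Γ Y]

attribute [local instance] Fintype.ofFinite

namespace IsCell

variable {H : Subgroup Γ} {S B : Set Y} (hS : IsCell H S B) (c : TwoCocycle Γ)

include hS

/-- Elements of the first ideal vanish on the orbits of B, so their local entries descend to
functions on the image of S vanishing on the image of B. All local entries vanish exactly when the
coefficients vanish on the orbits of S, which is membership in the second ideal. -/
theorem nonempty_starAlgEquiv {Z₁ Z₂ : Set (OrbitSpace Γ Y)} [CompactSpace Z₂]
    (h₁ : orbitMap Γ '' B = Z₁) (h₂ : orbitMap Γ '' S = Z₂) :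
    Nonempty (RelSubquotient c Z₁ Z₂ ≃⋆ₐ[ℂ] CStarMatrix (Γ ⧸ H) (Γ ⧸ H)
      (RelC0 ((↑) ⁻¹' Z₁ : Set Z₂) (TwistedGroupAlgebra H (c.restrict H)))) := by
  subst h₁ h₂
  have hfix : ∀ y : S, ∀ h ∈ H, h • (y : Y) = y := fun y h hh => hS.smul_eq h hh y y.2
  refine CStarQuotient.nonempty_starAlgEquiv_matrix _ (orbitMapOn_surjective (Γ := Γ) S)
    (fun a i j y => localEntry H a.1 i j y) ?_ ?_ ?_ ?_ ?_ ?_ ?_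
  · intro a i j
    refine hS.exists_descend ⟨fun y => localEntry H a.1 i j y,
      (continuous_localEntry H a.1 i j).comp continuous_subtype_val⟩ fun y hy => ?_
    exact (forall_localEntry_eq_zero_iff a.1 (hfix y)).mpr (fun w g =>
      (mem_relIdeal_image_iff hS.isClosed_boundary).mp a.2 w g y hy) i j
  · exact fun a b i j y => localEntry_add H a.1 b.1 i j y
  · exact fun z a i j y => localEntry_smul H a.1 i j z y
  · exact fun a b i j y => localEntry_mul a.1 b.1 i j (hfix y)
  · exact fun a i j y => localEntry_star a.1 i j (hfix y)
  · intro M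
    have : ∀ i j, Continuous fun y => (M i j).1 (orbitMapOn Γ S y) := fun i j =>
      (map_continuous (M i j).1).comp hS.isQuotientMap_orbitMapOn.continuous
    obtain ⟨a, ha, hM⟩ := hS.exists_localEntry_eq (c := c)
      (fun i j => ⟨fun y => (M i j).1 (orbitMapOn Γ S y), this i j⟩)
      (fun i j y hy => (M i j).2 _ ⟨y, hy, rfl⟩)
    exact ⟨⟨a, ha⟩, hM⟩
  · intro a b
    have e1 : a - b ∈ idealInside (relIdeal c (orbitMap Γ '' S)) (relIdeal c (orbitMap Γ '' B)) ↔
        a.1 - b.1 ∈ relIdeal c (orbitMap Γ '' S) := Iff.rfl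
    rw [e1, mem_relIdeal_image_iff hS.isClosed]
    constructor
    · intro h w g y hy
      refine (forall_localEntry_eq_zero_iff _ (hfix ⟨y, hy⟩)).mp (fun i j => ?_) w g
      rw [localEntry_sub, h i j ⟨y, hy⟩, sub_self]
    · intro h i j y
      rw [← sub_eq_zero, ← localEntry_sub]
      exact (forall_localEntry_eq_zero_iff _ (hfix y)).mpr (fun w g => h w g y y.2) i j

end IsCell

end MainIso
end

/-! ### Barycentric coordinates and barycenters -/

noncomputable section

section AffineIndependent

variable {E : Type*} [AddCommGroup E] [Module ℝ E] {s : Finset E}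

theorem AffineIndependent.eq_of_sum_smul_eq (hs : AffineIndependent ℝ ((↑) : s → E))
    {w w' : E → ℝ} (h1 : ∑ x ∈ s, w x = ∑ x ∈ s, w' x)
    (h2 : ∑ x ∈ s, w x • x = ∑ x ∈ s, w' x • x) {x : E} (hx : x ∈ s) : w x = w' x := by
  rw [affineIndependent_iff] at hs
  have := hs Finset.univ (fun x => w x - w' x) ?_ ?_ ⟨x, hx⟩ (Finset.mem_univ _)
  · exact sub_eq_zero.mp this
  · rw [Finset.sum_coe_sort s (fun x => w x - w' x), Finset.sum_sub_distrib, h1, sub_self]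
  · rw [Finset.sum_coe_sort s (fun x => (w x - w' x) • x)]
    simp only [sub_smul]
    rw [Finset.sum_sub_distrib, h2, sub_self]

theorem AffineIndependent.weight_eq_zero (hs : AffineIndependent ℝ ((↑) : s → E)) {t : Finset E}
    (hts : t ⊆ s) {w : E → ℝ} (h1 : ∑ x ∈ s, w x = 1)
    (h2 : ∑ x ∈ s, w x • x ∈ convexHull ℝ (t : Set E)) {x : E} (hx : x ∈ s) (hxt : x ∉ t) :
    w x = 0 := by
  classical
  obtain ⟨u, -, hu1, hu2⟩ := Finset.mem_convexHull'.mp h2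
  have := hs.eq_of_sum_smul_eq (w := w) (w' := fun x => if x ∈ t then u x else 0) ?_ ?_ hx
  · rwa [if_neg hxt] at this
  · rw [Finset.sum_ite_mem, Finset.inter_eq_right.mpr hts, hu1, h1]
  · simp only [ite_smul, zero_smul]
    rw [Finset.sum_ite_mem, Finset.inter_eq_right.mpr hts, hu2]

theorem AffineIndependent.mem_of_mem_convexHull (hs : AffineIndependent ℝ ((↑) : s → E))
    {t : Finset E} (hts : t ⊆ s) {x : E} (hx : x ∈ s) (hxt : x ∈ convexHull ℝ (t : Set E)) :
    x ∈ t := by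
  classical
  by_contra h
  have := hs.weight_eq_zero hts (w := Pi.single x 1) ?_ ?_ hx h
  · simp at this
  · simp [hx]
  · rw [Finset.sum_eq_single x]
    · simpa using hxt
    · intro y _ hy
      simp [hy]
    · exact fun h => absurd hx h

/-- The barycenter of a finite set of points. -/
def barycenter (s : Finset E) : E := ∑ x ∈ s, (s.card : ℝ)⁻¹ • x

theorem barycenter_mem_convexHull (hs : s.Nonempty) :
    barycenter s ∈ convexHull ℝ (s : Set E) :=
  Finset.mem_convexHull'.mpr ⟨fun _ => (s.card : ℝ)⁻¹, fun _ _ => by positivity, by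
    rw [Finset.sum_const, nsmul_eq_mul, mul_inv_cancel₀]
    exact_mod_cast hs.card_pos.ne', rfl⟩

/-- Every barycentric coordinate of the midpoint is at least 1/(2|s|), hence positive, whereas a
point of a proper face has a vanishing coordinate. This moves an arbitrary point of a simplex to an
interior one. -/
theorem AffineIndependent.midpoint_barycenter_notMem (hs : AffineIndependent ℝ ((↑) : s → E))
    {x : E} (hx : x ∈ convexHull ℝ (s : Set E)) {t : Finset E} (ht : t ⊂ s) :
    midpoint ℝ x (barycenter s) ∉ convexHull ℝ (t : Set E) := by
  intro h
  obtain ⟨v, hv, hvt⟩ := Finset.exists_of_ssubset ht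
  obtain ⟨w, hw0, hw1, rfl⟩ := Finset.mem_convexHull'.mp hx
  have hpos : (0 : ℝ) < (s.card : ℝ)⁻¹ := by
    have : 0 < s.card := Finset.card_pos.mpr ⟨v, hv⟩
    positivity
  have := hs.weight_eq_zero ht.1 (w := fun x => (1 / 2 : ℝ) * (w x + (s.card : ℝ)⁻¹)) ?_ ?_ hv hvt
  · have := hw0 v hv
    linarith
  · rw [← Finset.mul_sum, Finset.sum_add_distrib, hw1, Finset.sum_const, nsmul_eq_mul,
      mul_inv_cancel₀ (by rintro h; simp [h] at hpos)]
    norm_num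
  · convert h using 1
    rw [midpoint_eq_smul_add, barycenter, ← Finset.sum_add_distrib, Finset.smul_sum]
    refine Finset.sum_congr rfl fun x _ => ?_
    rw [← add_smul, smul_smul]
    norm_num

/-- A map of the finite set s onto itself is a permutation, and affine maps preserve averages. -/
theorem AffineMap.map_barycenter (φ : E →ᵃ[ℝ] E) (h : φ '' (s : Set E) = s) (hs : s.Nonempty) :
    φ (barycenter s) = barycenter s := by
  classical
  have himg : s.image φ = s := by
    rw [← Finset.coe_inj, Finset.coe_image, h]
  have hinj : Set.InjOn φ s := Finset.injOn_of_card_image_eq (by rw [himg])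
  have hφ : ∀ x, φ x = φ.linear x + φ 0 := fun x => by
    have := φ.map_vadd 0 x
    simpa using this
  have hn : (s.card : ℝ) ≠ 0 := by exact_mod_cast hs.card_pos.ne'
  have h1 : ∑ x ∈ s, φ x = ∑ x ∈ s, x := by
    conv_rhs => rw [← himg, Finset.sum_image hinj]
  have h2 : ∑ x ∈ s, x = φ.linear (∑ x ∈ s, x) + (s.card : ℝ) • φ 0 := by
    conv_lhs => rw [← h1, Finset.sum_congr rfl fun x _ => hφ x]
    rw [Finset.sum_add_distrib, Finset.sum_const, map_sum, Nat.cast_smul_eq_nsmul]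
  rw [hφ, barycenter, ← Finset.smul_sum, map_smul]
  conv_rhs => rw [h2, smul_add, inv_smul_smul₀ hn]

end AffineIndependent

/-! ### Simplices of an equivariant triangulation are cells -/

namespace EquivariantTriangulation

variable {Γ Y E : Type*} [Group Γ] [TopologicalSpace Y] [MulAction Γ Y]
  [NormedAddCommGroup E] [NormedSpace ℝ E] (T : EquivariantTriangulation Γ Y E) {s t : Finset E}

theorem exists_homeo_eq (hs : s ∈ T.complex.faces) {x : E} (hx : x ∈ convexHull ℝ (s : Set E)) :
    ∃ y, (T.homeo y : E) = x :=
  ⟨T.homeo.symm ⟨x, Geometry.SimplicialComplex.convexHull_subset_space hs hx⟩, by simp⟩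

theorem homeo_inj {y z : Y} (h : (T.homeo y : E) = T.homeo z) : y = z :=
  T.homeo.injective (Subtype.ext h)

/-- A vertex of s lies in the hull of t, hence in that of s ∩ t; by affine independence it belongs
to s ∩ t. -/
theorem eq_of_simplex_eq (hs : s ∈ T.complex.faces) (ht : t ∈ T.complex.faces)
    (h : T.simplex s = T.simplex t) : s = t := by
  classical
  have key : ∀ {s t : Finset E}, s ∈ T.complex.faces → t ∈ T.complex.faces →
      T.simplex s = T.simplex t → s ⊆ t := by
    intro s t hs ht h x hx
    have hxs : x ∈ convexHull ℝ (s : Set E) := subset_convexHull ℝ _ hx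
    obtain ⟨y, rfl⟩ := T.exists_homeo_eq hs hxs
    have hyt : y ∈ T.simplex t := h ▸ hxs
    have := T.complex.inter_subset_convexHull hs ht ⟨hxs, hyt⟩
    rw [← Finset.coe_inter] at this
    exact (Finset.mem_inter.mp ((T.complex.indep hs).mem_of_mem_convexHull
      Finset.inter_subset_left hx this)).2
  exact (key hs ht h).antisymm (key ht hs h.symm)

theorem smul_simplex_eq {g : Γ} (hs : s ∈ T.complex.faces) {φ : E →ᵃ[ℝ] E}
    (hφ : φ '' (s : Set E) = t)
    (hφg : ∀ y : Y, (T.homeo y : E) ∈ convexHull ℝ (s : Set E) →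
      (T.homeo (g • y) : E) = φ (T.homeo y)) :
    g • T.simplex s = T.simplex t := by
  have himg : φ '' convexHull ℝ (s : Set E) = convexHull ℝ (t : Set E) := by
    rw [AffineMap.image_convexHull, hφ]
  ext z
  constructor
  · rintro ⟨y, hy, rfl⟩
    change (T.homeo (g • y) : E) ∈ convexHull ℝ (t : Set E)
    rw [hφg y hy, ← himg]
    exact ⟨_, hy, rfl⟩
  · intro hz
    change (T.homeo z : E) ∈ convexHull ℝ (t : Set E) at hz
    rw [← himg] at hz
    obtain ⟨x, hx, hxz⟩ := hz
    obtain ⟨y, rfl⟩ := T.exists_homeo_eq hs hx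
    exact ⟨y, hx, T.homeo_inj ((hφg y hx).trans hxz)⟩

/-- The affine map φ through which g acts permutes the vertices, so g fixes the barycenter b. The
midpoint m of y and b is interior and thus has the same stabilizer as b. As φ fixes both b and m, it
fixes y. -/
theorem smul_eq_of_mem_simplexStabilizer (hs : s ∈ T.complex.faces) {g : Γ}
    (hg : g ∈ T.simplexStabilizer s) {y : Y} (hy : y ∈ T.simplex s) : g • y = y := by
  obtain ⟨t, ht, φ, hφ, hφg⟩ := T.simplicial g s hs
  have hst : s = t := T.eq_of_simplex_eq hs ht
    ((MulAction.mem_stabilizer_iff.mp hg).symm.trans (T.smul_simplex_eq hs hφ hφg))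
  subst hst
  have hne := T.complex.nonempty_of_mem_faces hs
  have hφb := φ.map_barycenter hφ hne
  have hb := barycenter_mem_convexHull hne
  obtain ⟨b, hb'⟩ := T.exists_homeo_eq hs hb
  have hm := (convex_convexHull ℝ (s : Set E)).midpoint_mem hy hb
  obtain ⟨m, hm'⟩ := T.exists_homeo_eq hs hm
  have hind := T.complex.indep hs
  have hstab := T.stabilizer_eq s hs b m (hb' ▸ hb) (hm' ▸ hm)
    (fun t ht => by
      rw [hb', ← midpoint_self ℝ (barycenter s)]
      exact hind.midpoint_barycenter_notMem hb ht)
    (fun t ht => by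
      rw [hm']
      exact hind.midpoint_barycenter_notMem hy ht)
  have hgb : g ∈ MulAction.stabilizer Γ b := by
    refine T.homeo_inj ?_
    rw [hφg b (hb' ▸ hb), hb', hφb]
  rw [hstab] at hgb
  have h1 := hφg m (hm' ▸ hm)
  rw [MulAction.mem_stabilizer_iff.mp hgb, hm', AffineMap.map_midpoint, hφb] at h1
  refine T.homeo_inj ?_
  rw [hφg y hy]
  rw [midpoint_eq_midpoint_iff_vsub_eq_vsub, vsub_self, vsub_eq_zero_iff_eq] at h1
  exact h1.symm

/-- The point g y lies in τ' and in gτ', hence in the common face spanned by s ∩ t, which is proper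
because gτ' differs from τ'. -/
theorem smul_mem_boundary (hs : s ∈ T.complex.faces) {g : Γ}
    (hg : g ∉ T.simplexStabilizer s) {y : Y} (hy : y ∈ T.simplex s) (hgy : g • y ∈ T.simplex s) :
    g • y ∈ T.boundary s := by
  classical
  obtain ⟨t, ht, φ, hφ, hφg⟩ := T.simplicial g s hs
  have h1 := T.smul_simplex_eq hs hφ hφg
  have hgt : g • y ∈ T.simplex t := h1 ▸ Set.smul_mem_smul_set hy
  have hmem := T.complex.inter_subset_convexHull hs ht ⟨hgy, hgt⟩
  rw [← Finset.coe_inter] at hmem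
  refine ⟨s ∩ t, Finset.inter_subset_left.ssubset_of_ne fun hst => hg ?_, hmem⟩
  have himg : s.image φ = t := by rw [← Finset.coe_inj, Finset.coe_image, hφ]
  -- If s ∩ t = s then s ⊆ t, while t is the image of s under φ and has at most |s| vertices.
  have : s = t := Finset.eq_of_subset_of_card_le (Finset.inter_eq_left.mp hst)
    (himg ▸ Finset.card_image_le)
  subst this
  exact h1

theorem isClosed_simplex (s : Finset E) : IsClosed (T.simplex s) :=
  (s.finite_toSet.isCompact_convexHull ℝ).isClosed.preimage
    (continuous_subtype_val.comp T.homeo.continuous)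

theorem isClosed_boundary (s : Finset E) : IsClosed (T.boundary s) := by
  classical
  have : T.boundary s = ⋃ t ∈ s.ssubsets, T.simplex t := by
    ext y
    simp [boundary, simplex]
  rw [this]
  exact isClosed_biUnion_finset fun t _ => T.isClosed_simplex t

theorem isCell (hs : s ∈ T.complex.faces) :
    IsCell (T.simplexStabilizer s) (T.simplex s) (T.boundary s) where
  isClosed := T.isClosed_simplex s
  isClosed_boundary := T.isClosed_boundary s
  subset := by
    rintro y ⟨t, ht, hy⟩
    exact convexHull_mono (Finset.coe_subset.mpr ht.1) hy
  smul_eq _ hh _ hy := T.smul_eq_of_mem_simplexStabilizer hs hh hy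
  mem_boundary _ hg _ hy hgy := T.smul_mem_boundary hs hg hy hgy

end EquivariantTriangulation
end

/-! ### Morita equivalence and K-theory of the subquotient -/

noncomputable section

instance unitaryUnramified.t2Space {L : Type*} [Group L] [TopologicalSpace L] :
    T2Space (unitaryUnramified L) :=
  unitaryUnramified.isEmbedding.t2Space

namespace EquivariantTriangulation

theorem nonempty_starAlgEquiv {Γ Y E : Type*} [Group Γ] [Finite Γ] [TopologicalSpace Y]
    [CompactSpace Y] [T2Space Y] [MulAction Γ Y] [ContinuousConstSMul Γ Y] [NormedAddCommGroup E]
    [NormedSpace ℝ E] (T : EquivariantTriangulation Γ Y E) {s : Finset E}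
    (hs : s ∈ T.complex.faces) (c : TwoCocycle Γ) :
    let _ : Fintype (Γ ⧸ T.simplexStabilizer s) := Fintype.ofFinite _
    Nonempty (RelSubquotient c (T.orbitBoundary s) (T.orbitSimplex s) ≃⋆ₐ[ℂ]
      CStarMatrix (Γ ⧸ T.simplexStabilizer s) (Γ ⧸ T.simplexStabilizer s)
        (T.simplexC0 s (TwistedGroupAlgebra (T.simplexStabilizer s)
          (c.restrict (T.simplexStabilizer s))))) :=
  (T.isCell hs).nonempty_starAlgEquiv c rfl rfl

universe u

/-- Γ and Y share a universe because `MoritaEquivalent.of_matrix` asks for a common universe of the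
algebras and the index set Γ/H. -/
theorem moritaEquivalent_and_nonempty_addEquiv {Γ Y : Type u} {E : Type*} [Group Γ] [Finite Γ]
    [TopologicalSpace Y] [CompactSpace Y] [T2Space Y] [MulAction Γ Y] [ContinuousConstSMul Γ Y]
    [NormedAddCommGroup E] [NormedSpace ℝ E] (T : EquivariantTriangulation Γ Y E) {s : Finset E}
    (hs : s ∈ T.complex.faces) (c : TwoCocycle Γ) :
    MoritaEquivalent (RelSubquotient c (T.orbitBoundary s) (T.orbitSimplex s))
        (T.simplexC0 s
          (TwistedGroupAlgebra (T.simplexStabilizer s) (c.restrict (T.simplexStabilizer s)))) ∧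
      Nonempty (K0 (RelSubquotient c (T.orbitBoundary s) (T.orbitSimplex s)) ≃+
        K0 (T.simplexC0 s ℂ) ⊗[ℤ] RepGroup
          (TwistedGroupAlgebra (T.simplexStabilizer s) (c.restrict (T.simplexStabilizer s)))) ∧
      Nonempty (K1 (RelSubquotient c (T.orbitBoundary s) (T.orbitSimplex s)) ≃+
        K1 (T.simplexC0 s ℂ) ⊗[ℤ] RepGroup
          (TwistedGroupAlgebra (T.simplexStabilizer s) (c.restrict (T.simplexStabilizer s)))) := by
  classical
  let _ : Fintype (Γ ⧸ T.simplexStabilizer s) := Fintype.ofFinite _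
  obtain ⟨Ψ⟩ := T.nonempty_starAlgEquiv hs c
  exact ⟨MoritaEquivalent.of_matrix (QuotientGroup.mk 1) Ψ, nonempty_K0_K1_addEquiv _ _ Ψ⟩

end EquivariantTriangulation

theorem lemma6p15
    {G : Type*} [Group G] [TopologicalSpace G] [IsTopologicalGroup G] [LocallyCompactSpace G]
    [TotallyDisconnectedSpace G]
    (L : Subgroup G) (hL : IsClosed (L : Set G))
    {V : Type*} [AddCommGroup V] [Module ℂ V] (σ : Representation ℂ L V)
    [Finite (extWeylGroup L σ)]
    (c : TwoCocycle (extWeylGroup L σ))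
    {E : Type*} [NormedAddCommGroup E] [NormedSpace ℝ E]
    (T : EquivariantTriangulation (extWeylGroup L σ) (unitaryUnramified L) E)
    (s : Finset E) (hs : s ∈ T.complex.faces) :
    MoritaEquivalent
        (RelSubquotient c⁻¹ (T.orbitBoundary s) (T.orbitSimplex s))
        (T.simplexC0 s
          (TwistedGroupAlgebra (T.simplexStabilizer s) (c⁻¹.restrict (T.simplexStabilizer s)))) ∧
      Nonempty
        (K0 (RelSubquotient c⁻¹ (T.orbitBoundary s) (T.orbitSimplex s)) ≃+
          K0 (T.simplexC0 s ℂ) ⊗[ℤ] RepGroup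
            (TwistedGroupAlgebra (T.simplexStabilizer s)
              (c⁻¹.restrict (T.simplexStabilizer s)))) ∧
      Nonempty
        (K1 (RelSubquotient c⁻¹ (T.orbitBoundary s) (T.orbitSimplex s)) ≃+
          K1 (T.simplexC0 s ℂ) ⊗[ℤ] RepGroup
            (TwistedGroupAlgebra (T.simplexStabilizer s)
              (c⁻¹.restrict (T.simplexStabilizer s)))) := by
  exact T.moritaEquivalent_and_nonempty_addEquiv hs c⁻¹

end
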